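/- Notation. For a positive integer $d$, let $\|\cdot\|_2$ be the Euclidean norm on $\mathbb R^d$, $\phi(t)=\log(1+e^{-t})$ the logistic loss, and $\mathrm{sgn}(t)=1$ if $t\ge 0$, $\mathrm{sgn}(t)=-1$ if $t<0$. For a Borel probability measure $P$ on $[0,1]^d\times\{-1,1\}$ let $P_X$ be its marginal on $[0,1]^d$ and $P(\cdot|x)$ the regular conditional distribution of the label given $x$; for $f$ whose restriction to $[0,1]^d$ is measurable put $$\mathcal R_P^\phi(f)=\int \phi(yf(x))\,dP(x,y),\quad \mathcal E_P^\phi(f)=\mathcal R_P^\phi(f)-\inf_g \mathcal R_P^\phi(g),\quad \mathcal R_P(f)=P(y\neq \mathrm{sgn}(f(x))),\quad \mathcal E_P(f)=\mathcal R_P(f)-\inf_g\mathcal R_P(g),$$ the infima being over all Borel measurable $g:[0,1]^d\to\mathbb R$. For $\beta,r>0$, with $k=\lceil\beta\rceil-1$ and $\lambda=\beta-\lceil\beta\rceil+1$, let $\mathcal B^\beta_r([0,1]^d)$ be the set of functions $f:[0,1]^d\to\mathbb R$ with continuous partial derivatives up to order $k$ on $[0,1]^d$ and $$\max_{|m|\le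 k}\sup_{x}|D^mf(x)|+\max_{|m|=k}\sup_{x\ne z}\frac{|D^mf(x)-D^mf(z)|}{\|x-z\|_2^\lambda}\le r .$$ Let $\mathcal H^{d,\beta,r}_1$ be the set of all Borel probability measures $P$ on $[0,1]^d\times\{-1,1\}$ for which there is $\hat\eta\in\mathcal B^\beta_r([0,1]^d)$ with $P(\{1\}|x)=\hat\eta(x)$ for $P_X$-almost every $x$ (nothing is assumed on $P_X$). Let $\mathcal F_d^{\mathbf{FNN}}(G,N,S,B,F)$ be the set of functions $f:\mathbb R^d\to\mathbb R$ of the form $f(x)=W_L\sigma_{v_L}W_{L-1}\cdots W_1\sigma_{v_1}W_0x$, where $\sigma_v(z)=\max\{z-v,0\}$ componentwise, $W_k\in\mathbb R^{m_{k+1}\times m_k}$, $v_k\in\mathbb R^{m_k}$, $m_0=d$, $m_{L+1}=1$, such that the number $L$ of hidden layers is at most $G$, the hidden widths $m_1,\dots,m_L$ are at most $N$, the total number of nonzero entries of all $W_k$ and $v_k$ is at most $S$, all these entries are at most $B$ in absolute value, and $\sup_{x\in[0,1]^d}|f(x)|\le F$. For sequences, $a_n\lesssim b_n$ means that there are $n_0\in\mathbb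 N$ and a constant $C>0$ independent of $n$ with $a_n\le C b_n$ for all $n\ge n_0$, and $a_n\asymp b_n$ means $a_n\lesssim b_n\lesssim a_n$. Theorem. Let $d$ be a positive integer and $\beta,r\in(0,\infty)$. There is a constant $\mathrm c\in(0,\infty)$ depending only on $(d,\beta,r)$ such that the following holds for every $\nu\in[0,\infty)$. Let $G=G_n,N=N_n,S=S_n,B=B_n,F=F_n$ be real sequences such that, for all sufficiently large $n$, $$\mathrm c\log n\le G,\qquad 1\le B,\qquad \tfrac{\beta}{d+\beta}\log n\le F,$$ and $$G\lesssim\log n,\quad N\asymp\Big(\tfrac{(\log n)^5}{n}\Big)^{\frac{-d}{d+\beta}},\quad S\asymp\Big(\tfrac{(\log n)^5}{n}\Big)^{\frac{-d}{d+\beta}}\log n,\quad B\lesssim n^\nu,\quad F\lesssim\log n .$$ For all sufficiently large $n$, let $\hat f_n$ be an empirical logistic risk minimizer over this class, that is, a measurable function of the sample $(X_1,Y_1),\dots,(X_n,Y_n)\in[0,1]^d\times\{-1,1\}$ with $$\hat f_n\in\mathop{\arg\min}_{f\in\mathcal F_d^{\mathbf{FNN}}(G,N,S,B,F)}\frac1n\sum_{i=1}^n\phi(Y_if(X_i)).$$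 Then $$\sup_{P\in\mathcal H_1^{d,\beta,r}}\mathbf E_{P^{\otimes n}}\big[\mathcal E_P^\phi(\hat f_n)\big]\lesssim\Big(\tfrac{(\log n)^5}{n}\Big)^{\frac{\beta}{\beta+d}} \quad\text{and}\quad \sup_{P\in\mathcal H_1^{d,\beta,r}}\mathbf E_{P^{\otimes n}}\big[\mathcal E_P(\hat f_n)\big]\lesssim\Big(\tfrac{(\log n)^5}{n}\Big)^{\frac{\beta}{2\beta+2d}},$$ where $\mathbf E_{P^{\otimes n}}$ is the expectation when the sample is i.i.d. from $P$. -/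

import Mathlib

open MeasureTheory ProbabilityTheory Filter
open scoped ENNReal

noncomputable section

/-! ### The input space, the label space and the data distributions -/

/-- The unit cube `[0,1]^d` in Euclidean space. -/
def unitCube (d : ℕ) : Set (EuclideanSpace ℝ (Fin d)) :=
  {x | ∀ i, x i ∈ Set.Icc (0 : ℝ) 1}

/-- The label space `{-1, 1}`. -/
abbrev Label : Type := ↥({-1, 1} : Set ℝ)

/-- The data space `[0,1]^d × {-1, 1}`, with its Borel (product) sigma algebra. -/
abbrev DataPoint (d : ℕ) : Type := ↥(unitCube d) × Label

/-! ### Hölder balls -/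

/-- The iterated partial derivative `∂_{I 0} ∂_{I 1} ⋯ ∂_{I (j-1)} f (x)` relative to the set `Ω`.
For a function that is `j` times continuously differentiable on the cube, the order of
differentiation does not matter, so these are exactly the derivatives `D^m f` with `|m| = j`. -/
def partialDerivWithin {d : ℕ} (Ω : Set (EuclideanSpace ℝ (Fin d)))
    (f : EuclideanSpace ℝ (Fin d) → ℝ) {j : ℕ} (I : Fin j → Fin d)
    (x : EuclideanSpace ℝ (Fin d)) : ℝ :=
  iteratedFDerivWithin ℝ j f Ω x (fun t => EuclideanSpace.single (I t) (1 : ℝ))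

/-- The Hölder norm
`max_{|m| ≤ k} ‖D^m f‖_Ω + max_{|m| = k} sup_{x ≠ z ∈ Ω} |D^m f x - D^m f z| / ‖x - z‖₂ ^ l`,
as an extended nonnegative number. -/
def holderNormOn {d : ℕ} (Ω : Set (EuclideanSpace ℝ (Fin d))) (k : ℕ) (l : ℝ)
    (f : EuclideanSpace ℝ (Fin d) → ℝ) : ℝ≥0∞ :=
  (⨆ (j : ℕ) (_ : j ≤ k) (I : Fin j → Fin d) (x ∈ Ω),
      ENNReal.ofReal |partialDerivWithin Ω f I x|) +
    ⨆ (I : Fin k → Fin d) (x ∈ Ω) (z ∈ Ω) (_ : x ≠ z),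
      ENNReal.ofReal
        (|partialDerivWithin Ω f I x - partialDerivWithin Ω f I z| / ‖x - z‖ ^ l)

/-- The closed ball of radius `r` in the Hölder space of order `β` on `Ω`, with
`k = ⌈β⌉ - 1` continuous derivatives and Hölder exponent `β - ⌈β⌉ + 1 ∈ (0, 1]`.
Only the values of the function on `Ω` matter. -/
def holderBall {d : ℕ} (Ω : Set (EuclideanSpace ℝ (Fin d))) (β r : ℝ) :
    Set (EuclideanSpace ℝ (Fin d) → ℝ) :=
  {f | ContDiffOn ℝ ((⌈β⌉₊ - 1 : ℕ) : WithTop ℕ∞) f Ω ∧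
    holderNormOn Ω (⌈β⌉₊ - 1) (β - (⌈β⌉₊ : ℝ) + 1) f ≤ ENNReal.ofReal r}

/-- The conditional probability function `x ↦ P({1} | x)` of `P`, from the regular conditional
distribution of the label given the input. -/
def condProb {d : ℕ} (P : Measure (DataPoint d)) [IsFiniteMeasure P] (x : unitCube d) : ℝ :=
  (P.condKernel x).real {y : Label | (y : ℝ) = 1}

/-- The Borel probability measures on `[0,1]^d × {-1, 1}` whose conditional probability function
agrees almost surely, for the marginal distribution on the cube, with a function in the Hölder
ball of order `β` and radius `r`. -/
def holderClass (d : ℕ) (β r : ℝ) : Set (ProbabilityMeasure (DataPoint d)) :=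
  {P | ∃ h ∈ holderBall (unitCube d) β r,
    ∀ᵐ x ∂((P : Measure (DataPoint d)).fst),
      condProb (P : Measure (DataPoint d)) x = h (x : EuclideanSpace ℝ (Fin d))}

/-! ### Fully connected ReLU networks -/

/-- `ReluNet m` is the type of ReLU networks with input dimension `m` and one output.
`output W` is the final linear map; `layer hk W v T` first sends `x` to the `k`-dimensional vector
`σ (W x - v)` and then applies the network `T`. So a network with `L` hidden layers is
`W_L σ_{v_L} W_{L-1} ⋯ W_1 σ_{v_1} W_0`. -/
inductive ReluNet : ℕ → Type
  | output {m : ℕ} (W : Matrix (Fin 1) (Fin m) ℝ) : ReluNet m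
  | layer {m k : ℕ} (hk : 0 < k) (W : Matrix (Fin k) (Fin m) ℝ) (v : Fin k → ℝ)
      (T : ReluNet k) : ReluNet m

namespace ReluNet

/-- The function computed by a network. -/
def eval : {m : ℕ} → ReluNet m → (Fin m → ℝ) → ℝ
  | _, output W, x => W.mulVec x 0
  | _, layer _ W v T, x => T.eval (fun i => max (W.mulVec x i - v i) 0)

/-- The number `L` of hidden layers. -/
def depth : {m : ℕ} → ReluNet m → ℕ
  | _, output _ => 0
  | _, layer _ _ _ T => T.depth + 1

/-- The largest width of a hidden layer (`0` if there is none). -/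
def width : {m : ℕ} → ReluNet m → ℕ
  | _, output _ => 0
  | _, layer (k := k) _ _ _ T => max k T.width

/-- The number of nonzero entries of all weight matrices and bias vectors. -/
def numNonzero : {m : ℕ} → ReluNet m → ℕ
  | _, output W => ∑ i, hammingNorm (W i)
  | _, layer _ W v T => ∑ i, hammingNorm (W i) + hammingNorm v + T.numNonzero

/-- All entries of the weight matrices and bias vectors are at most `B` in absolute value. -/
def ParamsBoundedBy (B : ℝ) : {m : ℕ} → ReluNet m → Prop
  | _, output W => ∀ i j, |W i j| ≤ B
  | _, layer _ W v T => (∀ i j, |W i j| ≤ B) ∧ (∀ i, |v i| ≤ B) ∧ T.ParamsBoundedBy B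

end ReluNet

/-- The space of fully connected ReLU networks on `ℝ^d` with depth at most `G`, width at most `N`,
at most `S` nonzero parameters, parameters bounded by `B`, and values on `[0,1]^d` bounded
by `F`. -/
def fnnClass (d : ℕ) (G N S B F : ℝ) : Set (EuclideanSpace ℝ (Fin d) → ℝ) :=
  {f | ∃ T : ReluNet d, (∀ x, f x = T.eval (fun i => x i)) ∧
    (T.depth : ℝ) ≤ G ∧ (T.width : ℝ) ≤ N ∧ (T.numNonzero : ℝ) ≤ S ∧
    T.ParamsBoundedBy B ∧ ∀ x ∈ unitCube d, |f x| ≤ F}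

/-! ### Risks and empirical risk minimizers -/

/-- The logistic loss. -/
def logisticLoss (t : ℝ) : ℝ := Real.log (1 + Real.exp (-t))

/-- The sign function with `sgn 0 = 1`. -/
def sgn (t : ℝ) : ℝ := if 0 ≤ t then 1 else -1

/-- The logistic risk `∫ φ(y f(x)) dP(x, y) ∈ [0, ∞]`. -/
def logisticRisk {d : ℕ} (P : Measure (DataPoint d)) (f : unitCube d → ℝ) : ℝ≥0∞ :=
  ∫⁻ z, ENNReal.ofReal (logisticLoss ((z.2 : ℝ) * f z.1)) ∂P

/-- The excess logistic risk. The subtracted infimum is at most `log 2` (take `g = 0`), hence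
finite, and it is at most the logistic risk of `f` for every measurable `f`. -/
def excessLogisticRisk {d : ℕ} (P : Measure (DataPoint d)) (f : unitCube d → ℝ) : ℝ≥0∞ :=
  logisticRisk P f - ⨅ (g : unitCube d → ℝ) (_ : Measurable g), logisticRisk P g

/-- The misclassification error `P(y ≠ sgn(f(x)))`. -/
def misclassError {d : ℕ} (P : Measure (DataPoint d)) (f : unitCube d → ℝ) : ℝ≥0∞ :=
  P {z | (z.2 : ℝ) ≠ sgn (f z.1)}

/-- The excess misclassification error. -/
def excessMisclassError {d : ℕ} (P : Measure (DataPoint d)) (f : unitCube d → ℝ) : ℝ≥0∞ :=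
  misclassError P f - ⨅ (g : unitCube d → ℝ) (_ : Measurable g), misclassError P g

/-- The empirical logistic risk of `f` on the sample `s`. -/
def empiricalRisk {d n : ℕ} (s : Fin n → DataPoint d) (f : EuclideanSpace ℝ (Fin d) → ℝ) : ℝ :=
  (1 / (n : ℝ)) * ∑ i, logisticLoss (((s i).2 : ℝ) * f (s i).1)

/-- `est` is an empirical logistic risk minimizer over the function class `𝓕`: for every sample `s`
the function `est s` is a minimizer of the empirical risk over `𝓕`; and `est` is a statistic, in
the sense that its value at every input is a measurable function of the sample. -/
def IsLogisticERM {d n : ℕ} (𝓕 : Set (EuclideanSpace ℝ (Fin d) → ℝ))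
    (est : (Fin n → DataPoint d) → EuclideanSpace ℝ (Fin d) → ℝ) : Prop :=
  (∀ x ∈ unitCube d, Measurable fun s => est s x) ∧
    ∀ s, est s ∈ 𝓕 ∧ ∀ f ∈ 𝓕, empiricalRisk s (est s) ≤ empiricalRisk s f

/-- The expectation, for an i.i.d. sample of size `n` from `P`, of a nonnegative functional `𝓔` of
the restriction to `[0,1]^d` of the estimator. -/
def expectedError {d n : ℕ} (P : ProbabilityMeasure (DataPoint d))
    (𝓔 : Measure (DataPoint d) → (unitCube d → ℝ) → ℝ≥0∞)
    (est : (Fin n → DataPoint d) → EuclideanSpace ℝ (Fin d) → ℝ) : ℝ≥0∞ :=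
  ∫⁻ s, 𝓔 P (fun x => est s x) ∂(Measure.pi fun _ : Fin n => (P : Measure (DataPoint d)))

/-! ### Comparison of sequences -/

/-- `a_n ≲ b_n`: there are `n₀` and `c > 0` with `a_n ≤ c * b_n` for all `n ≥ n₀`. -/
def Lesssim (a b : ℕ → ℝ) : Prop :=
  ∃ n₀ : ℕ, ∃ c : ℝ, 0 < c ∧ ∀ n ≥ n₀, a n ≤ c * b n

/-- `a_n ≍ b_n`. -/
def Asymp (a b : ℕ → ℝ) : Prop := Lesssim a b ∧ Lesssim b a

/-- The sequence `(log n)^5 / n`. -/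
def baseRate (n : ℕ) : ℝ := Real.log n ^ 5 / n

end

/-!
The logistic loss is the negative log-likelihood of the model `P(1 | x) = 1 / (1 + e^{-f(x)})`.
Hence the excess logistic risk of a score `f` is the relative entropy `klRisk P f` between the true
and the modelled conditional label distributions, averaged over the inputs
(`excessLogisticRisk_le_klRisk`), and by Pinsker's inequality the excess misclassification error is
at most of the order of its square root (`excessMisclassError_le_klRisk`). So both claims follow
from one bound on the expected value of `klRisk` at the empirical risk minimizer.

Estimation. The optimal score `log (η / (1 - η))` is unbounded, so neither a bounded target nor
the usual variance bound for the loss is available. What replaces them is that the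
log-likelihood ratio `X` of the truth to the model satisfies `E e^{-X} ≤ 1`, which turns an
upper bound `X ≤ U`, for a score bounded by `U - 1`, into
`E e^{-sX} ≤ 1 - (s / 2) E X` for `s` of order `1 / U` (`exp_moment_le`). Summing these exponential
moments over a finite cover of the class yields an oracle inequality with the fast rate
`F log M / n`, where `M` is the covering number (`lintegral_klRisk_le`). Networks with `S` nonzero
parameters are encoded by `S` positions and `S` values on a fine grid, so that `log M` is of order
`S (log n) ^ 2` for networks of logarithmic depth (`exists_cover_fnnClass`, `exists_resolution`).

Approximation. A network first computes an approximation of the Hölder function `η`, then clamps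
it to `[ε, 1 - ε]`, then applies the logit `log z - log (1 - z)`. Relative entropy is at most the
chi-square divergence, and after clamping at the level `ε` of the sup-norm error the latter is of
order `ε ^ 2 / ε = ε` (`exists_reluNet_klRisk_le`); this holds for every input distribution.
Both stages are sums of products of piecewise linear functions of one variable: partitions of unity
by hat functions times Taylor polynomials, on a uniform grid for `η` (`exists_isProdSum_holder`) and
on a geometric grid for the logit (`exists_isProdSum_logit`). With `ρ` nodes in either grid the
first error is `ρ ^ (-β / d)`, and the second one, for a Taylor polynomial of degree `⌈β / d⌉₊`, is of
smaller order up to powers of `log n`, hence negligible. The products are computed, with parameters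
at most `1`, by narrow networks that approximate `u - u ^ 2` by sums of sawtooth functions; all the
products run in parallel, and large coefficients are produced by repeated doubling
(`exists_reluNet_comp`).

With `ρ = (log n ^ 5 / n) ^ (-d / (d + β))`, the approximation error `ρ ^ (-β / d)` and the
estimation error `log n · ρ (log n) ^ 3 / n ≤ ρ (log n) ^ 5 / n` are both at most of the order of the rate.
-/

noncomputable section

/-! ### The logistic loss and the binary relative entropy -/

lemma one_add_exp_neg_pos (t : ℝ) : 0 < 1 + Real.exp (-t) := by positivity

lemma logisticLoss_nonneg (t : ℝ) : 0 ≤ logisticLoss t :=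
  Real.log_nonneg (by linarith [Real.exp_pos (-t)])

lemma logisticLoss_le_add_abs_sub (a b : ℝ) : logisticLoss a ≤ logisticLoss b + |a - b| := by
  unfold logisticLoss
  rw [← Real.log_exp |a - b|, ← Real.log_mul (one_add_exp_neg_pos b).ne' (Real.exp_pos _).ne']
  apply Real.log_le_log (one_add_exp_neg_pos a)
  have h1 : (1 : ℝ) ≤ Real.exp |a - b| := Real.one_le_exp (abs_nonneg _)
  have h2 : Real.exp (-a) ≤ Real.exp (-b) * Real.exp |a - b| := by
    rw [← Real.exp_add]
    exact Real.exp_le_exp.2 (by linarith [neg_abs_le (a - b)])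
  nlinarith

lemma logisticLoss_le_abs_add_one (t : ℝ) : logisticLoss t ≤ |t| + 1 := by
  have h := logisticLoss_le_add_abs_sub t 0
  have h0 : logisticLoss 0 ≤ 1 := by
    unfold logisticLoss
    have := Real.log_le_sub_one_of_pos (show (0 : ℝ) < 1 + Real.exp (-0) by positivity)
    simp at this ⊢
    linarith
  simp only [sub_zero] at h
  linarith

/-- The logistic sigmoid `1 / (1 + e^{-t})`, the conditional probability modelled by the
score `t`. -/
def logisticSigmoid (t : ℝ) : ℝ := (1 + Real.exp (-t))⁻¹

lemma logisticSigmoid_pos (t : ℝ) : 0 < logisticSigmoid t := inv_pos.2 (one_add_exp_neg_pos t)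

lemma logisticSigmoid_neg (t : ℝ) : logisticSigmoid (-t) = 1 - logisticSigmoid t := by
  unfold logisticSigmoid
  have h := Real.exp_pos t
  rw [neg_neg, Real.exp_neg]
  field_simp
  ring

lemma exp_neg_logisticLoss (t : ℝ) : Real.exp (-logisticLoss t) = logisticSigmoid t := by
  unfold logisticLoss logisticSigmoid
  rw [Real.exp_neg, Real.exp_log (one_add_exp_neg_pos t)]

lemma logisticLoss_eq (t : ℝ) : logisticLoss t = -Real.log (logisticSigmoid t) := by
  unfold logisticLoss logisticSigmoid
  rw [Real.log_inv, neg_neg]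

/-- The relative entropy of the Bernoulli distribution with success probability `p` with respect to
the one with success probability `logisticSigmoid v`; that is, the conditional excess logistic risk
of the score `v` when the label is `1` with probability `p`. The convention `0 log 0 = 0` is
provided by `Real.log 0 = 0`. -/
def binaryKL (p v : ℝ) : ℝ :=
  p * (logisticLoss v + Real.log p) + (1 - p) * (logisticLoss (-v) + Real.log (1 - p))

lemma binaryKL_le_add_abs_sub {p : ℝ} (hp0 : 0 ≤ p) (hp1 : p ≤ 1) (v w : ℝ) :
    binaryKL p v ≤ binaryKL p w + |v - w| := by
  have h1 := logisticLoss_le_add_abs_sub v w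
  have h2 := logisticLoss_le_add_abs_sub (-v) (-w)
  rw [show -v - -w = -(v - w) by ring, abs_neg] at h2
  unfold binaryKL
  nlinarith [mul_le_mul_of_nonneg_left h1 hp0,
    mul_le_mul_of_nonneg_left h2 (sub_nonneg.2 hp1)]

/-- One summand of the relative entropy dominates the corresponding summand of the squared
Hellinger distance, up to the linear terms that cancel in the sum. -/
lemma two_mul_sub_sqrt_le {p v : ℝ} (hp : 0 ≤ p) :
    2 * (p - √p * √(logisticSigmoid v)) ≤ p * (logisticLoss v + Real.log p) := by
  rcases hp.eq_or_lt with rfl | hp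
  · simp
  have hq := logisticSigmoid_pos v
  set q := logisticSigmoid v with hqd
  have h1 := Real.log_le_sub_one_of_pos (show 0 < √q / √p by positivity)
  rw [Real.log_div (by positivity) (by positivity), Real.log_sqrt hq.le, Real.log_sqrt hp.le] at h1
  rw [logisticLoss_eq, ← hqd]
  have h2 : p * (√q / √p) = √p * √q := by
    nth_rewrite 1 [← Real.mul_self_sqrt hp.le]
    have : √p ≠ 0 := by positivity
    field_simp
  nlinarith [mul_le_mul_of_nonneg_left h1 hp.le]

/-- A form of Pinsker's inequality. -/
lemma sq_sub_le_two_mul_binaryKL {p : ℝ} (hp0 : 0 ≤ p) (hp1 : p ≤ 1) (v : ℝ) :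
    (p - logisticSigmoid v) ^ 2 ≤ 2 * binaryKL p v := by
  have key : ∀ {a b : ℝ}, 0 ≤ a → a ≤ 1 → 0 ≤ b → b ≤ 1 →
      (a - b) ^ 2 ≤ 4 * (a + b - 2 * (√a * √b)) := by
    intro a b ha ha1 hb hb1
    have h1 := Real.sq_sqrt ha
    have h2 := Real.sq_sqrt hb
    have h3 : √a ≤ 1 := Real.sqrt_le_one.2 ha1
    have h4 : √b ≤ 1 := Real.sqrt_le_one.2 hb1
    have h5 := Real.sqrt_nonneg a
    have h6 := Real.sqrt_nonneg b
    have h7 : (√a + √b) ^ 2 ≤ 4 := by nlinarith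
    calc (a - b) ^ 2 = (√a - √b) ^ 2 * (√a + √b) ^ 2 := by
          rw [← mul_pow]; nth_rewrite 1 [← h1, ← h2]; ring
      _ ≤ (√a - √b) ^ 2 * 4 := by gcongr
      _ = 4 * (√a ^ 2 + √b ^ 2 - 2 * (√a * √b)) := by ring
      _ = 4 * (a + b - 2 * (√a * √b)) := by rw [h1, h2]
  have hq := logisticSigmoid_pos v
  have hq' := logisticSigmoid_pos (-v)
  have hn := logisticSigmoid_neg v
  have h1 := two_mul_sub_sqrt_le (v := v) hp0
  have h2 := two_mul_sub_sqrt_le (v := -v) (sub_nonneg.2 hp1)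
  have k1 := key hp0 hp1 hq.le (by linarith)
  have k2 := key (sub_nonneg.2 hp1) (by linarith) hq'.le (by linarith)
  rw [show (1 - p - logisticSigmoid (-v)) ^ 2 = (p - logisticSigmoid v) ^ 2 by rw [hn]; ring] at k2
  unfold binaryKL
  linarith

lemma binaryKL_nonneg {p : ℝ} (hp0 : 0 ≤ p) (hp1 : p ≤ 1) (v : ℝ) : 0 ≤ binaryKL p v := by
  have := sq_sub_le_two_mul_binaryKL hp0 hp1 v
  nlinarith [sq_nonneg (p - logisticSigmoid v)]

lemma binaryKL_le_abs_add_one {p : ℝ} (hp0 : 0 ≤ p) (hp1 : p ≤ 1) (v : ℝ) :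
    binaryKL p v ≤ |v| + 1 := by
  have h1 := logisticLoss_le_abs_add_one v
  have h2 := logisticLoss_le_abs_add_one (-v)
  rw [abs_neg] at h2
  have h3 := Real.log_nonpos hp0 hp1
  have h4 := Real.log_nonpos (sub_nonneg.2 hp1) (by linarith)
  unfold binaryKL
  nlinarith [mul_le_mul_of_nonneg_left (show logisticLoss v + Real.log p ≤ |v| + 1 by linarith) hp0,
    mul_le_mul_of_nonneg_left (show logisticLoss (-v) + Real.log (1 - p) ≤ |v| + 1 by linarith)
      (sub_nonneg.2 hp1)]

/-- The relative entropy is at most the chi-square divergence. -/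
lemma binaryKL_logit_le {p q : ℝ} (hp0 : 0 ≤ p) (hp1 : p ≤ 1) (hq0 : 0 < q) (hq1 : q < 1) :
    binaryKL p (Real.log q - Real.log (1 - q)) ≤ (p - q) ^ 2 / (q * (1 - q)) := by
  have hq1' : 0 < 1 - q := sub_pos.2 hq1
  have e1 : logisticLoss (Real.log q - Real.log (1 - q)) = -Real.log q := by
    rw [logisticLoss_eq, logisticSigmoid, neg_sub, Real.exp_sub, Real.exp_log hq0,
      Real.exp_log hq1', show (1 + (1 - q) / q)⁻¹ = q by field_simp; ring]
  have e2 : logisticLoss (-(Real.log q - Real.log (1 - q))) = -Real.log (1 - q) := by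
    rw [logisticLoss_eq, logisticSigmoid, neg_neg, Real.exp_sub, Real.exp_log hq0,
      Real.exp_log hq1', show (1 + q / (1 - q))⁻¹ = 1 - q by field_simp; ring]
  have key : ∀ {a b : ℝ}, 0 ≤ a → 0 < b → a * (-Real.log b + Real.log a) ≤ a * (a / b - 1) := by
    intro a b ha hb
    rcases ha.eq_or_lt with rfl | ha
    · simp
    have := Real.log_le_sub_one_of_pos (div_pos ha hb)
    rw [Real.log_div ha.ne' hb.ne'] at this
    exact mul_le_mul_of_nonneg_left (by linarith) ha.le
  unfold binaryKL
  rw [e1, e2]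
  refine (add_le_add (key hp0 hq0) (key (sub_nonneg.2 hp1) hq1')).trans (le_of_eq ?_)
  field_simp
  ring

/-! ### The exponential moment of the logistic excess loss -/

lemma exp_neg_le_quadratic {w : ℝ} (hw : 0 ≤ w) : Real.exp (-w) ≤ 1 - w + w ^ 2 / 2 := by
  have h := Real.quadratic_le_exp_of_nonneg hw
  rw [Real.exp_neg]
  have h2 : 0 < 1 - w + w ^ 2 / 2 := by nlinarith [sq_nonneg (w - 1)]
  rw [inv_le_comm₀ (Real.exp_pos w) h2]
  refine le_trans ?_ h
  rw [inv_le_iff_one_le_mul₀ h2]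
  nlinarith [sq_nonneg (w ^ 2)]

lemma sq_le_mul_exp_neg_sub {u : ℝ} (hu : 0 ≤ u) :
    u ^ 2 ≤ (2 + u) * (Real.exp (-u) - 1 + u) := by
  have hmono : MonotoneOn (fun u : ℝ => u - 2 + (2 + u) * Real.exp (-u)) (Set.Ici 0) := by
    have hd : ∀ x : ℝ, HasDerivAt (fun u : ℝ => u - 2 + (2 + u) * Real.exp (-u))
        (1 + (1 * Real.exp (-x) + (2 + x) * (Real.exp (-x) * (-1)))) x := by
      intro x
      have h1 : HasDerivAt (fun u : ℝ => Real.exp (-u)) (Real.exp (-x) * (-1)) x :=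
        (hasDerivAt_neg x).exp
      exact ((hasDerivAt_id x).sub_const 2).add (((hasDerivAt_id x).const_add 2).mul h1)
    apply monotoneOn_of_deriv_nonneg (convex_Ici 0)
    · exact fun x _ => (hd x).continuousAt.continuousWithinAt
    · exact fun x _ => (hd x).differentiableAt.differentiableWithinAt
    · intro x _
      rw [(hd x).deriv]
      have h1 := Real.add_one_le_exp x
      have h2 : Real.exp (-x) * Real.exp x = 1 := by rw [← Real.exp_add]; simp
      nlinarith [Real.exp_pos (-x)]
  have := hmono (Set.mem_Ici.2 le_rfl) (Set.mem_Ici.2 hu) hu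
  simp at this
  nlinarith

lemma four_mul_exp_half_sub_le {w : ℝ} (hw : 0 ≤ w) :
    4 * (Real.exp w - 1 - w) ≤ Real.exp (2 * w) - 1 - 2 * w := by
  have hmono : MonotoneOn (fun w : ℝ => Real.exp w ^ 2 - 4 * Real.exp w + 2 * w) (Set.Ici 0) := by
    have hd : ∀ x : ℝ, HasDerivAt (fun w : ℝ => Real.exp w ^ 2 - 4 * Real.exp w + 2 * w)
        ((2 : ℕ) * Real.exp x ^ (2 - 1) * Real.exp x - 4 * Real.exp x + 2 * 1) x := by
      intro x
      exact (((Real.hasDerivAt_exp x).pow 2).sub ((Real.hasDerivAt_exp x).const_mul 4)).add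
        ((hasDerivAt_id x).const_mul 2)
    apply monotoneOn_of_deriv_nonneg (convex_Ici 0)
    · exact fun x _ => (hd x).continuousAt.continuousWithinAt
    · exact fun x _ => (hd x).differentiableAt.differentiableWithinAt
    · intro x _
      rw [(hd x).deriv]
      norm_num
      nlinarith [sq_nonneg (Real.exp x - 1)]
  have := hmono (Set.mem_Ici.2 le_rfl) (Set.mem_Ici.2 hw) hw
  simp at this
  rw [two_mul w, Real.exp_add]
  nlinarith

/-- If `u` is bounded above by `U`, then the second order remainder of `e^{-su}` is at most `s / 2`
times the one of `e^{-u}` as soon as `s` is of order `1 / U`. This replaces the variance bound in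
Bernstein's inequality: no lower bound on `u` is needed. -/
lemma exp_neg_mul_le {s u U : ℝ} (hs : 0 < s) (hu : u ≤ U) (hU : 0 ≤ U) (hsU : s * (2 + U) ≤ 1) :
    Real.exp (-(s * u)) ≤ 1 - s * u + s / 2 * (Real.exp (-u) - 1 + u) := by
  rcases le_total 0 u with h | h
  · have h1 := exp_neg_le_quadratic (mul_nonneg hs.le h)
    have h2 := sq_le_mul_exp_neg_sub h
    have h3 : 0 ≤ Real.exp (-u) - 1 + u := by linarith [Real.add_one_le_exp (-u)]
    have h4 : s * (2 + u) ≤ 1 := le_trans (by gcongr) hsU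
    have h5 : s * u ^ 2 ≤ Real.exp (-u) - 1 + u := by
      calc s * u ^ 2 ≤ s * ((2 + u) * (Real.exp (-u) - 1 + u)) := by gcongr
        _ = (s * (2 + u)) * (Real.exp (-u) - 1 + u) := by ring
        _ ≤ 1 * (Real.exp (-u) - 1 + u) := by gcongr
        _ = _ := one_mul _
    nlinarith
  · obtain ⟨v, rfl⟩ : ∃ v, u = -v := ⟨-u, by ring⟩
    have hv : 0 ≤ v := by linarith
    have hs2 : 2 * s ≤ 1 := by nlinarith
    have h1 := four_mul_exp_half_sub_le (w := v / 2) (by linarith)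
    rw [show 2 * (v / 2) = v by ring] at h1
    -- convexity of the exponential between `0` and `v / 2`
    have h2 := convexOn_exp.2 (Set.mem_univ (0 : ℝ)) (Set.mem_univ (v / 2))
      (show 0 ≤ 1 - 2 * s by linarith) (show 0 ≤ 2 * s by linarith) (by ring)
    simp only [smul_eq_mul, mul_zero, zero_add, Real.exp_zero, mul_one] at h2
    rw [show 2 * s * (v / 2) = s * v by ring] at h2
    rw [show -(s * -v) = s * v by ring, neg_neg]
    nlinarith

/-- The conditional exponential moment of the excess loss of a score `v`. The second order
remainders in `exp_neg_mul_le` sum up to the relative entropy itself, since the expected likelihood ratio is at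
most `1`. -/
lemma exp_moment_le {p v U s : ℝ} (hp0 : 0 ≤ p) (hp1 : p ≤ 1) (hv : |v| + 1 ≤ U) (hs : 0 < s)
    (hsU : s * (2 + U) ≤ 1) :
    p * Real.exp (-(s * (logisticLoss v + Real.log p))) +
      (1 - p) * Real.exp (-(s * (logisticLoss (-v) + Real.log (1 - p)))) ≤
      1 - s / 2 * binaryKL p v := by
  have hU : 0 ≤ U := le_trans (by positivity) hv
  have key : ∀ {a w : ℝ}, 0 ≤ a → a ≤ 1 → |w| + 1 ≤ U →
      a * Real.exp (-(s * (logisticLoss w + Real.log a))) ≤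
        a - s / 2 * (a * (logisticLoss w + Real.log a)) + s / 2 * (logisticSigmoid w - a) := by
    intro a w ha ha1 hw
    rcases ha.eq_or_lt with rfl | ha
    · simp
      have := logisticSigmoid_pos w
      positivity
    have h1 := exp_neg_mul_le (u := logisticLoss w + Real.log a) hs
      (by linarith [logisticLoss_le_abs_add_one w, Real.log_nonpos ha.le ha1]) hU hsU
    have h2 : a * Real.exp (-(logisticLoss w + Real.log a)) = logisticSigmoid w := by
      rw [neg_add, Real.exp_add, exp_neg_logisticLoss, Real.exp_neg, Real.exp_log ha]
      field_simp
    have h3 := mul_le_mul_of_nonneg_left h1 ha.le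
    linear_combination h3 + s / 2 * h2
  have k1 := key hp0 hp1 hv
  have k2 := key (a := 1 - p) (w := -v) (by linarith) (by linarith) (by rwa [abs_neg])
  rw [logisticSigmoid_neg] at k2
  unfold binaryKL
  linarith

/-! ### Disintegration of the risks -/

/-- The label `1`. -/
def posLabel : Label := ⟨1, by simp⟩

/-- The label `-1`. -/
def negLabel : Label := ⟨-1, by simp⟩

lemma label_eq (y : Label) : y = posLabel ∨ y = negLabel := by
  rcases y with ⟨y, hy⟩
  rcases hy with rfl | rfl
  · exact Or.inr rfl
  · exact Or.inl rfl

lemma negLabel_ne_posLabel : negLabel ≠ posLabel := by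
  intro h
  have := congrArg Subtype.val h
  norm_num [negLabel, posLabel] at this

lemma label_coe_eq_one_iff (y : Label) : (y : ℝ) = 1 ↔ y = posLabel :=
  ⟨fun h => Subtype.ext h, fun h => by rw [h]; rfl⟩

section

variable {d : ℕ} (P : Measure (DataPoint d)) [IsProbabilityMeasure P]

lemma condProb_eq (x : unitCube d) : condProb P x = (P.condKernel x).real {posLabel} := by
  unfold condProb
  congr 1
  ext y
  simp [label_coe_eq_one_iff]

lemma condProb_nonneg (x : unitCube d) : 0 ≤ condProb P x := measureReal_nonneg

lemma condProb_le_one (x : unitCube d) : condProb P x ≤ 1 := measureReal_le_one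

lemma measurable_condProb : Measurable (condProb P) := by
  have : condProb P = fun x => ((P.condKernel x) {posLabel}).toReal := by
    ext x; exact condProb_eq P x
  rw [this]
  exact (Kernel.measurable_coe _ (measurableSet_singleton _)).ennreal_toReal

lemma condKernel_eq (x : unitCube d) : P.condKernel x =
    ENNReal.ofReal (condProb P x) • Measure.dirac posLabel +
      ENNReal.ofReal (1 - condProb P x) • Measure.dirac negLabel := by
  have hcompl : ({posLabel} : Set Label)ᶜ = {negLabel} := by
    ext y
    rcases label_eq y with rfl | rfl
    · simp [negLabel_ne_posLabel.symm]
    · simp [negLabel_ne_posLabel]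
  have h1 : P.condKernel x {posLabel} = ENNReal.ofReal (condProb P x) := by
    rw [condProb_eq, ofReal_measureReal]
  have h2 : P.condKernel x {negLabel} = ENNReal.ofReal (1 - condProb P x) := by
    rw [condProb_eq, ← probReal_compl_eq_one_sub (measurableSet_singleton _), hcompl,
      ofReal_measureReal]
  refine Measure.ext_of_singleton fun y => ?_
  rcases label_eq y with rfl | rfl
  · simp [h1, negLabel_ne_posLabel]
  · simp [h2, negLabel_ne_posLabel.symm]

lemma lintegral_dataPoint {g : DataPoint d → ℝ≥0∞} (hg : Measurable g) :
    ∫⁻ z, g z ∂P = ∫⁻ x, (ENNReal.ofReal (condProb P x) * g (x, posLabel) +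
      ENNReal.ofReal (1 - condProb P x) * g (x, negLabel)) ∂P.fst := by
  rw [← Measure.lintegral_condKernel hg]
  refine lintegral_congr fun x => ?_
  rw [condKernel_eq, lintegral_add_measure, lintegral_smul_measure, lintegral_smul_measure,
    lintegral_dirac, lintegral_dirac, smul_eq_mul, smul_eq_mul]

/-- The conditional expectation of `g (x, ·)` given the input `x`. -/
def condMean (g : DataPoint d → ℝ) (x : unitCube d) : ℝ :=
  condProb P x * g (x, posLabel) + (1 - condProb P x) * g (x, negLabel)

lemma lintegral_ofReal_dataPoint {g : DataPoint d → ℝ} (hg : Measurable g) (h0 : ∀ z, 0 ≤ g z) :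
    ∫⁻ z, ENNReal.ofReal (g z) ∂P = ∫⁻ x, ENNReal.ofReal (condMean P g x) ∂P.fst := by
  rw [lintegral_dataPoint P hg.ennreal_ofReal]
  refine lintegral_congr fun x => ?_
  have h1 := condProb_nonneg P x
  have h2 := sub_nonneg.2 (condProb_le_one P x)
  rw [condMean, ENNReal.ofReal_add (mul_nonneg h1 (h0 _)) (mul_nonneg h2 (h0 _)),
    ENNReal.ofReal_mul h1, ENNReal.ofReal_mul h2]

lemma integrable_of_condMean_abs_le {g : DataPoint d → ℝ} (hg : Measurable g) {C : ℝ}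
    (hC : ∀ x, condMean P (fun z => |g z|) x ≤ C) : Integrable g P := by
  refine ⟨hg.aestronglyMeasurable, ?_⟩
  rw [hasFiniteIntegral_iff_norm]
  simp only [Real.norm_eq_abs]
  rw [lintegral_ofReal_dataPoint P hg.abs (fun z => abs_nonneg _)]
  calc _ ≤ ∫⁻ x, ENNReal.ofReal C ∂P.fst :=
        lintegral_mono fun x => ENNReal.ofReal_le_ofReal (hC x)
    _ < ⊤ := by simp

lemma integral_dataPoint {g : DataPoint d → ℝ} (hg : Integrable g P) :
    ∫ z, g z ∂P = ∫ x, condMean P g x ∂P.fst := by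
  rw [← Measure.integral_condKernel hg]
  refine integral_congr_ae (Eventually.of_forall fun x => ?_)
  have hi : ∀ y : Label, Integrable (fun y => g (x, y)) (Measure.dirac y) := fun y =>
    integrable_dirac (by simp)
  simp only
  rw [condKernel_eq, integral_add_measure ((hi _).smul_measure (by simp))
    ((hi _).smul_measure (by simp)), integral_smul_measure, integral_smul_measure,
    integral_dirac, integral_dirac, ENNReal.toReal_ofReal (condProb_nonneg P x),
    ENNReal.toReal_ofReal (sub_nonneg.2 (condProb_le_one P x)), smul_eq_mul, smul_eq_mul, condMean]

/-! ### Excess risks and relative entropy -/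

lemma measurable_logisticLoss : Measurable logisticLoss :=
  Real.measurable_log.comp (measurable_const.add (Real.measurable_exp.comp measurable_neg))

lemma measurable_binaryKL_comp {f : unitCube d → ℝ} (hf : Measurable f) :
    Measurable fun x => binaryKL (condProb P x) (f x) := by
  have h := measurable_condProb P
  unfold binaryKL
  exact (h.mul ((measurable_logisticLoss.comp hf).add (Real.measurable_log.comp h))).add
    ((measurable_const.sub h).mul ((measurable_logisticLoss.comp hf.neg).add
      (Real.measurable_log.comp (measurable_const.sub h))))

/-- The relative entropy of the conditional label distribution with respect to the one modelled by
the score `f`, averaged over the inputs. -/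
def klRisk (f : unitCube d → ℝ) : ℝ := ∫ x, binaryKL (condProb P x) (f x) ∂P.fst

lemma integrable_binaryKL {f : unitCube d → ℝ} (hf : Measurable f) {F : ℝ}
    (hF : ∀ x, |f x| ≤ F) : Integrable (fun x => binaryKL (condProb P x) (f x)) P.fst := by
  refine Integrable.of_bound (measurable_binaryKL_comp P hf).aestronglyMeasurable (F + 1)
    (Eventually.of_forall fun x => ?_)
  have h1 := condProb_nonneg P x
  have h2 := condProb_le_one P x
  rw [Real.norm_eq_abs, abs_of_nonneg (binaryKL_nonneg h1 h2 _)]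
  linarith [binaryKL_le_abs_add_one h1 h2 (f x), hF x]

lemma klRisk_nonneg (f : unitCube d → ℝ) : 0 ≤ klRisk P f :=
  integral_nonneg fun x => binaryKL_nonneg (condProb_nonneg P x) (condProb_le_one P x) _

lemma ofReal_klRisk {f : unitCube d → ℝ} (hf : Measurable f) {F : ℝ} (hF : ∀ x, |f x| ≤ F) :
    ENNReal.ofReal (klRisk P f) = ∫⁻ x, ENNReal.ofReal (binaryKL (condProb P x) (f x)) ∂P.fst :=
  ofReal_integral_eq_lintegral_ofReal (integrable_binaryKL P hf hF)
    (Eventually.of_forall fun x =>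
      binaryKL_nonneg (condProb_nonneg P x) (condProb_le_one P x) _)

lemma logisticRisk_eq {f : unitCube d → ℝ} (hf : Measurable f) :
    logisticRisk P f = ∫⁻ x, ENNReal.ofReal (condProb P x * logisticLoss (f x) +
      (1 - condProb P x) * logisticLoss (-f x)) ∂P.fst := by
  unfold logisticRisk
  rw [lintegral_ofReal_dataPoint P (g := fun z => logisticLoss ((z.2 : ℝ) * f z.1))
    (measurable_logisticLoss.comp
      ((measurable_subtype_coe.comp measurable_snd).mul (hf.comp measurable_fst)))
    (fun z => logisticLoss_nonneg _)]
  simp [condMean, posLabel, negLabel]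

/-- The excess logistic risk is at most the averaged relative entropy: the conditional risk of
every score is at least the entropy of the label. -/
lemma excessLogisticRisk_le_klRisk {f : unitCube d → ℝ} (hf : Measurable f) {F : ℝ}
    (hF : ∀ x, |f x| ≤ F) : excessLogisticRisk P f ≤ ENNReal.ofReal (klRisk P f) := by
  set H : unitCube d → ℝ := fun x => -(condProb P x * Real.log (condProb P x) +
    (1 - condProb P x) * Real.log (1 - condProb P x)) with hH
  have hH0 : ∀ x, 0 ≤ H x := by
    intro x
    have h1 := condProb_nonneg P x
    have h2 := sub_nonneg.2 (condProb_le_one P x)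
    have h3 := Real.log_nonpos h1 (condProb_le_one P x)
    have h4 := Real.log_nonpos h2 (by linarith)
    simp only [hH]
    nlinarith [mul_nonneg h1 (neg_nonneg.2 h3), mul_nonneg h2 (neg_nonneg.2 h4)]
  have hadd : ∀ (g : unitCube d → ℝ) x, condProb P x * logisticLoss (g x) +
      (1 - condProb P x) * logisticLoss (-g x) = binaryKL (condProb P x) (g x) + H x := by
    intro g x
    simp only [hH, binaryKL]
    ring
  have hkl : ∀ (g : unitCube d → ℝ) x, 0 ≤ binaryKL (condProb P x) (g x) := fun g x =>
    binaryKL_nonneg (condProb_nonneg P x) (condProb_le_one P x) _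
  have h1 : ∫⁻ x, ENNReal.ofReal (H x) ∂P.fst ≤
      ⨅ (g : unitCube d → ℝ) (_ : Measurable g), logisticRisk P g := by
    refine le_iInf₂ fun g hg => ?_
    rw [logisticRisk_eq P hg]
    refine lintegral_mono fun x => ENNReal.ofReal_le_ofReal ?_
    rw [hadd]
    linarith [hkl g x]
  have h2 : logisticRisk P f ≤ ENNReal.ofReal (klRisk P f) + ∫⁻ x, ENNReal.ofReal (H x) ∂P.fst := by
    rw [logisticRisk_eq P hf, ofReal_klRisk P hf hF,
      ← lintegral_add_left (measurable_binaryKL_comp P hf).ennreal_ofReal]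
    refine lintegral_mono fun x => ?_
    rw [hadd, ENNReal.ofReal_add (hkl f x) (hH0 x)]
  unfold excessLogisticRisk
  rw [tsub_le_iff_right]
  exact h2.trans (add_le_add le_rfl h1)

lemma misclassError_eq {f : unitCube d → ℝ} (hf : Measurable f) :
    misclassError P f = ∫⁻ x, ENNReal.ofReal (if 0 ≤ f x then 1 - condProb P x else condProb P x)
      ∂P.fst := by
  have hm : MeasurableSet {z : DataPoint d | (z.2 : ℝ) ≠ sgn (f z.1)} := by
    refine (measurableSet_eq_fun (measurable_subtype_coe.comp measurable_snd) ?_).compl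
    exact Measurable.ite (measurableSet_le measurable_const (hf.comp measurable_fst))
      measurable_const measurable_const
  unfold misclassError
  rw [← lintegral_indicator_one hm, lintegral_dataPoint P (measurable_one.indicator hm)]
  refine lintegral_congr fun x => ?_
  by_cases h : 0 ≤ f x
  · simp [Set.indicator, sgn, h, posLabel, negLabel]
    norm_num
  · simp [Set.indicator, sgn, h, posLabel, negLabel]
    norm_num

/-- The excess misclassification error is controlled by the averaged relative entropy. The free
parameter `τ` replaces a square root, so that the bound can be integrated over the sample. -/
lemma excessMisclassError_le_klRisk {f : unitCube d → ℝ} (hf : Measurable f) {F : ℝ}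
    (hF : ∀ x, |f x| ≤ F) {τ : ℝ} (hτ : 0 < τ) :
    excessMisclassError P f ≤ ENNReal.ofReal τ +
      ENNReal.ofReal (2 / τ) * ENNReal.ofReal (klRisk P f) := by
  have h1 : ∫⁻ x, ENNReal.ofReal (min (condProb P x) (1 - condProb P x)) ∂P.fst ≤
      ⨅ (g : unitCube d → ℝ) (_ : Measurable g), misclassError P g := by
    refine le_iInf₂ fun g hg => ?_
    rw [misclassError_eq P hg]
    refine lintegral_mono fun x => ENNReal.ofReal_le_ofReal ?_
    split_ifs
    · exact min_le_right _ _
    · exact min_le_left _ _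
  have hpt : ∀ x, (if 0 ≤ f x then 1 - condProb P x else condProb P x) ≤
      (τ + 2 / τ * binaryKL (condProb P x) (f x)) + min (condProb P x) (1 - condProb P x) := by
    intro x
    have hp0 := condProb_nonneg P x
    have hp1 := condProb_le_one P x
    have hsq := sq_sub_le_two_mul_binaryKL hp0 hp1 (f x)
    set p := condProb P x
    set q := logisticSigmoid (f x) with hq
    have hab : 2 * |p - q| ≤ τ + 2 / τ * binaryKL p (f x) := by
      have h3 : 0 ≤ (|p - q| - τ) ^ 2 := sq_nonneg _
      have h4 : 2 * |p - q| * τ ≤ τ ^ 2 + 2 * binaryKL p (f x) := by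
        nlinarith [sq_abs (p - q)]
      have h5 : τ + 2 / τ * binaryKL p (f x) = (τ ^ 2 + 2 * binaryKL p (f x)) / τ := by
        field_simp
      rw [h5, le_div_iff₀ hτ]
      exact h4
    have hlt := le_abs_self (p - q)
    have hlt' := neg_abs_le (p - q)
    split_ifs with h
    · have : 1 / 2 ≤ q := by
        rw [hq, logisticSigmoid, one_div]
        apply inv_anti₀ (one_add_exp_neg_pos _)
        linarith [Real.exp_le_one_iff.2 (neg_nonpos.2 h)]
      rcases min_cases p (1 - p) with ⟨h6, _⟩ | ⟨h6, _⟩ <;> rw [h6] <;>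
        linarith [abs_nonneg (p - q)]
    · have : q ≤ 1 / 2 := by
        rw [hq, logisticSigmoid, one_div]
        apply inv_anti₀ two_pos
        linarith [Real.one_le_exp (show 0 ≤ -f x by linarith)]
      rcases min_cases p (1 - p) with ⟨h6, _⟩ | ⟨h6, _⟩ <;> rw [h6] <;>
        linarith [abs_nonneg (p - q)]
  have hkl : ∀ x, 0 ≤ binaryKL (condProb P x) (f x) := fun x =>
    binaryKL_nonneg (condProb_nonneg P x) (condProb_le_one P x) _
  have hm := (measurable_binaryKL_comp P hf).ennreal_ofReal
  have h2 : misclassError P f ≤ (ENNReal.ofReal τ +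
      ENNReal.ofReal (2 / τ) * ENNReal.ofReal (klRisk P f)) +
      ∫⁻ x, ENNReal.ofReal (min (condProb P x) (1 - condProb P x)) ∂P.fst := by
    have h3 : ENNReal.ofReal τ + ENNReal.ofReal (2 / τ) * ENNReal.ofReal (klRisk P f) =
        ∫⁻ x, (ENNReal.ofReal τ +
          ENNReal.ofReal (2 / τ) * ENNReal.ofReal (binaryKL (condProb P x) (f x))) ∂P.fst := by
      rw [lintegral_add_left measurable_const, lintegral_const_mul _ hm, ofReal_klRisk P hf hF]
      simp
    have hm' : Measurable fun x => ENNReal.ofReal τ +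
        ENNReal.ofReal (2 / τ) * ENNReal.ofReal (binaryKL (condProb P x) (f x)) :=
      measurable_const.add (hm.const_mul _)
    rw [misclassError_eq P hf, h3, ← lintegral_add_left hm']
    refine lintegral_mono fun x => (ENNReal.ofReal_le_ofReal (hpt x)).trans ?_
    refine ENNReal.ofReal_add_le.trans ?_
    gcongr
    rw [ENNReal.ofReal_add hτ.le (by have := hkl x; positivity), ENNReal.ofReal_mul (by positivity)]
  unfold excessMisclassError
  rw [tsub_le_iff_right]
  exact h2.trans (add_le_add le_rfl h1)

/-! ### The oracle inequality -/

/-- The excess loss of the score `f` at a data point: the logistic loss minus the negative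
log-likelihood of the true conditional label distribution. -/
def excessLoss (f : unitCube d → ℝ) (z : DataPoint d) : ℝ :=
  logisticLoss ((z.2 : ℝ) * f z.1) +
    Real.log (if (z.2 : ℝ) = 1 then condProb P z.1 else 1 - condProb P z.1)

lemma measurable_excessLoss {f : unitCube d → ℝ} (hf : Measurable f) :
    Measurable (excessLoss P f) := by
  have h : Measurable fun z : DataPoint d => condProb P z.1 :=
    (measurable_condProb P).comp measurable_fst
  have hy : Measurable fun z : DataPoint d => (z.2 : ℝ) :=
    measurable_subtype_coe.comp measurable_snd
  refine (measurable_logisticLoss.comp (hy.mul (hf.comp measurable_fst))).add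
    (Real.measurable_log.comp ?_)
  exact Measurable.ite (measurableSet_eq_fun hy measurable_const) h (measurable_const.sub h)

lemma excessLoss_pos (f : unitCube d → ℝ) (x : unitCube d) :
    excessLoss P f (x, posLabel) = logisticLoss (f x) + Real.log (condProb P x) := by
  simp [excessLoss, posLabel]

lemma excessLoss_neg (f : unitCube d → ℝ) (x : unitCube d) :
    excessLoss P f (x, negLabel) = logisticLoss (-f x) + Real.log (1 - condProb P x) := by
  have : ¬ ((-1 : ℝ) = 1) := by norm_num
  simp [excessLoss, negLabel, this]

lemma abs_mul_log_le_one {p : ℝ} (hp0 : 0 ≤ p) (hp1 : p ≤ 1) : p * |Real.log p| ≤ 1 := by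
  rcases hp0.eq_or_lt with rfl | hp
  · simp
  have h := Real.abs_log_mul_self_lt p hp hp1
  rw [abs_mul, abs_of_pos hp] at h
  linarith

lemma integrable_excessLoss {f : unitCube d → ℝ} (hf : Measurable f) {F : ℝ}
    (hF : ∀ x, |f x| ≤ F) : Integrable (excessLoss P f) P := by
  refine integrable_of_condMean_abs_le P (measurable_excessLoss P hf) (C := F + 3) fun x => ?_
  have hp0 := condProb_nonneg P x
  have hp1 := condProb_le_one P x
  simp only [condMean, excessLoss_pos, excessLoss_neg]
  have h1 := abs_mul_log_le_one hp0 hp1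
  have h2 := abs_mul_log_le_one (sub_nonneg.2 hp1) (by linarith)
  have h3 := logisticLoss_le_abs_add_one (f x)
  have h4 := logisticLoss_le_abs_add_one (-f x)
  rw [abs_neg] at h4
  have h5 := abs_add_le (logisticLoss (f x)) (Real.log (condProb P x))
  have h6 := abs_add_le (logisticLoss (-f x)) (Real.log (1 - condProb P x))
  rw [abs_of_nonneg (logisticLoss_nonneg _)] at h5 h6
  have h7 := hF x
  nlinarith [mul_le_mul_of_nonneg_left h5 hp0, mul_le_mul_of_nonneg_left h6 (sub_nonneg.2 hp1),
    mul_le_mul_of_nonneg_left (h3.trans (add_le_add_left h7 1)) hp0,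
    mul_le_mul_of_nonneg_left (h4.trans (add_le_add_left h7 1)) (sub_nonneg.2 hp1)]

lemma integral_excessLoss {f : unitCube d → ℝ} (hf : Measurable f) {F : ℝ}
    (hF : ∀ x, |f x| ≤ F) : ∫ z, excessLoss P f z ∂P = klRisk P f := by
  rw [integral_dataPoint P (integrable_excessLoss P hf hF)]
  simp only [condMean, excessLoss_pos, excessLoss_neg]
  rfl

lemma integrable_exp_excessLoss {f : unitCube d → ℝ} (hf : Measurable f) {F s : ℝ}
    (hF : ∀ x, |f x| ≤ F) (hs : 0 < s) (hsF : s * (F + 3) ≤ 1) :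
    Integrable (fun z => Real.exp (-(s * excessLoss P f z))) P := by
  refine integrable_of_condMean_abs_le P
    (Real.measurable_exp.comp ((measurable_excessLoss P hf).const_mul s).neg) (C := 1) fun x => ?_
  have hp0 := condProb_nonneg P x
  have hp1 := condProb_le_one P x
  simp only [condMean, excessLoss_pos, excessLoss_neg, Real.abs_exp]
  have h := exp_moment_le hp0 hp1 (add_le_add_left (hF x) 1) hs (by linarith)
  have := binaryKL_nonneg hp0 hp1 (f x)
  have : 0 ≤ s / 2 * binaryKL (condProb P x) (f x) := by positivity
  linarith

lemma integral_exp_excessLoss_le {f : unitCube d → ℝ} (hf : Measurable f) {F s : ℝ}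
    (hF : ∀ x, |f x| ≤ F) (hs : 0 < s) (hsF : s * (F + 3) ≤ 1) :
    ∫ z, Real.exp (-(s * excessLoss P f z)) ∂P ≤ Real.exp (-(s / 2 * klRisk P f)) := by
  rw [integral_dataPoint P (integrable_exp_excessLoss P hf hF hs hsF)]
  have hi := (integrable_binaryKL P hf hF).const_mul (s / 2)
  calc _ ≤ ∫ x, (1 - s / 2 * binaryKL (condProb P x) (f x)) ∂P.fst := by
        refine integral_mono_of_nonneg (Eventually.of_forall fun x => ?_)
          ((integrable_const _).sub hi) (Eventually.of_forall fun x => ?_)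
        · have hp0 := condProb_nonneg P x
          have hp1 := sub_nonneg.2 (condProb_le_one P x)
          simp only [condMean, Pi.zero_apply]
          positivity
        · simp only [condMean, excessLoss_pos, excessLoss_neg]
          exact exp_moment_le (condProb_nonneg P x) (condProb_le_one P x)
            (add_le_add_left (hF x) 1) hs (by linarith)
    _ = 1 - s / 2 * klRisk P f := by
        rw [integral_sub (integrable_const _) hi, integral_const_mul]
        simp [klRisk]
    _ ≤ _ := by linarith [Real.add_one_le_exp (-(s / 2 * klRisk P f))]

lemma klRisk_le_add {f g : unitCube d → ℝ} (hf : Measurable f) (hg : Measurable g) {F δ : ℝ}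
    (hF : ∀ x, |f x| ≤ F) (hδ : ∀ x, |g x - f x| ≤ δ) : klRisk P g ≤ klRisk P f + δ := by
  have hG : ∀ x, |g x| ≤ F + δ := fun x => by
    have := abs_add_le (f x) (g x - f x)
    rw [add_sub_cancel] at this
    linarith [hF x, hδ x]
  have h1 := integral_mono (integrable_binaryKL P hg hG)
    ((integrable_binaryKL P hf hF).add (integrable_const δ)) fun x => by
      have := binaryKL_le_add_abs_sub (condProb_nonneg P x) (condProb_le_one P x) (g x) (f x)
      simp only [Pi.add_apply]
      linarith [hδ x]
  simp only [Pi.add_apply] at h1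
  rw [integral_add (integrable_binaryKL P hf hF) (integrable_const δ)] at h1
  simpa [klRisk] using h1

/-- The total excess loss over a sample has an exponential moment that compensates half of its
expectation. -/
lemma integral_exp_sum_excessLoss_le {f : unitCube d → ℝ} (hf : Measurable f) {F s : ℝ}
    (hF : ∀ x, |f x| ≤ F) (hs : 0 < s) (hsF : s * (F + 3) ≤ 1) (n : ℕ) :
    Integrable (fun z : Fin n → DataPoint d =>
      Real.exp (n * (s / 2) * klRisk P f - s * ∑ i, excessLoss P f (z i)))
      (Measure.pi fun _ => P) ∧
    ∫ z : Fin n → DataPoint d,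
      Real.exp (n * (s / 2) * klRisk P f - s * ∑ i, excessLoss P f (z i))
      ∂(Measure.pi fun _ => P) ≤ 1 := by
  have heq : (fun z : Fin n → DataPoint d =>
      Real.exp (n * (s / 2) * klRisk P f - s * ∑ i, excessLoss P f (z i))) =
      fun z => Real.exp (n * (s / 2) * klRisk P f) *
        ∏ i, Real.exp (-(s * excessLoss P f (z i))) := by
    ext z
    rw [← Real.exp_sum, ← Real.exp_add, Finset.sum_neg_distrib, ← Finset.mul_sum, sub_eq_add_neg]
  rw [heq]
  have hi := integrable_exp_excessLoss P hf hF hs hsF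
  constructor
  · exact (Integrable.fintype_prod (μ := fun _ : Fin n => P)
      (f := fun _ z => Real.exp (-(s * excessLoss P f z))) fun _ => hi).const_mul _
  · rw [integral_const_mul, integral_fintype_prod_eq_prod
      (fun _ z => Real.exp (-(s * excessLoss P f z)))]
    have h0 : 0 ≤ ∫ z, Real.exp (-(s * excessLoss P f z)) ∂P :=
      integral_nonneg fun z => (Real.exp_pos _).le
    have h1 := pow_le_pow_left₀ h0 (integral_exp_excessLoss_le P hf hF hs hsF) n
    rw [← Real.exp_nat_mul] at h1
    simp only [Finset.prod_const, Finset.card_univ, Fintype.card_fin]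
    calc _ ≤ Real.exp (n * (s / 2) * klRisk P f) *
          Real.exp (n * -(s / 2 * klRisk P f)) := by gcongr
      _ = 1 := by rw [← Real.exp_add, Real.exp_eq_one_iff]; ring

/-- Oracle inequality for an empirical risk minimizer that always stays close to one of finitely
many bounded functions. The maximum over these functions is bounded by the sum of the exponential
moments, so that no joint measurability of the estimator in the sample is needed. -/
theorem lintegral_klRisk_le {ι : Type*} [Fintype ι] [Nonempty ι] {n : ℕ} (hn : 0 < n)
    (f : ι → unitCube d → ℝ) (hf : ∀ j, Measurable (f j)) {F δ : ℝ}
    (hF : ∀ j x, |f j x| ≤ F) (f₀ : unitCube d → ℝ) (hf₀ : Measurable f₀)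
    (hF₀ : ∀ x, |f₀ x| ≤ F) (est : (Fin n → DataPoint d) → unitCube d → ℝ)
    (hest : ∀ z, Measurable (est z)) (hnet : ∀ z, ∃ j, ∀ x, |est z x - f j x| ≤ δ)
    (hmin : ∀ z : Fin n → DataPoint d, ∑ i, logisticLoss (((z i).2 : ℝ) * est z (z i).1) ≤
      ∑ i, logisticLoss (((z i).2 : ℝ) * f₀ (z i).1)) :
    ∫⁻ z, ENNReal.ofReal (klRisk P (est z)) ∂(Measure.pi fun _ : Fin n => P) ≤
      ENNReal.ofReal (2 * klRisk P f₀ + 3 * δ +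
        2 * (F + 3) / n * Real.log (Fintype.card ι)) := by
  have hF0 : 0 ≤ F := by
    obtain ⟨j, _⟩ := hnet fun _ => (⟨0, by intro i; simp⟩, posLabel)
    exact (abs_nonneg _).trans (hF j ⟨0, by intro i; simp⟩)
  have hn' : (0 : ℝ) < n := by exact_mod_cast hn
  set M : ℝ := (Fintype.card ι : ℝ) with hM
  have hM0 : 0 < M := by rw [hM]; exact_mod_cast Fintype.card_pos
  set s : ℝ := (F + 3)⁻¹ with hs
  have hs0 : 0 < s := by positivity
  have hsF : s * (F + 3) ≤ 1 := by rw [hs, inv_mul_cancel₀ (by positivity)]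
  set lam : ℝ := n * (s / 2) with hlam
  have hlam0 : 0 < lam := by positivity
  set E : ι → (Fin n → DataPoint d) → ℝ := fun j z =>
    Real.exp (n * (s / 2) * klRisk P (f j) - s * ∑ i, excessLoss P (f j) (z i)) with hE
  set W : (Fin n → DataPoint d) → ℝ := fun z => 3 * δ +
    ((2 / n) * ∑ i, excessLoss P f₀ (z i) + lam⁻¹ * (Real.log M - 1 + M⁻¹ * ∑ j, E j z)) with hW
  have hpt : ∀ z, klRisk P (est z) ≤ W z := by
    intro z
    obtain ⟨j, hj⟩ := hnet z
    have h1 := klRisk_le_add P (hf j) (hest z) (hF j) hj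
    -- `t ≤ log M - 1 + e ^ t / M`: the constant `-1` cancels the expectation of the last term
    have h2 := Real.add_one_le_exp
      ((n * (s / 2) * klRisk P (f j) - s * ∑ i, excessLoss P (f j) (z i)) - Real.log M)
    rw [Real.exp_sub, Real.exp_log hM0] at h2
    have h3 : E j z ≤ ∑ j, E j z :=
      Finset.single_le_sum (f := fun j => E j z) (fun j _ => (Real.exp_pos _).le)
        (Finset.mem_univ j)
    have h4 : lam * (klRisk P (f j) - 2 / n * ∑ i, excessLoss P (f j) (z i)) ≤
        Real.log M - 1 + M⁻¹ * ∑ j, E j z := by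
      have e1 : lam * (klRisk P (f j) - 2 / n * ∑ i, excessLoss P (f j) (z i)) =
          n * (s / 2) * klRisk P (f j) - s * ∑ i, excessLoss P (f j) (z i) := by
        rw [hlam]; field_simp
      have e2 : E j z / M ≤ M⁻¹ * ∑ j, E j z := by
        rw [div_eq_inv_mul]; gcongr
      rw [e1]
      simp only [hE] at e2 h3 ⊢
      linarith
    have h5 : klRisk P (f j) - 2 / n * ∑ i, excessLoss P (f j) (z i) ≤
        lam⁻¹ * (Real.log M - 1 + M⁻¹ * ∑ j, E j z) := by
      rw [inv_mul_eq_div, le_div_iff₀ hlam0]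
      linarith
    have h6 : ∑ i, excessLoss P (f j) (z i) ≤ ∑ i, excessLoss P f₀ (z i) + n * δ := by
      have h7 : ∑ i, logisticLoss (((z i).2 : ℝ) * f j (z i).1) ≤
          ∑ i, (logisticLoss (((z i).2 : ℝ) * est z (z i).1) + δ) := by
        refine Finset.sum_le_sum fun i _ =>
          (logisticLoss_le_add_abs_sub _ (((z i).2 : ℝ) * est z (z i).1)).trans ?_
        refine add_le_add le_rfl ?_
        rw [← mul_sub, abs_mul, abs_sub_comm]
        have : |((z i).2 : ℝ)| = 1 := by
          rcases label_eq (z i).2 with h | h <;> rw [h] <;> simp [posLabel, negLabel]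
        rw [this, one_mul]
        exact hj _
      rw [Finset.sum_add_distrib] at h7
      simp only [Finset.sum_const, Finset.card_univ, Fintype.card_fin, nsmul_eq_mul] at h7
      simp only [excessLoss, Finset.sum_add_distrib]
      linarith [hmin z]
    have h8 : 2 / n * ∑ i, excessLoss P (f j) (z i) ≤
        2 / n * ∑ i, excessLoss P f₀ (z i) + 2 * δ := by
      calc _ ≤ 2 / n * (∑ i, excessLoss P f₀ (z i) + n * δ) := by gcongr
        _ = _ := by field_simp
    simp only [hW]
    linarith
  have hEi : ∀ j, Integrable (E j) (Measure.pi fun _ : Fin n => P) := fun j =>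
    (integral_exp_sum_excessLoss_le P (hf j) (hF j) hs0 hsF n).1
  have hEle : ∀ j, ∫ z, E j z ∂(Measure.pi fun _ : Fin n => P) ≤ 1 := fun j =>
    (integral_exp_sum_excessLoss_le P (hf j) (hF j) hs0 hsF n).2
  have hXi : ∀ i : Fin n, Integrable (fun z : Fin n → DataPoint d => excessLoss P f₀ (z i))
      (Measure.pi fun _ : Fin n => P) := fun i =>
    (measurePreserving_eval (fun _ : Fin n => P) i).integrable_comp_of_integrable
      (integrable_excessLoss P hf₀ hF₀)
  have hXe : ∀ i : Fin n, ∫ z : Fin n → DataPoint d, excessLoss P f₀ (z i)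
      ∂(Measure.pi fun _ : Fin n => P) = klRisk P f₀ := by
    intro i
    have h1 := integral_map (μ := Measure.pi fun _ : Fin n => P)
      (measurable_pi_apply (X := fun _ : Fin n => DataPoint d) i).aemeasurable
      (measurable_excessLoss P hf₀).aestronglyMeasurable
    have h2 : Measure.map (fun z : Fin n → DataPoint d => z i) (Measure.pi fun _ => P) = P :=
      (measurePreserving_eval (fun _ : Fin n => P) i).map_eq
    rw [h2, integral_excessLoss P hf₀ hF₀] at h1
    exact h1.symm
  have hi1 : Integrable (fun z : Fin n → DataPoint d => (2 / n : ℝ) * ∑ i, excessLoss P f₀ (z i))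
      (Measure.pi fun _ : Fin n => P) := (integrable_finsetSum _ fun i _ => hXi i).const_mul _
  have hi2 : Integrable (fun z : Fin n → DataPoint d => M⁻¹ * ∑ j, E j z)
      (Measure.pi fun _ : Fin n => P) := (integrable_finsetSum _ fun j _ => hEi j).const_mul _
  have hi3 : Integrable (fun z : Fin n → DataPoint d =>
      lam⁻¹ * (Real.log M - 1 + M⁻¹ * ∑ j, E j z)) (Measure.pi fun _ : Fin n => P) :=
    ((integrable_const _).add hi2).const_mul _
  have hi4 : Integrable (fun z : Fin n → DataPoint d => (2 / n : ℝ) * ∑ i, excessLoss P f₀ (z i) +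
      lam⁻¹ * (Real.log M - 1 + M⁻¹ * ∑ j, E j z)) (Measure.pi fun _ : Fin n => P) := hi1.add hi3
  have hWi : Integrable W (Measure.pi fun _ : Fin n => P) :=
    (integrable_const _).add hi4
  have hWint : ∫ z, W z ∂(Measure.pi fun _ : Fin n => P) ≤ 2 * klRisk P f₀ + 3 * δ +
        2 * (F + 3) / n * Real.log M := by
    have e1 : ∫ z, W z ∂(Measure.pi fun _ : Fin n => P) = 3 * δ + ((2 / n) * (n * klRisk P f₀) +
        lam⁻¹ * (Real.log M - 1 + M⁻¹ * ∑ j, ∫ z, E j z ∂(Measure.pi fun _ : Fin n => P))) := by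
      simp only [hW]
      rw [integral_add (integrable_const _) hi4, integral_add hi1 hi3,
        integral_const_mul (2 / n : ℝ), integral_const_mul lam⁻¹,
        integral_add (integrable_const _) hi2, integral_const_mul M⁻¹,
        integral_finsetSum _ fun i _ => hXi i, integral_finsetSum _ fun j _ => hEi j]
      simp [hXe]
    have e2 : M⁻¹ * ∑ j, ∫ z, E j z ∂(Measure.pi fun _ : Fin n => P) ≤ 1 := by
      rw [inv_mul_le_iff₀ hM0, mul_one, hM]
      calc _ ≤ ∑ j : ι, (1 : ℝ) := Finset.sum_le_sum fun j _ => hEle j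
        _ = _ := by simp
    have e3 : lam⁻¹ = 2 * (F + 3) / n := by rw [hlam, hs]; field_simp
    have e4 : (2 / n : ℝ) * (n * klRisk P f₀) = 2 * klRisk P f₀ := by field_simp
    rw [e1, e4, ← e3]
    have : lam⁻¹ * (Real.log M - 1 + M⁻¹ * ∑ j, ∫ z, E j z ∂(Measure.pi fun _ : Fin n => P)) ≤
        lam⁻¹ * Real.log M := by
      gcongr
      linarith
    linarith
  calc _ ≤ ∫⁻ z, ENNReal.ofReal (W z) ∂(Measure.pi fun _ : Fin n => P) :=
        lintegral_mono fun z => ENNReal.ofReal_le_ofReal (hpt z)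
    _ = ENNReal.ofReal (∫ z, W z ∂(Measure.pi fun _ : Fin n => P)) :=
        (ofReal_integral_eq_lintegral_ofReal hWi
          (Eventually.of_forall fun z => (klRisk_nonneg P _).trans (hpt z))).symm
    _ ≤ _ := ENNReal.ofReal_le_ofReal hWint

end

/-! ### Covering numbers of ReLU networks -/

lemma ReluNet.continuous_eval : ∀ {m : ℕ} (T : ReluNet m), Continuous T.eval
  | _, .output W => by
    simp only [ReluNet.eval, Matrix.mulVec, dotProduct]
    fun_prop
  | _, .layer _ W v T => by
    have := T.continuous_eval
    simp only [ReluNet.eval]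
    refine this.comp ?_
    simp only [Matrix.mulVec, dotProduct]
    fun_prop

/-- The function computed by a network all of whose layers have width `M + 1`, given by its
parameters: `θ l i (some j)` is the weight of layer `l` from neuron `j` to neuron `i`, and
`θ l i none` is the bias of neuron `i`. Only the first row of the output layer is used. -/
def padEval {M : ℕ} : ℕ → (ℕ → Fin (M + 1) → Option (Fin (M + 1)) → ℝ) → (Fin (M + 1) → ℝ) → ℝ
  | 0, θ, x => ∑ j, θ 0 0 (some j) * x j
  | L + 1, θ, x => padEval L (fun l => θ (l + 1))
      (fun i => max (∑ j, θ 0 i (some j) * x j - θ 0 i none) 0)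

lemma continuous_padEval {M : ℕ} : ∀ (L : ℕ) (θ : ℕ → Fin (M + 1) → Option (Fin (M + 1)) → ℝ),
    Continuous (padEval L θ)
  | 0, θ => by
    simp only [padEval]
    fun_prop
  | L + 1, θ => by
    have := continuous_padEval L (fun l => θ (l + 1))
    simp only [padEval]
    refine this.comp ?_
    fun_prop

/-- Extension of a vector by zero. -/
def extendZero {k M : ℕ} (x : Fin k → ℝ) (i : Fin (M + 1)) : ℝ :=
  if h : (i : ℕ) < k then x ⟨i, h⟩ else 0

lemma continuous_extendZero {k M : ℕ} :
    Continuous (extendZero : (Fin k → ℝ) → Fin (M + 1) → ℝ) := by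
  refine continuous_pi fun i => ?_
  unfold extendZero
  split_ifs <;> fun_prop

lemma abs_extendZero_le {k M : ℕ} {x : Fin k → ℝ} {a : ℝ} (ha : 0 ≤ a) (hx : ∀ i, |x i| ≤ a)
    (i : Fin (M + 1)) : |extendZero x i| ≤ a := by
  unfold extendZero
  split_ifs
  · exact hx _
  · simpa using ha

/-- Extension of a matrix by zero. -/
def extendZeroMatrix {k k' M : ℕ} (W : Fin k' → Fin k → ℝ) (i j : Fin (M + 1)) : ℝ :=
  if h : (i : ℕ) < k' then extendZero (W ⟨i, h⟩) j else 0

lemma sum_extendZero_mul {k M : ℕ} (hk : k ≤ M + 1) (w x : Fin k → ℝ) :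
    ∑ j : Fin (M + 1), extendZero w j * extendZero x j = ∑ j, w j * x j := by
  symm
  have hinj : Function.Injective (Fin.castLE hk) := Fin.castLE_injective hk
  calc ∑ j, w j * x j
      = ∑ j, (extendZero w (Fin.castLE hk j) * extendZero x (Fin.castLE hk j) : ℝ) :=
        Finset.sum_congr rfl fun j _ => by simp [extendZero]
    _ = ∑ j ∈ Finset.univ.image (Fin.castLE hk), (extendZero w j * extendZero x j : ℝ) :=
        (Finset.sum_image (f := fun j : Fin (M + 1) => (extendZero w j * extendZero x j : ℝ))
          fun a _ b _ h => hinj h).symm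
    _ = _ := Finset.sum_subset (Finset.subset_univ _) fun j _ hj => by
        have : ¬ (j : ℕ) < k := fun h => hj (Finset.mem_image.2 ⟨⟨j, h⟩, Finset.mem_univ _, rfl⟩)
        simp [extendZero, this]

/-- Every network can be padded with zeros to constant width. The nonzero parameters of the padded
network are collected in a set with at most as many elements as the network has nonzero
parameters. -/
lemma ReluNet.exists_padEval {M : ℕ} {B : ℝ} (hB : 0 ≤ B) : ∀ {k : ℕ} (T : ReluNet k), k ≤ M + 1 →
    T.width ≤ M + 1 → T.ParamsBoundedBy B →
    ∃ (θ : ℕ → Fin (M + 1) → Option (Fin (M + 1)) → ℝ)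
      (s : Finset (ℕ × Fin (M + 1) × Option (Fin (M + 1)))),
      s.card ≤ T.numNonzero ∧ (∀ p ∈ s, p.1 ≤ T.depth) ∧
      (∀ l i o, θ l i o ≠ 0 → (l, i, o) ∈ s) ∧ (∀ l i o, |θ l i o| ≤ B) ∧
      ∀ x : Fin k → ℝ, padEval T.depth θ (extendZero x) = T.eval x
  | k, .output W, hk, _, hW => by
    refine ⟨fun l i o => if l = 0 ∧ i = 0 then o.elim 0 (extendZero (W 0)) else 0,
      (Finset.univ.filter fun j => W 0 j ≠ 0).image
        fun j => (0, 0, some (Fin.castLE hk j)), ?_, ?_, ?_, ?_, ?_⟩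
    · refine Finset.card_image_le.trans ?_
      simp [ReluNet.numNonzero, hammingNorm]
    · intro p hp
      obtain ⟨j, _, rfl⟩ := Finset.mem_image.1 hp
      exact Nat.zero_le _
    · intro l i o h
      dsimp only at h
      split_ifs at h with hli
      · obtain ⟨rfl, rfl⟩ := hli
        cases o with
        | none => simp at h
        | some j =>
          simp only [Option.elim, extendZero] at h
          split_ifs at h with hj
          · exact Finset.mem_image.2 ⟨⟨j, hj⟩, by simpa using h, by simp⟩
          · exact absurd rfl h
      · exact absurd rfl h
    · intro l i o
      simp only
      split_ifs
      · cases o with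
        | none => simpa using hB
        | some j => exact abs_extendZero_le hB (fun j => hW 0 j) j
      · simpa using hB
    · intro x
      simp [ReluNet.depth, padEval, ReluNet.eval, sum_extendZero_mul hk, Matrix.mulVec, dotProduct]
  | k, .layer (k := k') hk' W v T, hk, hw, hW => by
    have hk'M : k' ≤ M + 1 := le_trans (le_max_left _ _) hw
    obtain ⟨θ, s, hs1, hs2, hs3, hs4, hs5⟩ := ReluNet.exists_padEval hB T hk'M
      (le_trans (le_max_right _ _) hw) hW.2.2
    refine ⟨fun l => match l with
        | 0 => fun i o => o.elim (extendZero v i) (extendZeroMatrix W i)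
        | l + 1 => θ l,
      ((Finset.univ : Finset (Fin k')).biUnion fun i =>
          (Finset.univ.filter fun j => W i j ≠ 0).image
            fun j => (0, Fin.castLE hk'M i, some (Fin.castLE hk j))) ∪
        (Finset.univ.filter fun i => v i ≠ 0).image (fun i => (0, Fin.castLE hk'M i, none)) ∪
        s.image (fun p => (p.1 + 1, p.2)), ?_, ?_, ?_, ?_, ?_⟩
    · refine (Finset.card_union_le _ _).trans (add_le_add ((Finset.card_union_le _ _).trans
        (add_le_add (Finset.card_biUnion_le.trans (Finset.sum_le_sum fun i _ =>
          Finset.card_image_le)) Finset.card_image_le)) (Finset.card_image_le.trans hs1))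
    · intro p hp
      simp only [ReluNet.depth]
      rcases Finset.mem_union.1 hp with hp | hp
      · rcases Finset.mem_union.1 hp with hp | hp
        · obtain ⟨i, _, hp⟩ := Finset.mem_biUnion.1 hp
          obtain ⟨j, _, rfl⟩ := Finset.mem_image.1 hp
          exact Nat.zero_le _
        · obtain ⟨j, _, rfl⟩ := Finset.mem_image.1 hp
          exact Nat.zero_le _
      · obtain ⟨q, hq, rfl⟩ := Finset.mem_image.1 hp
        exact Nat.succ_le_succ (hs2 q hq)
    · intro l i o h
      cases l with
      | zero =>
        refine Finset.mem_union_left _ ?_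
        cases o with
        | none =>
          simp only [Option.elim, extendZero] at h
          split_ifs at h with hi
          · exact Finset.mem_union_right _
              (Finset.mem_image.2 ⟨⟨i, hi⟩, by simpa using h, by simp⟩)
          · exact absurd rfl h
        | some j =>
          simp only [Option.elim, extendZero, extendZeroMatrix] at h
          split_ifs at h with hi hj
          · exact Finset.mem_union_left _ (Finset.mem_biUnion.2 ⟨⟨i, hi⟩, Finset.mem_univ _,
              Finset.mem_image.2 ⟨⟨j, hj⟩, by simpa using h, by simp⟩⟩)
          · exact absurd rfl h
          · exact absurd rfl h
      | succ l =>
        exact Finset.mem_union_right _ (Finset.mem_image.2 ⟨(l, i, o), hs3 l i o h, rfl⟩)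
    · intro l i o
      cases l with
      | zero =>
        cases o with
        | none => exact abs_extendZero_le hB hW.2.1 i
        | some j =>
          simp only [Option.elim, extendZeroMatrix]
          split_ifs
          · exact abs_extendZero_le hB (hW.1 _) j
          · simpa using hB
      | succ l => exact hs4 l i o
    · intro x
      simp only [ReluNet.depth, padEval, ReluNet.eval]
      rw [← hs5]
      congr 1
      ext i
      simp only [Option.elim, extendZeroMatrix]
      by_cases hi : (i : ℕ) < k'
      · simp only [hi, dite_true]
        rw [sum_extendZero_mul hk]
        simp [extendZero, hi, Matrix.mulVec, dotProduct]
      · simp [extendZero, hi]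

/-- The function computed by a network depends on the parameters in a Lipschitz way. -/
lemma abs_padEval_sub_le {M : ℕ} {B η : ℝ} (hB : 1 ≤ B) (hη : 0 ≤ η) (L : ℕ) :
    ∀ (θ θ' : ℕ → Fin (M + 1) → Option (Fin (M + 1)) → ℝ),
    (∀ l i o, |θ l i o| ≤ B) → (∀ l i o, |θ' l i o| ≤ B) →
    (∀ l i o, |θ l i o - θ' l i o| ≤ η) → ∀ (x x' : Fin (M + 1) → ℝ) (a e : ℝ), 1 ≤ a →
    0 ≤ e → (∀ i, |x i| ≤ a) → (∀ i, |x' i| ≤ a) → (∀ i, |x i - x' i| ≤ e) →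
    |padEval L θ x - padEval L θ' x'| ≤
      ((M + 2) * B) ^ (L + 1) * e + (L + 1) * ((M + 2) * B) ^ L * ((M + 2) * η * a) := by
  have hsum : ∀ (w w' x x' : Fin (M + 1) → ℝ) (a e : ℝ), 1 ≤ a → 0 ≤ e →
      (∀ j, |w j| ≤ B) → (∀ j, |w j - w' j| ≤ η) →
      (∀ i, |x' i| ≤ a) → (∀ i, |x i - x' i| ≤ e) →
      |∑ j, w j * x j - ∑ j, w' j * x' j| ≤ (M + 1) * (B * e + η * a) := by
    intro w w' x x' a e ha he h1 h2 h4 h5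
    rw [← Finset.sum_sub_distrib]
    refine (Finset.abs_sum_le_sum_abs _ _).trans ?_
    calc _ ≤ ∑ j : Fin (M + 1), (B * e + η * a) := by
          refine Finset.sum_le_sum fun j _ => ?_
          rw [show w j * x j - w' j * x' j = w j * (x j - x' j) + (w j - w' j) * x' j by ring]
          refine (abs_add_le _ _).trans ?_
          rw [abs_mul, abs_mul]
          exact add_le_add (mul_le_mul (h1 j) (h5 j) (abs_nonneg _) (by linarith))
            (mul_le_mul (h2 j) (h4 j) (abs_nonneg _) hη)
      _ = _ := by simp; ring
  have hbd : ∀ (w x : Fin (M + 1) → ℝ) (b a : ℝ), 1 ≤ a → (∀ j, |w j| ≤ B) → |b| ≤ B →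
      (∀ i, |x i| ≤ a) → |max (∑ j, w j * x j - b) 0| ≤ (M + 2) * B * a := by
    intro w x b a ha h1 h2 h3
    have h4 : |∑ j, w j * x j| ≤ (M + 1) * (B * a) := by
      refine (Finset.abs_sum_le_sum_abs _ _).trans ?_
      calc _ ≤ ∑ j : Fin (M + 1), B * a := Finset.sum_le_sum fun j _ => by
            rw [abs_mul]; exact mul_le_mul (h1 j) (h3 j) (abs_nonneg _) (by linarith)
        _ = _ := by simp
    have h5 : |max (∑ j, w j * x j - b) 0| ≤ |∑ j, w j * x j - b| := by
      rcases le_total (∑ j, w j * x j - b) 0 with h | h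
      · rw [max_eq_right h]; simp
      · rw [max_eq_left h]
    have h6 := abs_sub (∑ j, w j * x j) b
    nlinarith [mul_le_mul_of_nonneg_left ha (show 0 ≤ B by linarith)]
  induction L with
  | zero =>
    intro θ θ' h1 h2 h3 x x' a e ha he hx hx' hxx
    simp only [padEval]
    refine (hsum _ _ _ _ a e ha he (fun j => h1 _ _ _) (fun j => h3 _ _ _) hx' hxx).trans ?_
    have : 0 ≤ B * e + η * a := by positivity
    simp
    nlinarith
  | succ L ih =>
    intro θ θ' h1 h2 h3 x x' a e ha he hx hx' hxx
    simp only [padEval]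
    have hM : (0 : ℝ) ≤ M := Nat.cast_nonneg M
    have hA : 1 ≤ (M + 2) * B := by nlinarith
    refine (ih (fun l => θ (l + 1)) (fun l => θ' (l + 1)) (fun l => h1 _) (fun l => h2 _)
      (fun l => h3 _) _ _ ((M + 2) * B * a) ((M + 2) * B * e + (M + 2) * η * a) (by nlinarith)
      (by positivity) (fun i => hbd _ _ _ _ ha (fun j => h1 _ _ _) (h1 _ _ _) hx)
      (fun i => hbd _ _ _ _ ha (fun j => h2 _ _ _) (h2 _ _ _) hx') fun i => ?_).trans ?_
    · refine (abs_max_sub_max_le_abs _ _ _).trans ?_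
      rw [sub_sub_sub_comm]
      refine (abs_sub _ _).trans ?_
      have := hsum _ _ _ _ a e ha he (fun j => h1 0 i (some j)) (fun j => h3 0 i (some j)) hx' hxx
      have h4 := h3 0 i none
      have h5 : 0 ≤ B * e := by positivity
      nlinarith
    · push_cast
      apply le_of_eq
      ring

/-- Rounding to a multiple of `η`, towards zero. -/
lemma exists_grid_approx {B η b : ℝ} (hη : 0 < η) (hb : |b| ≤ B) :
    ∃ v : Fin (2 * ⌈B / η⌉₊ + 1), |(((v : ℕ) : ℝ) - ⌈B / η⌉₊) * η| ≤ B ∧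
      |b - (((v : ℕ) : ℝ) - ⌈B / η⌉₊) * η| ≤ η := by
  set Q := ⌈B / η⌉₊ with hQ
  have h1 : ⌊|b| / η⌋₊ ≤ Q :=
    Nat.floor_le_of_le ((div_le_div_of_nonneg_right hb hη.le).trans (Nat.le_ceil _))
  have h2 : (⌊|b| / η⌋₊ : ℝ) * η ≤ |b| := by
    rw [← le_div_iff₀ hη]; exact Nat.floor_le (by positivity)
  have h3 : |b| < (⌊|b| / η⌋₊ + 1 : ℝ) * η := by
    rw [← div_lt_iff₀ hη]; exact Nat.lt_floor_add_one _
  have h0 : (0 : ℝ) ≤ ⌊|b| / η⌋₊ * η := by positivity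
  rcases le_total 0 b with h | h
  · refine ⟨⟨Q + ⌊|b| / η⌋₊, by omega⟩, ?_⟩
    simp only [Nat.cast_add, add_sub_cancel_left]
    rw [abs_of_nonneg h] at *
    rw [abs_of_nonneg h0, abs_of_nonneg (by linarith)]
    constructor <;> linarith
  · refine ⟨⟨Q - ⌊|b| / η⌋₊, by omega⟩, ?_⟩
    simp only [Nat.cast_sub h1, sub_sub_cancel_left]
    rw [abs_of_nonpos h] at *
    rw [neg_mul, abs_neg, abs_of_nonneg h0, abs_of_nonpos (by linarith)]
    constructor <;> linarith

open Classical in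
/-- The parameters encoded by a list `c` of pairs of a position and a grid value. -/
def decodeParams {α β : Type} {S : ℕ} (c : Fin S → Option (α × β)) (val : β → ℝ) (p : α) : ℝ :=
  if h : ∃ v, ∃ k, c k = some (p, v) then val h.choose else 0

/-- A function on `α` that vanishes outside of a set with at most `S` elements can be encoded up to
errors in its values by a list of length `S`. -/
lemma exists_decodeParams {α β : Type} {S : ℕ} (s : Finset α) (hs : s.card ≤ S) (w : α → β)
    (val : β → ℝ) : ∃ c : Fin S → Option (α × β), (∀ p ∈ s, decodeParams c val p = val (w p)) ∧
      ∀ p ∉ s, decodeParams c val p = 0 := by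
  classical
  let e := s.equivFin
  refine ⟨fun k => if h : (k : ℕ) < s.card then
    some ((e.symm ⟨k, h⟩ : α), w (e.symm ⟨k, h⟩)) else none, ?_, ?_⟩
  · intro p hp
    unfold decodeParams
    have hex : ∃ v, ∃ k : Fin S, (if h : (k : ℕ) < s.card then
        some ((e.symm ⟨k, h⟩ : α), w (e.symm ⟨k, h⟩)) else none) = some (p, v) := by
      refine ⟨w p, ⟨e ⟨p, hp⟩, (e ⟨p, hp⟩).2.trans_le hs⟩, ?_⟩
      simp
    rw [dif_pos hex]
    obtain ⟨k, hk⟩ := hex.choose_spec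
    split_ifs at hk with h
    simp only [Option.some.injEq, Prod.mk.injEq] at hk
    rw [← hk.2, hk.1]
  · intro p hp
    unfold decodeParams
    rw [dif_neg]
    rintro ⟨v, k, hk⟩
    dsimp only at hk
    split_ifs at hk with h
    simp only [Option.some.injEq, Prod.mk.injEq] at hk
    exact hp (hk.1 ▸ (e.symm ⟨k, h⟩).2)

/-- Uniform covering of the class of networks by an explicit finite number of functions. -/
theorem exists_cover_fnnClass (d : ℕ) (G N S B F : ℝ) (hB : 1 ≤ B) {η : ℝ} (hη : 0 < η) :
    ∃ (ι : Type) (_ : Fintype ι) (f : ι → unitCube d → ℝ), (∀ j, Measurable (f j)) ∧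
      Fintype.card ι ≤ (⌊G⌋₊ + 1) * ((⌊G⌋₊ + 1) * ((max d ⌊N⌋₊ + 1) * (max d ⌊N⌋₊ + 2)) *
        (2 * ⌈B / η⌉₊ + 1) + 1) ^ ⌊S⌋₊ ∧
      ∀ g ∈ fnnClass d G N S B F, ∃ j, ∀ x : unitCube d, |g x - f j x| ≤
        (⌊G⌋₊ + 1) * ((((max d ⌊N⌋₊ : ℕ) : ℝ) + 2) * B) ^ ⌊G⌋₊ *
          ((((max d ⌊N⌋₊ : ℕ) : ℝ) + 2) * η) := by
  classical
  set M := max d ⌊N⌋₊ with hM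
  set Q := ⌈B / η⌉₊ with hQ
  let α := Fin (⌊G⌋₊ + 1) × Fin (M + 1) × Option (Fin (M + 1))
  let val : Fin (2 * Q + 1) → ℝ := fun v => (((v : ℕ) : ℝ) - Q) * η
  let θ : (Fin ⌊S⌋₊ → Option (α × Fin (2 * Q + 1))) →
      ℕ → Fin (M + 1) → Option (Fin (M + 1)) → ℝ := fun c l i o =>
    if h : l < ⌊G⌋₊ + 1 then decodeParams c val (⟨l, h⟩, i, o) else 0
  have hcont : Continuous fun x : unitCube d =>
      (extendZero (fun i => (x : EuclideanSpace ℝ (Fin d)) i) : Fin (M + 1) → ℝ) := by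
    refine continuous_extendZero.comp ?_
    fun_prop
  refine ⟨Fin (⌊G⌋₊ + 1) × (Fin ⌊S⌋₊ → Option (α × Fin (2 * Q + 1))), inferInstance,
    fun j x => padEval j.1 (θ j.2) (extendZero fun i => (x : EuclideanSpace ℝ (Fin d)) i),
    fun j => ((continuous_padEval _ _).comp hcont).measurable, ?_, ?_⟩
  · simp [α]
  · rintro g ⟨T, hT, hTG, hTN, hTS, hTB, -⟩
    have hB0 : 0 ≤ B := by linarith
    have hdepth : T.depth ≤ ⌊G⌋₊ := Nat.le_floor hTG
    have hwidth : T.width ≤ M + 1 := (Nat.le_floor hTN).trans ((le_max_right d _).trans (by omega))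
    obtain ⟨θ₀, s, hs1, hs2, hs3, hs4, hs5⟩ :=
      T.exists_padEval (M := M) hB0 ((le_max_left d ⌊N⌋₊).trans (by omega)) hwidth hTB
    let s' : Finset α := Finset.univ.filter fun p => ((p.1 : ℕ), p.2) ∈ s
    have hs' : s'.card ≤ ⌊S⌋₊ := by
      refine le_trans ?_ (hs1.trans (Nat.le_floor hTS))
      refine Finset.card_le_card_of_injOn (fun p => ((p.1 : ℕ), p.2))
        (fun p hp => (Finset.mem_filter.1 hp).2) ?_
      intro p _ q _ h
      simp only [Prod.mk.injEq] at h
      exact Prod.ext (Fin.ext h.1) h.2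
    choose w hw1 hw2 using fun p : α => exists_grid_approx hη (hs4 p.1 p.2.1 p.2.2)
    obtain ⟨c, hc1, hc2⟩ := exists_decodeParams s' hs' w val
    have hθ : ∀ l i o, |θ c l i o| ≤ B ∧ |θ₀ l i o - θ c l i o| ≤ η := by
      intro l i o
      by_cases hmem : (l, i, o) ∈ s
      · have hl : l < ⌊G⌋₊ + 1 := Nat.lt_succ_of_le ((hs2 _ hmem).trans hdepth)
        simp only [θ, dif_pos hl]
        rw [hc1 (⟨l, hl⟩, i, o) (Finset.mem_filter.2 ⟨Finset.mem_univ _, hmem⟩)]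
        exact ⟨hw1 (⟨l, hl⟩, i, o), hw2 (⟨l, hl⟩, i, o)⟩
      · have h0 : θ₀ l i o = 0 := by
          by_contra h
          exact hmem (hs3 l i o h)
        have h1 : θ c l i o = 0 := by
          simp only [θ]
          split_ifs with hl
          · exact hc2 _ fun h => hmem (Finset.mem_filter.1 h).2
          · rfl
        rw [h0, h1]
        simp [hη.le, hB0]
    refine ⟨(⟨T.depth, Nat.lt_succ_of_le hdepth⟩, c), fun x => ?_⟩
    have hx : ∀ i, |(extendZero (fun i => (x : EuclideanSpace ℝ (Fin d)) i) :
        Fin (M + 1) → ℝ) i| ≤ 1 := by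
      refine abs_extendZero_le zero_le_one fun i => ?_
      have := x.2 i
      exact abs_le.2 ⟨by linarith [this.1], this.2⟩
    rw [hT, ← hs5]
    refine (abs_padEval_sub_le hB hη.le T.depth θ₀ (θ c) hs4 (fun l i o => (hθ l i o).1)
      (fun l i o => (hθ l i o).2) _ _ 1 0 le_rfl le_rfl hx hx (by simp)).trans ?_
    have hA : 1 ≤ ((M : ℝ) + 2) * B := by nlinarith [Nat.cast_nonneg (α := ℝ) M]
    have hdepth' : (T.depth : ℝ) ≤ ⌊G⌋₊ := by exact_mod_cast hdepth
    rw [mul_zero, zero_add, mul_one]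
    gcongr

/-! ### Taylor's formula in Hölder balls -/

lemma convex_unitCube (d : ℕ) : Convex ℝ (unitCube d) := by
  intro x hx y hy a b ha hb hab i
  have h1 := hx i
  have h2 := hy i
  simp only [PiLp.add_apply, PiLp.smul_apply, smul_eq_mul]
  exact convex_Icc (0 : ℝ) 1 h1 h2 ha hb hab

lemma uniqueDiffOn_unitCube (d : ℕ) : UniqueDiffOn ℝ (unitCube d) := by
  refine uniqueDiffOn_convex (convex_unitCube d) ?_
  have hopen : IsOpen {x : EuclideanSpace ℝ (Fin d) | ∀ i, x i ∈ Set.Ioo (0 : ℝ) 1} := by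
    simp only [Set.ofPred_forall]
    exact isOpen_iInter_of_finite fun i => isOpen_Ioo.preimage (by fun_prop)
  refine ⟨WithLp.toLp 2 fun _ => 1 / 2, interior_maximal ?_ hopen ?_⟩
  · exact fun x hx i => Set.Ioo_subset_Icc_self (hx i)
  · intro i
    constructor <;> norm_num

/-- A Taylor estimate that only uses the oscillation of the last derivative. -/
lemma abs_sub_taylor_le {M : ℝ} (k : ℕ) : ∀ (φ : ℕ → ℝ → ℝ),
    (∀ j < k, ∀ t ∈ Set.Icc (0 : ℝ) 1,
      HasDerivWithinAt (φ j) (φ (j + 1) t) (Set.Icc 0 1) t) →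
    (∀ t ∈ Set.Icc (0 : ℝ) 1, |φ k t - φ k 0| ≤ M) →
    ∀ t ∈ Set.Icc (0 : ℝ) 1,
      |φ 0 t - ∑ j ∈ Finset.range (k + 1), φ j 0 * t ^ j / (j.factorial : ℝ)| ≤ M := by
  induction k with
  | zero =>
    intro φ _ h t ht
    simpa using h t ht
  | succ k ih =>
    intro φ hφ h t ht
    have ih' := ih (fun j => φ (j + 1)) (fun j hj => hφ (j + 1) (by omega)) h
    have hM : 0 ≤ M := (abs_nonneg _).trans (h 0 (by simp))
    set ψ : ℝ → ℝ := fun t =>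
      φ 0 t - ∑ j ∈ Finset.range (k + 2), φ j 0 * t ^ j / (j.factorial : ℝ) with hψ
    have hd : ∀ s ∈ Set.Icc (0 : ℝ) 1, HasDerivWithinAt ψ
        (φ 1 s - ∑ j ∈ Finset.range (k + 1), φ (j + 1) 0 * s ^ j / (j.factorial : ℝ))
        (Set.Icc 0 1) s := by
      intro s hs
      refine (hφ 0 (by omega) s hs).sub ?_
      have h1 : ∀ j ∈ Finset.range (k + 1), HasDerivAt
          (fun t : ℝ => φ (j + 1) 0 * t ^ (j + 1) / ((j + 1).factorial : ℝ))
          (φ (j + 1) 0 * s ^ j / (j.factorial : ℝ)) s := by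
        intro j _
        have := ((hasDerivAt_pow (j + 1) s).const_mul (φ (j + 1) 0)).div_const
          ((j + 1).factorial : ℝ)
        refine this.congr_deriv ?_
        have : (j.factorial : ℝ) ≠ 0 := by positivity
        rw [Nat.factorial_succ]
        push_cast
        field_simp
      have h2 := (HasDerivAt.fun_sum h1).add_const (φ 0 0)
      have h3 : (fun t : ℝ => ∑ j ∈ Finset.range (k + 2), φ j 0 * t ^ j / (j.factorial : ℝ)) =
          fun t => ∑ j ∈ Finset.range (k + 1),
            φ (j + 1) 0 * t ^ (j + 1) / ((j + 1).factorial : ℝ) + φ 0 0 := by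
        ext t
        rw [Finset.sum_range_succ']
        simp
      rw [h3]
      exact h2.hasDerivWithinAt
    have h4 := (convex_Icc (0 : ℝ) 1).norm_image_sub_le_of_norm_hasDerivWithin_le hd
      (C := M) (fun s hs => by simpa using ih' s hs) (Set.left_mem_Icc.2 zero_le_one) ht
    have h5 : ψ 0 = 0 := by
      simp only [hψ]
      rw [Finset.sum_range_succ']
      simp
    rw [h5, sub_zero, sub_zero, Real.norm_eq_abs, Real.norm_eq_abs, abs_of_nonneg ht.1] at h4
    exact h4.trans (mul_le_of_le_one_right hM ht.2)

section

variable {d : ℕ} {β r : ℝ} {f : EuclideanSpace ℝ (Fin d) → ℝ}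

lemma abs_partialDerivWithin_le (hr : 0 < r) (hf : f ∈ holderBall (unitCube d) β r)
    {j : ℕ} (hj : j ≤ ⌈β⌉₊ - 1) (I : Fin j → Fin d) {x : EuclideanSpace ℝ (Fin d)}
    (hx : x ∈ unitCube d) : |partialDerivWithin (unitCube d) f I x| ≤ r := by
  have h := le_trans le_self_add hf.2
  have h2 : ENNReal.ofReal |partialDerivWithin (unitCube d) f I x| ≤ ENNReal.ofReal r := by
    refine le_trans ?_ h
    exact le_iSup_of_le j (le_iSup_of_le hj (le_iSup_of_le I (le_iSup₂_of_le x hx le_rfl)))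
  exact (ENNReal.ofReal_le_ofReal_iff hr.le).1 h2

lemma abs_partialDerivWithin_sub_le (hr : 0 < r) (hf : f ∈ holderBall (unitCube d) β r)
    (I : Fin (⌈β⌉₊ - 1) → Fin d) {x z : EuclideanSpace ℝ (Fin d)}
    (hx : x ∈ unitCube d) (hz : z ∈ unitCube d) :
    |partialDerivWithin (unitCube d) f I x - partialDerivWithin (unitCube d) f I z| ≤
      r * ‖x - z‖ ^ (β - (⌈β⌉₊ : ℝ) + 1) := by
  rcases eq_or_ne x z with rfl | hxz
  · simp
    positivity
  have h := le_trans le_add_self hf.2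
  have h2 : ENNReal.ofReal (|partialDerivWithin (unitCube d) f I x -
      partialDerivWithin (unitCube d) f I z| / ‖x - z‖ ^ (β - (⌈β⌉₊ : ℝ) + 1)) ≤
      ENNReal.ofReal r := by
    refine le_trans ?_ h
    exact le_iSup_of_le I (le_iSup₂_of_le x hx (le_iSup₂_of_le z hz (le_iSup_of_le hxz le_rfl)))
  have h3 := (ENNReal.ofReal_le_ofReal_iff hr.le).1 h2
  have h4 : 0 < ‖x - z‖ := norm_pos_iff.2 (sub_ne_zero.2 hxz)
  rwa [div_le_iff₀ (by positivity)] at h3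

lemma iteratedFDerivWithin_apply_eq_sum (Ω : Set (EuclideanSpace ℝ (Fin d))) (j : ℕ)
    (x v : EuclideanSpace ℝ (Fin d)) :
    iteratedFDerivWithin ℝ j f Ω x (fun _ => v) =
      ∑ I : Fin j → Fin d, (∏ t, v (I t)) * partialDerivWithin Ω f I x := by
  have hv : v = ∑ i, v i • EuclideanSpace.single i (1 : ℝ) := by
    ext i
    simp [Pi.single_apply]
  conv_lhs => rw [hv]
  rw [ContinuousMultilinearMap.map_sum]
  refine Finset.sum_congr rfl fun I _ => ?_
  rw [ContinuousMultilinearMap.map_smul_univ, smul_eq_mul, partialDerivWithin]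

/-- Taylor's formula for a function in a Hölder ball. -/
lemma abs_sub_taylor_le_of_mem_holderBall (hβ : 0 < β) (hr : 0 < r)
    (hf : f ∈ holderBall (unitCube d) β r) {a x : EuclideanSpace ℝ (Fin d)}
    (ha : a ∈ unitCube d) (hx : x ∈ unitCube d) :
    |f x - ∑ j ∈ Finset.range (⌈β⌉₊ - 1 + 1), ∑ I : Fin j → Fin d,
      partialDerivWithin (unitCube d) f I a / (j.factorial : ℝ) * ∏ t, (x (I t) - a (I t))| ≤
      r * d ^ (⌈β⌉₊ - 1) * ‖x - a‖ ^ β := by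
  set k := ⌈β⌉₊ - 1 with hk
  set v := x - a with hv
  have hceil : 1 ≤ ⌈β⌉₊ := Nat.one_le_iff_ne_zero.2 (Nat.ceil_pos.2 hβ).ne'
  have hkβ : (k : ℝ) = ⌈β⌉₊ - 1 := by rw [hk, Nat.cast_sub hceil]; simp
  set l := β - (⌈β⌉₊ : ℝ) + 1 with hl
  have hl0 : 0 < l := by linarith [Nat.ceil_lt_add_one hβ.le]
  set φ : ℕ → ℝ → ℝ := fun j t =>
    iteratedFDerivWithin ℝ j f (unitCube d) (a + t • v) (fun _ => v) with hφ
  have hmem : ∀ t ∈ Set.Icc (0 : ℝ) 1, a + t • v ∈ unitCube d := fun t ht =>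
    (convex_unitCube d).add_smul_sub_mem ha hx ht
  have hd : ∀ j < k, ∀ t ∈ Set.Icc (0 : ℝ) 1,
      HasDerivWithinAt (φ j) (φ (j + 1) t) (Set.Icc 0 1) t := by
    intro j hj t ht
    have h1 := (hf.1.differentiableOn_iteratedFDerivWithin (m := j) (by exact_mod_cast hj)
      (uniqueDiffOn_unitCube d) _ (hmem t ht)).hasFDerivWithinAt
    have h2 : HasDerivWithinAt (fun t : ℝ => a + t • v) v (Set.Icc 0 1) t := by
      have := ((hasDerivAt_id t).smul_const v).const_add a
      simpa using this.hasDerivWithinAt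
    have h3 := h1.comp_hasDerivWithinAt t h2 hmem
    have h4 := (ContinuousMultilinearMap.apply ℝ
      (fun _ : Fin j => EuclideanSpace ℝ (Fin d)) ℝ (fun _ => v)).hasFDerivAt.comp_hasDerivWithinAt
        t h3
    refine h4.congr_deriv ?_
    simp only [hφ]
    rw [iteratedFDerivWithin_succ_apply_left]
    rfl
  have hosc : ∀ t ∈ Set.Icc (0 : ℝ) 1, |φ k t - φ k 0| ≤ r * d ^ k * ‖v‖ ^ β := by
    intro t ht
    simp only [hφ]
    rw [iteratedFDerivWithin_apply_eq_sum, iteratedFDerivWithin_apply_eq_sum,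
      ← Finset.sum_sub_distrib]
    refine (Finset.abs_sum_le_sum_abs _ _).trans ?_
    have hterm : ∀ I : Fin k → Fin d, |(∏ t, v (I t)) *
        partialDerivWithin (unitCube d) f I (a + t • v) -
        (∏ t, v (I t)) * partialDerivWithin (unitCube d) f I (a + (0 : ℝ) • v)| ≤
        r * ‖v‖ ^ β := by
      intro I
      rw [← mul_sub, abs_mul, Finset.abs_prod]
      have h1 : ∏ t, |v (I t)| ≤ ‖v‖ ^ k := by
        refine (Finset.prod_le_prod (fun _ _ => abs_nonneg _)
          (fun t _ => PiLp.norm_apply_le v (I t))).trans ?_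
        simp
      have h2 := abs_partialDerivWithin_sub_le hr hf I (hmem t ht) (hmem 0 (by simp))
      have h3 : ‖a + t • v - (a + (0 : ℝ) • v)‖ ≤ ‖v‖ := by
        rw [zero_smul, add_zero, add_sub_cancel_left, norm_smul, Real.norm_eq_abs,
          abs_of_nonneg ht.1]
        exact mul_le_of_le_one_left (norm_nonneg _) ht.2
      have h4 : r * ‖a + t • v - (a + (0 : ℝ) • v)‖ ^ l ≤ r * ‖v‖ ^ l := by gcongr
      calc _ ≤ ‖v‖ ^ k * (r * ‖v‖ ^ l) :=
            mul_le_mul h1 (h2.trans h4) (abs_nonneg _) (by positivity)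
        _ = r * (‖v‖ ^ (k : ℝ) * ‖v‖ ^ l) := by rw [Real.rpow_natCast]; ring
        _ = r * ‖v‖ ^ β := by
            rw [← Real.rpow_add_of_nonneg (norm_nonneg _) (Nat.cast_nonneg _) hl0.le]
            congr 2
            rw [hkβ, hl]; ring
    calc _ ≤ ∑ I : Fin k → Fin d, r * ‖v‖ ^ β := Finset.sum_le_sum fun I _ => hterm I
      _ = _ := by simp; ring
  have h := abs_sub_taylor_le k φ hd hosc 1 (by simp)
  convert h using 3
  · simp [hφ, hv]
  · refine Finset.sum_congr rfl fun j _ => ?_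
    simp only [hφ]
    rw [zero_smul, add_zero, iteratedFDerivWithin_apply_eq_sum, one_pow, mul_one, Finset.sum_div]
    refine Finset.sum_congr rfl fun I _ => ?_
    simp only [hv, PiLp.sub_apply]
    ring

end

/-! ### Sums of products of one-dimensional piecewise linear factors -/

/-- A factor: a nonnegative piecewise linear function of one coordinate with a single kink apart
from the truncation at `0`. Its coefficients are at most `1` in absolute value, so that it can be
computed by a network with such weights, and it is at most `1 / 2` on the unit cube. -/
structure Factor (d : ℕ) where
  /-- the coordinate -/
  idx : Fin d
  /-- the position of the kink -/
  node : ℝ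
  /-- the value at the kink -/
  const : ℝ
  /-- the slope to the right of the kink -/
  right : ℝ
  /-- the slope to the left of the kink, in the direction away from the kink -/
  left : ℝ
  node_mem : node ∈ Set.Icc (0 : ℝ) 1
  abs_const_le : |const| ≤ 1
  abs_right_le : |right| ≤ 1
  abs_left_le : |left| ≤ 1
  le_half : ∀ z ∈ Set.Icc (0 : ℝ) 1,
    const + right * max (z - node) 0 + left * max (node - z) 0 ≤ 1 / 2

/-- The value of a factor. -/
def Factor.eval {d : ℕ} (y : Factor d) (x : Fin d → ℝ) : ℝ :=
  max (y.const + y.right * max (x y.idx - y.node) 0 + y.left * max (y.node - x y.idx) 0) 0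

/-- The unit cube, as a set of plain vectors. -/
def cubeVec (d : ℕ) : Set (Fin d → ℝ) := {x | ∀ i, x i ∈ Set.Icc (0 : ℝ) 1}

lemma Factor.eval_nonneg {d : ℕ} (y : Factor d) (x : Fin d → ℝ) : 0 ≤ y.eval x := le_max_right _ _

lemma Factor.eval_le_half {d : ℕ} (y : Factor d) {x : Fin d → ℝ} (hx : x ∈ cubeVec d) :
    y.eval x ≤ 1 / 2 :=
  max_le (y.le_half _ (hx _)) (by norm_num)

/-- `IsProdSum d D J C Φ` says that on the unit cube `Φ` is a linear combination of at most `J`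
products of `D` factors each, with coefficients bounded by `C`. -/
def IsProdSum (d D J : ℕ) (C : ℝ) (Φ : (Fin d → ℝ) → ℝ) : Prop :=
  ∃ (T : Type) (_ : Fintype T) (_ : Nonempty T) (c : T → ℝ) (y : T → Fin D → Factor d),
    Fintype.card T ≤ J ∧ (∀ τ, |c τ| ≤ C) ∧ ∀ x ∈ cubeVec d, Φ x = ∑ τ, c τ * ∏ i, (y τ i).eval x

namespace IsProdSum

variable {d D J : ℕ} {C : ℝ} {Φ : (Fin d → ℝ) → ℝ}

lemma congr {Ψ : (Fin d → ℝ) → ℝ} (h : IsProdSum d D J C Φ) (he : ∀ x, Ψ x = Φ x) :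
    IsProdSum d D J C Ψ := by
  rwa [show Ψ = Φ from funext he]

lemma mono {J' : ℕ} {C' : ℝ} (h : IsProdSum d D J C Φ) (hJ : J ≤ J') (hC : C ≤ C') :
    IsProdSum d D J' C' Φ := by
  obtain ⟨T, hT, hT', c, y, h1, h2, h3⟩ := h
  exact ⟨T, hT, hT', c, y, h1.trans hJ, fun τ => (h2 τ).trans hC, h3⟩

lemma const (c : ℝ) : IsProdSum d 0 1 |c| (fun _ => c) :=
  ⟨Unit, inferInstance, inferInstance, fun _ => c, fun _ => Fin.elim0, by simp,
    fun _ => le_rfl, by simp⟩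

lemma mul_factor (h : IsProdSum d D J C Φ) (φ : Factor d) :
    IsProdSum d (D + 1) J C (fun x => Φ x * φ.eval x) := by
  obtain ⟨T, hT, hT', c, y, h1, h2, h3⟩ := h
  refine ⟨T, hT, hT', c, fun τ => Fin.cons φ (y τ), h1, h2, fun x hx => ?_⟩
  simp only [Fin.prod_univ_succ, Fin.cons_zero, Fin.cons_succ]
  rw [h3 x hx, Finset.sum_mul]
  exact Finset.sum_congr rfl fun τ _ => by ring

lemma const_mul (h : IsProdSum d D J C Φ) (a : ℝ) :
    IsProdSum d D J (|a| * C) (fun x => a * Φ x) := by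
  obtain ⟨T, hT, hT', c, y, h1, h2, h3⟩ := h
  refine ⟨T, hT, hT', fun τ => a * c τ, y, h1, fun τ => ?_, fun x hx => ?_⟩
  · rw [abs_mul]
    exact mul_le_mul_of_nonneg_left (h2 τ) (abs_nonneg a)
  · simp only [h3 x hx, Finset.mul_sum]
    exact Finset.sum_congr rfl fun τ _ => by ring

lemma sum {G : Type} [Fintype G] [Nonempty G] {Φ : G → (Fin d → ℝ) → ℝ}
    (h : ∀ g, IsProdSum d D J C (Φ g)) :
    IsProdSum d D (Fintype.card G * J) C (fun x => ∑ g, Φ g x) := by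
  choose T hT hT' c y h1 h2 h3 using h
  refine ⟨Σ g, T g, inferInstance, ⟨⟨Classical.arbitrary G, (hT' _).some⟩⟩, fun τ => c τ.1 τ.2,
    fun τ => y τ.1 τ.2, ?_,
    fun τ => h2 τ.1 τ.2, fun x hx => ?_⟩
  · rw [Fintype.card_sigma]
    calc _ ≤ ∑ _g : G, J := Finset.sum_le_sum fun g _ => h1 g
      _ = _ := by simp
  · rw [Fintype.sum_sigma]
    exact Finset.sum_congr rfl fun g _ => h3 g x hx

lemma add {Ψ : (Fin d → ℝ) → ℝ} (h : IsProdSum d D J C Φ) (h' : IsProdSum d D J C Ψ) :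
    IsProdSum d D (2 * J) C (fun x => Φ x + Ψ x) := by
  have := sum (G := Bool) (Φ := fun b => if b then Φ else Ψ) (J := J) (C := C) (D := D) fun b => by
    cases b
    · simpa using h'
    · simpa using h
  simpa using this

/-- Multiplication by a dummy factor. -/
lemma pad [NeZero d] (h : IsProdSum d D J C Φ) : IsProdSum d (D + 1) J (2 * C) Φ := by
  let φ : Factor d := ⟨0, 0, 1 / 2, 0, 0, by simp, by norm_num [abs_of_pos], by simp, by simp,
    by simp⟩
  have h2 := (h.const_mul 2).mul_factor φ
  rw [abs_of_pos two_pos] at h2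
  refine h2.congr fun x => ?_
  have : φ.eval x = 1 / 2 := by simp [Factor.eval, φ]
  rw [this]
  ring

lemma pad_iterate [NeZero d] (h : IsProdSum d D J C Φ) (j : ℕ) :
    IsProdSum d (D + j) J (2 ^ j * C) Φ := by
  induction j with
  | zero => simpa using h
  | succ j ih => exact ih.pad.mono le_rfl (by rw [pow_succ]; linarith)

/-- Multiplication by `x i - a`, which is a difference of two factors. -/
lemma mul_sub (h : IsProdSum d D J C Φ) (i : Fin d) {a : ℝ} (ha : a ∈ Set.Icc (0 : ℝ) 1) :
    IsProdSum d (D + 1) (2 * J) (2 * C) (fun x => Φ x * (x i - a)) := by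
  have habs : |(1 / 2 : ℝ)| ≤ 1 := by norm_num [abs_of_pos]
  let φ : Factor d := ⟨i, a, 0, 1 / 2, 0, ha, by simp, habs, by simp, fun z hz => by
    have : max (z - a) 0 ≤ 1 := max_le (by linarith [hz.2, ha.1]) zero_le_one
    linarith⟩
  let ψ : Factor d := ⟨i, a, 0, 0, 1 / 2, ha, by simp, by simp, habs, fun z hz => by
    have : max (a - z) 0 ≤ 1 := max_le (by linarith [hz.1, ha.2]) zero_le_one
    linarith⟩
  have h1 := (h.const_mul 2).mul_factor φ
  have h2 := (h.const_mul (-2)).mul_factor ψ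
  rw [abs_neg] at h2
  rw [abs_of_pos two_pos] at h1 h2
  refine (h1.add h2).congr fun x => ?_
  simp only [Factor.eval, φ, ψ]
  rcases le_total (x i) a with h | h
  · rw [max_eq_right (by linarith : x i - a ≤ 0), max_eq_left (by linarith : 0 ≤ a - x i),
      max_eq_left (by linarith), max_eq_left (by linarith)]
    ring
  · rw [max_eq_left (by linarith : 0 ≤ x i - a), max_eq_right (by linarith : a - x i ≤ 0),
      max_eq_left (by linarith), max_eq_left (by linarith)]
    ring

lemma mul_prod_sub (h : IsProdSum d D J C Φ) : ∀ (j : ℕ) (I : Fin j → Fin d) (a : Fin j → ℝ),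
    (∀ t, a t ∈ Set.Icc (0 : ℝ) 1) →
    IsProdSum d (D + j) (2 ^ j * J) (2 ^ j * C) (fun x => Φ x * ∏ t, (x (I t) - a t))
  | 0, _, _, _ => by simpa using h
  | j + 1, I, a, ha => by
    have h1 := (mul_prod_sub h j (fun t => I t.succ) (fun t => a t.succ) fun t => ha _).mul_sub
      (I 0) (ha 0)
    refine (h1.mono (le_of_eq ?_) (le_of_eq ?_)).congr fun x => ?_
    · ring
    · ring
    · rw [Fin.prod_univ_succ]
      ring

end IsProdSum

/-! ### Hat functions and partitions of unity -/

/-- The hat function with peak `1` at `b` that vanishes outside of `[a, c]`. -/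
def hat (a b c z : ℝ) : ℝ := max (1 - max (z - b) 0 / (c - b) - max (b - z) 0 / (b - a)) 0

lemma hat_nonneg (a b c z : ℝ) : 0 ≤ hat a b c z := le_max_right _ _

lemma hat_one_sub (a b c z : ℝ) : hat a b c (1 - z) = hat (1 - c) (1 - b) (1 - a) z := by
  unfold hat
  rw [show 1 - z - b = 1 - b - z by ring, show b - (1 - z) = z - (1 - b) by ring,
    show 1 - a - (1 - b) = b - a by ring, show 1 - b - (1 - c) = c - b by ring, sub_right_comm]

lemma mem_of_hat_ne_zero {a b c z : ℝ} (hab : a < b) (hbc : b < c) (h : hat a b c z ≠ 0) :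
    a < z ∧ z < c := by
  by_contra hcon
  apply h
  unfold hat
  have h1 : 0 ≤ max (z - b) 0 / (c - b) := div_nonneg (le_max_right _ _) (by linarith)
  have h2 : 0 ≤ max (b - z) 0 / (b - a) := div_nonneg (le_max_right _ _) (by linarith)
  apply max_eq_right
  rcases not_and_or.1 hcon with h3 | h3
  · have : 1 ≤ max (b - z) 0 / (b - a) := by
      rw [one_le_div (by linarith)]
      exact le_max_of_le_left (by linarith)
    linarith
  · have : 1 ≤ max (z - b) 0 / (c - b) := by
      rw [one_le_div (by linarith)]
      exact le_max_of_le_left (by linarith)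
    linarith

/-- A hat function is a difference of two consecutive ramps. -/
lemma hat_eq_sub {a b c z : ℝ} (hab : a < b) (hbc : b < c) :
    hat a b c z = max 0 (min 1 ((z - a) / (b - a))) - max 0 (min 1 ((z - b) / (c - b))) := by
  unfold hat
  have hab' : 0 < b - a := by linarith
  have hbc' : 0 < c - b := by linarith
  rcases le_total z b with h | h
  · rw [max_eq_right (by linarith : z - b ≤ 0), max_eq_left (by linarith : 0 ≤ b - z), zero_div,
      sub_zero, max_eq_left (min_le_of_right_le (div_nonpos_of_nonpos_of_nonneg (by linarith)
        hbc'.le)), sub_zero, min_eq_right ((div_le_one hab').2 (by linarith)), max_comm]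
    congr 1
    field_simp
    ring
  · rw [max_eq_left (by linarith : 0 ≤ z - b), max_eq_right (by linarith : b - z ≤ 0), zero_div,
      sub_zero, min_eq_left ((one_le_div hab').2 (by linarith)), max_eq_right zero_le_one]
    have h0 : 0 ≤ (z - b) / (c - b) := div_nonneg (by linarith) hbc'.le
    rw [max_eq_right (le_min zero_le_one h0)]
    rcases le_total 1 ((z - b) / (c - b)) with h1 | h1
    · rw [min_eq_left h1, max_eq_right (by linarith)]; ring
    · rw [min_eq_right h1, max_eq_left (by linarith)]

lemma sum_hat_eq_one {a : ℕ → ℝ} (ha : StrictMono a) {m : ℕ} {z : ℝ}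
    (h1 : a 1 ≤ z) (h2 : z ≤ a m) : ∑ i : Fin m, hat (a i) (a (i + 1)) (a (i + 2)) z = 1 := by
  rw [Fin.sum_univ_eq_sum_range (fun i => hat (a i) (a (i + 1)) (a (i + 2)) z)]
  set s : ℕ → ℝ := fun i => max 0 (min 1 ((z - a i) / (a (i + 1) - a i))) with hs
  have : ∀ i, hat (a i) (a (i + 1)) (a (i + 2)) z = s i - s (i + 1) := fun i =>
    hat_eq_sub (ha (by omega)) (ha (by omega))
  simp only [this]
  rw [Finset.sum_range_sub']
  have h0 : s 0 = 1 := by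
    simp only [hs, zero_add]
    have : a 0 < a 1 := ha (by omega)
    rw [min_eq_left ((one_le_div (by linarith)).2 (by linarith)), max_eq_right zero_le_one]
  have hm : s m = 0 := by
    simp only [hs]
    have : a m < a (m + 1) := ha (by omega)
    rw [max_eq_left (min_le_of_right_le
      (div_nonpos_of_nonpos_of_nonneg (by linarith) (by linarith)))]
  rw [h0, hm, sub_zero]

/-- Local approximations are glued together by a partition of unity. -/
lemma abs_sum_mul_sub_le {G : Type*} [Fintype G] {h P : G → ℝ} {y E : ℝ} (h0 : ∀ g, 0 ≤ h g)
    (h1 : ∑ g, h g = 1) (hE : ∀ g, h g ≠ 0 → |P g - y| ≤ E) : |∑ g, h g * P g - y| ≤ E := by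
  have h2 : ∑ g, h g * P g - y = ∑ g, h g * (P g - y) := by
    simp only [mul_sub, Finset.sum_sub_distrib, ← Finset.sum_mul, h1, one_mul]
  rw [h2]
  refine (Finset.abs_sum_le_sum_abs _ _).trans ?_
  calc _ ≤ ∑ g, h g * E := Finset.sum_le_sum fun g _ => by
        rw [abs_mul, abs_of_nonneg (h0 g)]
        rcases eq_or_ne (h g) 0 with h3 | h3
        · simp [h3]
        · exact mul_le_mul_of_nonneg_left (hE g h3) (h0 g)
    _ = E := by rw [← Finset.sum_mul, h1, one_mul]

lemma IsProdSum.mul_hat {d D J : ℕ} {C : ℝ} {Φ : (Fin d → ℝ) → ℝ} (h : IsProdSum d D J C Φ)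
    (i : Fin d) {a b c Δ : ℝ} (hb : b ∈ Set.Icc (0 : ℝ) 1) (hΔ0 : 0 < Δ) (hΔ1 : Δ ≤ 1)
    (hab : Δ ≤ b - a) (hbc : Δ ≤ c - b) :
    IsProdSum d (D + 1) J (2 / Δ * C) (fun x => Φ x * hat a b c (x i)) := by
  have key : ∀ {w : ℝ}, Δ ≤ w → |-(Δ / 2 / w)| ≤ 1 := fun {w} hw => by
    have hw0 : 0 < w := by linarith
    rw [abs_neg, abs_of_nonneg (by positivity), div_le_one hw0]
    linarith
  have hnn : ∀ {w v : ℝ}, Δ ≤ w → 0 ≤ Δ / 2 / w * max v 0 := fun {w v} hw => by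
    have hw0 : 0 < w := by linarith
    have := le_max_right v 0
    positivity
  let φ : Factor d := ⟨i, b, Δ / 2, -(Δ / 2 / (c - b)), -(Δ / 2 / (b - a)), hb,
    by rw [abs_of_pos (by linarith)]; linarith, key hbc, key hab, fun z _ => by
      have h1 := hnn (v := z - b) hbc
      have h2 := hnn (v := b - z) hab
      linarith⟩
  have h1 := (h.const_mul (2 / Δ)).mul_factor φ
  rw [abs_of_pos (by positivity)] at h1
  refine h1.congr fun x => ?_
  have h2 : φ.eval x = Δ / 2 * hat a b c (x i) := by
    simp only [Factor.eval, φ, hat]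
    rw [mul_max_of_nonneg _ _ (by positivity : (0 : ℝ) ≤ Δ / 2), mul_zero]
    congr 1
    ring
  rw [h2]
  field_simp

lemma IsProdSum.mul_prod_hat {d D J : ℕ} {C : ℝ} {Φ : (Fin d → ℝ) → ℝ} (h : IsProdSum d D J C Φ)
    {Δ : ℝ} (hΔ0 : 0 < Δ) (hΔ1 : Δ ≤ 1) : ∀ (n : ℕ) (I : Fin n → Fin d) (a b c : Fin n → ℝ),
    (∀ t, b t ∈ Set.Icc (0 : ℝ) 1) → (∀ t, Δ ≤ b t - a t) → (∀ t, Δ ≤ c t - b t) →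
    IsProdSum d (D + n) J ((2 / Δ) ^ n * C)
      (fun x => Φ x * ∏ t, hat (a t) (b t) (c t) (x (I t)))
  | 0, _, _, _, _, _, _, _ => by simpa using h
  | n + 1, I, a, b, c, hb, hab, hbc => by
    have h1 := (mul_prod_hat h hΔ0 hΔ1 n (fun t => I t.succ) (fun t => a t.succ)
      (fun t => b t.succ) (fun t => c t.succ) (fun t => hb _) (fun t => hab _)
      (fun t => hbc _)).mul_hat (I 0) (hb 0) hΔ0 hΔ1 (hab 0) (hbc 0)
    refine (h1.mono le_rfl (le_of_eq ?_)).congr fun x => ?_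
    · ring
    · rw [Fin.prod_univ_succ]
      ring

/-! ### Approximation of Hölder functions and of the logit -/

lemma norm_le_of_abs_le {d : ℕ} {v : EuclideanSpace ℝ (Fin d)} {e : ℝ} (h : ∀ i, |v i| ≤ e) :
    ‖v‖ ≤ d * e := by
  have hv : v = ∑ i, v i • EuclideanSpace.single i (1 : ℝ) := by
    ext i
    simp [Pi.single_apply]
  rw [hv]
  refine (norm_sum_le _ _).trans ?_
  calc _ ≤ ∑ _i : Fin d, e := Finset.sum_le_sum fun i _ => by
        rw [norm_smul]; simpa using h i
    _ = _ := by simp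

/-- Piecewise Taylor approximation of a Hölder function on a grid of mesh `1 / K`. The number of
terms is of order `K ^ d`. -/
lemma exists_isProdSum_holder {d : ℕ} (hd : 0 < d) {β r : ℝ} (hβ : 0 < β) (hr : 0 < r)
    {f : EuclideanSpace ℝ (Fin d) → ℝ} (hf : f ∈ holderBall (unitCube d) β r) {K : ℕ}
    (hK : 0 < K) :
    ∃ Φ : (Fin d → ℝ) → ℝ, IsProdSum d (⌈β⌉₊ - 1 + d)
      ((K + 1) ^ d * (⌈β⌉₊ * (d ^ (⌈β⌉₊ - 1) * 2 ^ (⌈β⌉₊ - 1))))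
      ((2 * K) ^ d * (2 ^ (⌈β⌉₊ - 1) * r)) Φ ∧
      ∀ x : EuclideanSpace ℝ (Fin d), x ∈ unitCube d →
        |Φ x - f x| ≤ r * d ^ (⌈β⌉₊ - 1) * (d * (1 / K)) ^ β := by
  have : NeZero d := ⟨hd.ne'⟩
  set k := ⌈β⌉₊ - 1 with hk
  have hk1 : ⌈β⌉₊ = k + 1 := by
    have := Nat.ceil_pos.2 hβ
    omega
  have hK' : (0 : ℝ) < K := by exact_mod_cast hK
  set a : ℕ → ℝ := fun i => ((i : ℝ) - 1) / K with ha
  have hmono : StrictMono a := by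
    intro i j hij
    simp only [ha]
    have : (i : ℝ) < j := by exact_mod_cast hij
    gcongr
  have hstep : ∀ i, a (i + 1) - a i = 1 / K := by
    intro i
    simp only [ha]
    push_cast
    ring
  have hnode : ∀ i : Fin (K + 1), a (i + 1) ∈ Set.Icc (0 : ℝ) 1 := by
    intro i
    have h1 : ((i : ℕ) : ℝ) ≤ K := by exact_mod_cast Nat.lt_succ_iff.1 i.2
    simp only [ha]
    push_cast
    rw [add_sub_cancel_right]
    exact ⟨by positivity, (div_le_one hK').2 h1⟩
  -- the grid points
  set p : (Fin d → Fin (K + 1)) → EuclideanSpace ℝ (Fin d) := fun g =>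
    WithLp.toLp 2 fun i => a (g i + 1) with hp
  have hpc : ∀ g, p g ∈ unitCube d := fun g i => hnode (g i)
  set H : (Fin d → Fin (K + 1)) → (Fin d → ℝ) → ℝ := fun g x =>
    ∏ i, hat (a (g i)) (a (g i + 1)) (a (g i + 2)) (x i) with hH
  set P : (Fin d → Fin (K + 1)) → (Fin d → ℝ) → ℝ := fun g x =>
    ∑ j : Fin (k + 1), ∑ I : Fin j → Fin d,
      partialDerivWithin (unitCube d) f I (p g) / ((j : ℕ).factorial : ℝ) *
        ∏ t, (x (I t) - p g (I t)) with hP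
  refine ⟨fun x => ∑ g, H g x * P g x, ?_, ?_⟩
  · have hterm : ∀ (g : Fin d → Fin (K + 1)) (j : Fin (k + 1)) (I : Fin j → Fin d),
        IsProdSum d (k + d) (2 ^ (j : ℕ)) ((2 * K) ^ d * (2 ^ k * r)) (fun x =>
          H g x * (partialDerivWithin (unitCube d) f I (p g) / ((j : ℕ).factorial : ℝ) *
            ∏ t, (x (I t) - p g (I t)))) := by
      intro g j I
      have hj : (j : ℕ) ≤ k := Nat.lt_succ_iff.1 j.2
      set c := partialDerivWithin (unitCube d) f I (p g) / ((j : ℕ).factorial : ℝ) with hc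
      have hcr : |c| ≤ r := by
        rw [hc, abs_div, Nat.abs_cast]
        have h1 : (1 : ℝ) ≤ (j : ℕ).factorial := by exact_mod_cast Nat.factorial_pos _
        exact (div_le_self (abs_nonneg _) h1).trans
          (abs_partialDerivWithin_le hr hf hj I (hpc g))
      have h1 := (((IsProdSum.const (d := d) c).mul_prod_sub j I (fun t => p g (I t))
        (fun t => hpc g _)).pad_iterate (k - j)).mul_prod_hat (Δ := 1 / K) (by positivity)
        ((div_le_one hK').2 (by exact_mod_cast hK)) d id (fun i => a (g i))
        (fun i => a (g i + 1)) (fun i => a (g i + 2)) (fun i => hnode (g i))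
        (fun i => (hstep _).ge) (fun i => (hstep _).ge)
      have hD : 0 + (j : ℕ) + (k - j) + d = k + d := by omega
      rw [hD] at h1
      refine (h1.mono (by simp) ?_).congr fun x => ?_
      · rw [← mul_assoc (2 ^ (k - (j : ℕ))), ← pow_add, Nat.sub_add_cancel hj, one_div,
          div_inv_eq_mul]
        gcongr
      · simp only [id, hH]
        ring
    have h1 := IsProdSum.sum fun g : Fin d → Fin (K + 1) => IsProdSum.sum fun j : Fin (k + 1) =>
      (IsProdSum.sum fun I : Fin j → Fin d => hterm g j I).mono
        (J' := d ^ k * 2 ^ k) (by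
          have hj : (j : ℕ) ≤ k := Nat.lt_succ_iff.1 j.2
          simp only [Fintype.card_fun, Fintype.card_fin]
          exact Nat.mul_le_mul (Nat.pow_le_pow_right hd hj) (Nat.pow_le_pow_right two_pos hj))
        le_rfl
    refine (h1.mono (by simp [hk1]) le_rfl).congr fun x => ?_
    simp only [hP, Finset.mul_sum]
  · intro x hx
    refine abs_sum_mul_sub_le (h := fun g => H g x) (fun g => Finset.prod_nonneg fun i _ =>
      hat_nonneg _ _ _ _) ?_ fun g hg => ?_
    · simp only [hH]
      rw [← Fintype.prod_sum fun i (j : Fin (K + 1)) =>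
        hat (a j) (a (j + 1)) (a (j + 2)) (x i)]
      refine Finset.prod_eq_one fun i _ => sum_hat_eq_one hmono ?_ ?_
      · simpa [ha] using (hx i).1
      · simp only [ha]
        push_cast
        rw [add_sub_cancel_right, div_self hK'.ne']
        exact (hx i).2
    · have hxi : ∀ i, |(x - p g) i| ≤ 1 / K := by
        intro i
        have h1 := mem_of_hat_ne_zero (hmono (by omega)) (hmono (by omega))
          (Finset.prod_ne_zero_iff.1 hg i (Finset.mem_univ i))
        have h2 := hstep (g i)
        have h3 := hstep (g i + 1)
        rw [abs_le, PiLp.sub_apply]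
        simp only [hp]
        exact ⟨by linarith [h1.1], by linarith [h1.2]⟩
      rw [abs_sub_comm]
      have h := abs_sub_taylor_le_of_mem_holderBall hβ hr hf (hpc g) hx
      rw [← hk, Finset.sum_range] at h
      refine h.trans ?_
      have := norm_le_of_abs_le hxi
      gcongr

/-- One cell of a piecewise polynomial function of one variable. -/
lemma isProdSum_hat_mul_polynomial {q : ℕ} {a b c Δ E : ℝ} (hb : b ∈ Set.Icc (0 : ℝ) 1)
    (hΔ0 : 0 < Δ) (hΔ1 : Δ ≤ 1) (hab : Δ ≤ b - a) (hbc : Δ ≤ c - b) (w : ℕ → ℝ)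
    (hw : ∀ i ≤ q, |w i| ≤ E) :
    IsProdSum 1 (q + 1) ((q + 1) * 2 ^ q) (2 / Δ * (2 ^ q * E)) (fun x =>
      hat a b c (x 0) * ∑ i ∈ Finset.range (q + 1), w i * (x 0 - b) ^ i) := by
  have hE : 0 ≤ E := (abs_nonneg _).trans (hw 0 (Nat.zero_le _))
  have h1 : ∀ i : Fin (q + 1), IsProdSum 1 q (2 ^ q) (2 ^ q * E)
      (fun x => w i * (x 0 - b) ^ (i : ℕ)) := by
    intro i
    have hi : (i : ℕ) ≤ q := Nat.lt_succ_iff.1 i.2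
    have h := ((IsProdSum.const (d := 1) (w i)).mul_prod_sub i (fun _ => 0) (fun _ => b)
      (fun _ => hb)).pad_iterate (q - i)
    rw [show 0 + (i : ℕ) + (q - i) = q by omega] at h
    refine (h.mono ?_ ?_).congr fun x => ?_
    · rw [mul_one]
      exact Nat.pow_le_pow_right two_pos hi
    · rw [← mul_assoc, ← pow_add, Nat.sub_add_cancel hi]
      exact mul_le_mul_of_nonneg_left (hw i hi) (by positivity)
    · simp
  have h2 := (IsProdSum.sum h1).mul_hat 0 hb hΔ0 hΔ1 hab hbc
  refine (h2.mono (by simp) le_rfl).congr fun x => ?_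
  rw [Finset.sum_range, mul_comm]

/-- Taylor approximation of the logarithm around `b`. -/
lemma abs_log_taylor_le {b z σ : ℝ} (hb : 0 < b) (hσ : σ ≤ 1 / 2) (hz : |z - b| ≤ σ * b) (q : ℕ) :
    |(Real.log b - ∑ i ∈ Finset.range q, ((b - z) / b) ^ (i + 1) / ((i : ℝ) + 1)) - Real.log z| ≤
      2 * σ ^ (q + 1) := by
  have hu : |(b - z) / b| ≤ σ := by
    rw [abs_div, abs_of_pos hb, div_le_iff₀ hb, abs_sub_comm]
    exact hz
  have hσ0 : 0 ≤ σ := (abs_nonneg _).trans hu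
  have h := Real.abs_log_sub_add_sum_range_le (x := (b - z) / b) (by linarith) q
  have hz0 : 0 < z := by
    have := (abs_le.1 hz).1
    nlinarith
  have h1 : Real.log (1 - (b - z) / b) = Real.log z - Real.log b := by
    rw [← Real.log_div hz0.ne' hb.ne']
    congr 1
    field_simp
    ring
  rw [h1] at h
  rw [abs_sub_comm]
  calc _ = |∑ i ∈ Finset.range q, ((b - z) / b) ^ (i + 1) / ((i : ℝ) + 1) +
        (Real.log z - Real.log b)| := by congr 1; ring
    _ ≤ |(b - z) / b| ^ (q + 1) / (1 - |(b - z) / b|) := h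
    _ ≤ σ ^ (q + 1) / (1 / 2) := by
        gcongr
        linarith
    _ = 2 * σ ^ (q + 1) := by ring

/-- Piecewise Taylor approximation of the logit `log z - log (1 - z)` on `[δ, 1 - δ]`, on a
geometric grid with ratio `e ^ s`. On such a grid the relative distance to the nodes, and therefore
the Taylor error of the logarithm, is the same at all scales. -/
lemma exists_isProdSum_logit {δ s : ℝ} {M q : ℕ} (hδ0 : 0 < δ) (hδ1 : δ ≤ 1 / 2) (hM : 0 < M)
    (hq : 0 < q) (hs : s * M = Real.log (1 / δ)) (hs1 : s ≤ 1 / 4) :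
    ∃ Φ : (Fin 1 → ℝ) → ℝ, IsProdSum 1 (q + 1) (2 * ((M + 1) * ((q + 1) * 2 ^ q)))
      (4 / (δ * s) * (2 ^ q * (1 / δ) ^ q)) Φ ∧
      ∀ x : Fin 1 → ℝ, δ ≤ x 0 → x 0 ≤ 1 - δ →
        |Φ x - (Real.log (x 0) - Real.log (1 - x 0))| ≤ 4 * (2 * s) ^ (q + 1) := by
  have hM' : (0 : ℝ) < M := by exact_mod_cast hM
  have hδinv : 1 ≤ 1 / δ := by rw [one_le_div hδ0]; linarith
  have hlog : 0 < Real.log (1 / δ) := Real.log_pos (by rw [lt_div_iff₀ hδ0]; linarith)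
  have hs0 : 0 < s := by
    by_contra h
    nlinarith
  set a : ℕ → ℝ := fun i => δ * Real.exp (s * ((i : ℝ) - 1)) with ha
  have ha0 : ∀ i, 0 < a i := fun i => by simp only [ha]; positivity
  have hmono : StrictMono a := by
    intro i j hij
    simp only [ha]
    have : (i : ℝ) < j := by exact_mod_cast hij
    gcongr
  have hsucc : ∀ i, a (i + 1) = a i * Real.exp s := by
    intro i
    simp only [ha]
    rw [mul_assoc, ← Real.exp_add]
    push_cast
    ring_nf
  have ha1 : a 1 = δ := by simp [ha]
  have haM : a (M + 1) = 1 := by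
    simp only [ha]
    push_cast
    rw [add_sub_cancel_right, hs, Real.exp_log (by positivity)]
    field_simp
  have hnode : ∀ i : Fin (M + 1), δ ≤ a (i + 1) ∧ a (i + 1) ≤ 1 := by
    intro i
    rw [← ha1, ← haM]
    exact ⟨hmono.monotone (by omega), hmono.monotone (by omega)⟩
  -- `s / 2 ≤ 1 - e ^ (-s)` and `e ^ s - 1 ≤ 2 s`
  have hexp1 : Real.exp s - 1 ≤ 2 * s := by
    have := Real.abs_exp_sub_one_le (x := s) (by rw [abs_of_pos hs0]; linarith)
    rw [abs_of_pos hs0] at this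
    exact (le_abs_self _).trans this
  have hexp2 : 1 + s ≤ Real.exp s := by linarith [Real.add_one_le_exp s]
  have hgap : ∀ i : ℕ, a (i + 1) - a i ≤ 2 * s * a i ∧ s * a i ≤ a (i + 1) - a i := by
    intro i
    rw [hsucc]
    constructor <;> nlinarith [ha0 i]
  have hΔ : ∀ i : Fin (M + 1), δ * s / 2 ≤ a (i + 1) - a i ∧
      δ * s / 2 ≤ a (i + 2) - a (i + 1) := by
    intro i
    have h1 := (hnode i).1
    have h2 := hgap i
    have h3 := hgap (i + 1)
    have h4 : a (i + 1) ≤ 2 * a i := by nlinarith [ha0 i]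
    constructor
    · nlinarith
    · have : i + 2 = (i : ℕ) + 1 + 1 := rfl
      nlinarith
  -- coefficients of the Taylor polynomial; `e = ± 1` accounts for the reflection `z ↦ 1 - z`
  set w : ℝ → ℕ → ℕ → ℝ := fun e i j =>
    if j = 0 then Real.log (a (i + 1)) else -(e / a (i + 1)) ^ j / j with hw
  have hwE : ∀ e : ℝ, |e| = 1 → ∀ (i : Fin (M + 1)), ∀ j ≤ q, |w e i j| ≤ (1 / δ) ^ q := by
    intro e he i j hj
    obtain ⟨h1, h2⟩ := hnode i
    have h3 : 1 / a (i + 1) ≤ 1 / δ := one_div_le_one_div_of_le hδ0 h1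
    have h5 : (1 / δ) ^ 1 ≤ (1 / δ) ^ q := pow_le_pow_right₀ hδinv hq
    simp only [hw]
    split_ifs with hj0
    · rw [abs_of_nonpos (Real.log_nonpos (by linarith) h2), ← Real.log_inv, ← one_div]
      have := Real.log_le_sub_one_of_pos (show 0 < 1 / a (i + 1) by
        have := ha0 (i + 1); positivity)
      rw [pow_one] at h5
      linarith
    · have hj1 : (1 : ℝ) ≤ j := by exact_mod_cast Nat.one_le_iff_ne_zero.2 hj0
      rw [abs_div, abs_neg, abs_pow, abs_div, he, abs_of_pos (ha0 (i + 1)), Nat.abs_cast]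
      refine (div_le_self (by have := ha0 (i + 1); positivity) hj1).trans ?_
      exact (pow_le_pow_left₀ (by have := ha0 (i + 1); positivity) h3 j).trans
        (pow_le_pow_right₀ hδinv hj)
  have hsum : ∀ (e : ℝ) (i : ℕ) (u : ℝ), ∑ j ∈ Finset.range (q + 1), w e i j * u ^ j =
      Real.log (a (i + 1)) -
        ∑ j ∈ Finset.range q, (e * u / a (i + 1)) ^ (j + 1) / ((j : ℝ) + 1) := by
    intro e i u
    rw [Finset.sum_range_succ', sub_eq_neg_add, ← Finset.sum_neg_distrib]
    congr 1
    · refine Finset.sum_congr rfl fun j _ => ?_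
      simp only [hw, Nat.add_eq_zero_iff, one_ne_zero, and_false, if_false]
      push_cast
      rw [mul_div_right_comm, mul_pow]
      ring
    · simp [hw]
  have happ : ∀ z, δ ≤ z → z ≤ 1 → |∑ i : Fin (M + 1), hat (a i) (a (i + 1)) (a (i + 2)) z *
      (Real.log (a (i + 1)) - ∑ j ∈ Finset.range q,
        ((a (i + 1) - z) / a (i + 1)) ^ (j + 1) / ((j : ℝ) + 1)) - Real.log z| ≤
      2 * (2 * s) ^ (q + 1) := by
    intro z hz0 hz1
    refine abs_sum_mul_sub_le (fun i => hat_nonneg _ _ _ _)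
      (sum_hat_eq_one hmono (by rwa [ha1]) (by rwa [haM])) fun i hi => ?_
    have h1 := mem_of_hat_ne_zero (hmono (by omega)) (hmono (by omega)) hi
    refine abs_log_taylor_le (ha0 _) (by linarith) ?_ q
    have h2 := hgap i
    have h3 := hgap (i + 1)
    have h4 : a i ≤ a (i + 1) := hmono.monotone (by omega)
    rw [abs_le]
    constructor
    · nlinarith
    · linarith [h1.2, h3.1]
  have hΔ0 : 0 < δ * s / 2 := by positivity
  have hΔ1 : δ * s / 2 ≤ 1 := by nlinarith
  have hC : 2 / (δ * s / 2) * (2 ^ q * (1 / δ) ^ q) = 4 / (δ * s) * (2 ^ q * (1 / δ) ^ q) := by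
    field_simp
    ring
  have hP1 := IsProdSum.sum fun i : Fin (M + 1) => isProdSum_hat_mul_polynomial
    (b := a (i + 1)) (a := a i) (c := a (i + 2))
    ⟨(ha0 _).le, (hnode i).2⟩ hΔ0 hΔ1 (hΔ i).1 (hΔ i).2 (w (-1) i) (hwE (-1) (by simp) i)
  have hP2 := (IsProdSum.sum fun i : Fin (M + 1) => isProdSum_hat_mul_polynomial
    (b := 1 - a (i + 1)) (a := 1 - a (i + 2)) (c := 1 - a i)
    ⟨by linarith [(hnode i).2], by linarith [(ha0 (i + 1)).le]⟩ hΔ0 hΔ1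
    (by linarith [(hΔ i).2]) (by linarith [(hΔ i).1]) (w 1 i) (hwE 1 (by simp) i)).const_mul (-1)
  rw [abs_neg, abs_one, one_mul] at hP2
  have hP := hP1.add hP2
  rw [hC, Fintype.card_fin] at hP
  refine ⟨_, hP, fun x hx0 hx1 => ?_⟩
  have h1 := happ (x 0) hx0 (by linarith)
  have h2 := happ (1 - x 0) (by linarith) (by linarith)
  simp only [hsum]
  simp only [hat_one_sub] at h2
  have e1 : ∀ i : ℕ, -1 * (x 0 - a (i + 1)) = a (i + 1) - x 0 := fun i => by ring
  have e2 : ∀ i : ℕ, 1 * (x 0 - (1 - a (i + 1))) = a (i + 1) - (1 - x 0) := fun i => by ring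
  simp only [e1, e2]
  rw [abs_le] at h1 h2 ⊢
  constructor <;> linarith [h1.1, h1.2, h2.1, h2.2]

/-! ### Products computed by narrow networks with weights at most one -/

/-- A map computed by one ReLU layer whose parameters are at most `1` in absolute value. -/
def IsLayer {ι κ : Type} [Fintype ι] (A : (ι → ℝ) → κ → ℝ) : Prop :=
  ∃ (W : κ → ι → ℝ) (v : κ → ℝ), (∀ i j, |W i j| ≤ 1) ∧ (∀ i, |v i| ≤ 1) ∧
    ∀ x i, A x i = max (∑ j, W i j * x j - v i) 0

/-- A composition of a given number of ReLU layers of constant width, with parameters at most `1`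
in absolute value. -/
inductive IsProgram {ι : Type} [Fintype ι] : ℕ → ((ι → ℝ) → ι → ℝ) → Prop
  | nil : IsProgram 0 id
  | snoc {L : ℕ} {A B : (ι → ℝ) → ι → ℝ} : IsProgram L A → IsLayer B → IsProgram (L + 1) (B ∘ A)

namespace IsProgram

variable {ι : Type} [Fintype ι]

lemma single {A : (ι → ℝ) → ι → ℝ} (h : IsLayer A) : IsProgram 1 A := nil.snoc h

lemma append {L L' : ℕ} {A B : (ι → ℝ) → ι → ℝ} (hA : IsProgram L A) (hB : IsProgram L' B) :
    IsProgram (L + L') (B ∘ A) := by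
  induction hB with
  | nil => exact hA
  | snoc _ hC ih => exact ih.snoc hC

lemma exists_of_succ {L : ℕ} {A : (ι → ℝ) → ι → ℝ} (h : IsProgram (L + 1) A) :
    ∃ A' B, IsProgram L A' ∧ IsLayer B ∧ A = B ∘ A' := by
  cases h with
  | snoc h1 h2 => exact ⟨_, _, h1, h2, rfl⟩

lemma eq_id_of_zero {A : (ι → ℝ) → ι → ℝ} (h : IsProgram 0 A) : A = id := by
  cases h
  rfl

end IsProgram

/-- The state of a program: the input vector, which is carried along, and six registers. -/
def regState {d : ℕ} (x : Fin d → ℝ) (r : Fin 6 → ℝ) : Fin d ⊕ Fin 6 → ℝ := Sum.elim x r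

/-- The layer that keeps the input and updates the registers by the weights `U` (from the input),
`V` (from the registers) and the biases `b`. -/
def regLayer {d : ℕ} (U : Fin 6 → Fin d → ℝ) (V : Fin 6 → Fin 6 → ℝ) (b : Fin 6 → ℝ)
    (s : Fin d ⊕ Fin 6 → ℝ) : Fin d ⊕ Fin 6 → ℝ :=
  Sum.elim (fun i => max (s (Sum.inl i)) 0) fun k =>
    max (∑ i, U k i * s (Sum.inl i) + ∑ j, V k j * s (Sum.inr j) - b k) 0

lemma isLayer_regLayer {d : ℕ} {U : Fin 6 → Fin d → ℝ} {V : Fin 6 → Fin 6 → ℝ} {b : Fin 6 → ℝ}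
    (hU : ∀ k i, |U k i| ≤ 1) (hV : ∀ k j, |V k j| ≤ 1) (hb : ∀ k, |b k| ≤ 1) :
    IsLayer (regLayer U V b) := by
  refine ⟨Sum.elim (fun i => Sum.elim (Pi.single i 1) 0) fun k => Sum.elim (U k) (V k),
    Sum.elim 0 b, ?_, ?_, ?_⟩
  · rintro (i | k) (j | j)
    · simp only [Sum.elim_inl, Pi.single_apply]
      split_ifs <;> simp
    · simp
    · exact hU k j
    · exact hV k j
  · rintro (i | k)
    · simp
    · exact hb k
  · rintro s (i | k)
    · simp [regLayer, Pi.single_apply]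
    · simp [regLayer]

lemma regLayer_regState {d : ℕ} (U : Fin 6 → Fin d → ℝ) (V : Fin 6 → Fin 6 → ℝ) (b : Fin 6 → ℝ)
    {x : Fin d → ℝ} (hx : x ∈ cubeVec d) {r r' : Fin 6 → ℝ}
    (hr : ∀ k, max (∑ i, U k i * x i + ∑ j, V k j * r j - b k) 0 = r' k) :
    regLayer U V b (regState x r) = regState x r' := by
  ext (i | k)
  · simp [regLayer, regState, (hx i).1]
  · simp [regLayer, regState, hr]

/-- The sawtooth functions with the scaling `0 ≤ sawtooth u k ≤ 4⁻ᵏ`; the sum of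
`sawtooth u k` over `k ≥ 1` is `u - u ^ 2`. -/
def sawtooth (u : ℝ) : ℕ → ℝ
  | 0 => u
  | k + 1 => sawtooth u k / 2 - max (sawtooth u k - (1 / 4) ^ k / 2) 0

lemma sawtooth_mem {u : ℝ} (hu : u ∈ Set.Icc (0 : ℝ) 1) (k : ℕ) :
    sawtooth u k ∈ Set.Icc (0 : ℝ) ((1 / 4) ^ k) := by
  induction k with
  | zero => simpa [sawtooth] using hu
  | succ k ih =>
    obtain ⟨h1, h2⟩ := ih
    simp only [sawtooth, pow_succ]
    rcases le_total (sawtooth u k - (1 / 4) ^ k / 2) 0 with h | h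
    · rw [max_eq_right h]; constructor <;> linarith
    · rw [max_eq_left h]; constructor <;> linarith

lemma sub_sq_eq_sum_sawtooth (u : ℝ) (k : ℕ) :
    u - u ^ 2 = ∑ j ∈ Finset.range k, sawtooth u (j + 1) +
      (sawtooth u k - 4 ^ k * sawtooth u k ^ 2) := by
  induction k with
  | zero => simp [sawtooth]
  | succ k ih =>
    rw [ih, Finset.sum_range_succ]
    have h4 : (1 / 4 : ℝ) ^ k * 4 ^ k = 1 := by rw [← mul_pow]; norm_num
    have key : sawtooth u k - 4 ^ k * sawtooth u k ^ 2 =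
        2 * sawtooth u (k + 1) - 4 ^ (k + 1) * sawtooth u (k + 1) ^ 2 := by
      simp only [sawtooth, pow_succ]
      rcases le_total (sawtooth u k - (1 / 4) ^ k / 2) 0 with h | h
      · rw [max_eq_right h]; ring
      · rw [max_eq_left h]
        linear_combination
          (-(2 * sawtooth u k - (1 / 4) ^ k)) * h4
    rw [key]
    ring

/-- The network approximation of `t * y` built from `t * y = (u - (u - u²)) - (w - (w - w²))` with
`u = (t + y) / 2` and `w = |t - y| / 2`. -/
lemma abs_sawtooth_product_sub_le {t y : ℝ} (ht : t ∈ Set.Icc (0 : ℝ) 1)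
    (hy : y ∈ Set.Icc (0 : ℝ) 1) (m : ℕ) :
    |((t + y + ∑ j ∈ Finset.range (m + 1), sawtooth (|t - y| / 2) j) -
      (|t - y| + ∑ j ∈ Finset.range (m + 1), sawtooth ((t + y) / 2) j)) - t * y| ≤
      (1 / 4) ^ m := by
  have hw1 : |t - y| ≤ 1 := abs_le.2 ⟨by linarith [ht.1, hy.2], by linarith [ht.2, hy.1]⟩
  have hu : (t + y) / 2 ∈ Set.Icc (0 : ℝ) 1 := ⟨by linarith [ht.1, hy.1], by linarith [ht.2, hy.2]⟩
  have hw : |t - y| / 2 ∈ Set.Icc (0 : ℝ) 1 := ⟨by positivity, by linarith⟩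
  have key : ∀ u ∈ Set.Icc (0 : ℝ) 1, sawtooth u m - 4 ^ m * sawtooth u m ^ 2 ∈
      Set.Icc (0 : ℝ) ((1 / 4) ^ m) := by
    intro u hu
    obtain ⟨h1, h2⟩ := sawtooth_mem hu m
    have h4 : (4 : ℝ) ^ m * (1 / 4) ^ m = 1 := by rw [← mul_pow]; norm_num
    have h5 : (4 : ℝ) ^ m * sawtooth u m ≤ 1 := by
      rw [← h4]; gcongr
    have h6 : (0 : ℝ) < 4 ^ m := by positivity
    constructor
    · nlinarith
    · nlinarith [mul_nonneg h6.le (sq_nonneg (sawtooth u m))]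
  have k1 := key _ hu
  have k2 := key _ hw
  have e1 := sub_sq_eq_sum_sawtooth ((t + y) / 2) m
  have e2 := sub_sq_eq_sum_sawtooth (|t - y| / 2) m
  rw [Finset.sum_range_succ', Finset.sum_range_succ']
  have e3 : ∀ u, sawtooth u 0 = u := fun _ => rfl
  rw [e3, e3]
  have e4 : (|t - y| / 2) ^ 2 = (t - y) ^ 2 / 4 := by rw [div_pow, sq_abs]; norm_num
  rw [e4] at e2
  rw [abs_le]
  constructor <;> nlinarith [k1.1, k1.2, k2.1, k2.2]

section

variable {d : ℕ}

/-- The program that generates the sawtooth functions of two arguments and accumulates them. The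
registers `0, 1` and `2, 3` hold the current sawtooth values as differences, and the accumulators
`4, 5` start from `2 u` and `2 w` with the roles of the two arguments exchanged. -/
lemma exists_program_sawtooth (m : ℕ) : ∃ A : (Fin d ⊕ Fin 6 → ℝ) → Fin d ⊕ Fin 6 → ℝ,
    IsProgram m A ∧ ∀ x ∈ cubeVec d, ∀ u ∈ Set.Icc (0 : ℝ) 1, ∀ w ∈ Set.Icc (0 : ℝ) 1,
      ∃ r : Fin 6 → ℝ, A (regState x ![u, 0, w, 0, 2 * u, 2 * w]) = regState x r ∧
        r 0 - r 1 = sawtooth u m ∧ r 2 - r 3 = sawtooth w m ∧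
        r 4 = 2 * u + ∑ j ∈ Finset.range m, sawtooth w j ∧
        r 5 = 2 * w + ∑ j ∈ Finset.range m, sawtooth u j := by
  induction m with
  | zero => exact ⟨id, IsProgram.nil, fun x _ u _ w _ => ⟨_, rfl, by simp [sawtooth]⟩⟩
  | succ m ih =>
    obtain ⟨A, hA, hspec⟩ := ih
    set c : ℝ := (1 / 4) ^ m / 2 with hc
    have hc0 : 0 ≤ c := by positivity
    have hc1 : c ≤ 1 := by
      have : (1 / 4 : ℝ) ^ m ≤ 1 := pow_le_one₀ (by norm_num) (by norm_num)
      linarith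
    set V : Fin 6 → Fin 6 → ℝ := ![![1 / 2, -(1 / 2), 0, 0, 0, 0], ![1, -1, 0, 0, 0, 0],
      ![0, 0, 1 / 2, -(1 / 2), 0, 0], ![0, 0, 1, -1, 0, 0], ![0, 0, 1, -1, 1, 0],
      ![1, -1, 0, 0, 0, 1]] with hV
    have hlayer : IsLayer (regLayer (d := d) 0 V ![0, c, 0, c, 0, 0]) := by
      refine isLayer_regLayer (by simp) (fun k j => ?_) fun k => ?_
      · fin_cases k <;> fin_cases j <;> norm_num [hV, abs_of_pos]
      · fin_cases k <;> simp [abs_of_nonneg hc0, hc1]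
    refine ⟨_, hA.snoc hlayer, fun x hx u hu w hw => ?_⟩
    obtain ⟨r, h1, h2, h3, h4, h5⟩ := hspec x hx u hu w hw
    have hun := (sawtooth_mem hu m).1
    have hwn := (sawtooth_mem hw m).1
    have hsu : 0 ≤ ∑ j ∈ Finset.range m, sawtooth u j :=
      Finset.sum_nonneg fun j _ => (sawtooth_mem hu j).1
    have hsw : 0 ≤ ∑ j ∈ Finset.range m, sawtooth w j :=
      Finset.sum_nonneg fun j _ => (sawtooth_mem hw j).1
    refine ⟨![sawtooth u m / 2, max (sawtooth u m - c) 0, sawtooth w m / 2,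
      max (sawtooth w m - c) 0, 2 * u + ∑ j ∈ Finset.range (m + 1), sawtooth w j,
      2 * w + ∑ j ∈ Finset.range (m + 1), sawtooth u j], ?_, ?_, ?_, ?_, ?_⟩
    · rw [Function.comp_apply, h1]
      refine regLayer_regState _ _ _ hx fun k => ?_
      have hu0 := hu.1
      have hw0 := hw.1
      rw [Finset.sum_range_succ, Finset.sum_range_succ]
      fin_cases k
      · simp [hV, Fin.sum_univ_six]
        rw [max_eq_left] <;> linarith
      · simp [hV, Fin.sum_univ_six]
        rw [← sub_eq_add_neg, h2]
      · simp [hV, Fin.sum_univ_six]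
        rw [max_eq_left] <;> linarith
      · simp [hV, Fin.sum_univ_six]
        rw [← sub_eq_add_neg, h3]
      · simp [hV, Fin.sum_univ_six]
        rw [max_eq_left] <;> linarith
      · simp [hV, Fin.sum_univ_six]
        rw [max_eq_left] <;> linarith
    · simp [sawtooth, hc]
    · simp [sawtooth, hc]
    · simp
    · simp

/-- Multiplication of the register `0` by a factor: four layers evaluate the factor and prepare the
arguments of the sawtooth functions, and a last one subtracts the accumulated sums. -/
lemma exists_program_mul_factor (y : Factor d) {m : ℕ} (hm : 0 < m) :
    ∃ A : (Fin d ⊕ Fin 6 → ℝ) → Fin d ⊕ Fin 6 → ℝ, IsProgram (m + 6) A ∧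
      ∀ x ∈ cubeVec d, ∀ t ∈ Set.Icc (0 : ℝ) 1, ∃ t' ∈ Set.Icc (0 : ℝ) 1,
        A (regState x ![t, 0, 0, 0, 0, 0]) = regState x ![t', 0, 0, 0, 0, 0] ∧
        |t' - t * y.eval x| ≤ (1 / 4) ^ m := by
  obtain ⟨S, hS, hspec⟩ := exists_program_sawtooth (d := d) (m + 1)
  have ha := abs_le.2 ⟨by linarith [y.node_mem.1], y.node_mem.2⟩
  have h1' : |(1 / 2 : ℝ)| ≤ 1 := by norm_num [abs_of_pos]
  -- distances to the kink
  set U₁ : Fin 6 → Fin d → ℝ := ![0, Pi.single y.idx 1, Pi.single y.idx (-1), 0, 0, 0] with hU₁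
  set V₁ : Fin 6 → Fin 6 → ℝ := ![![1, 0, 0, 0, 0, 0], 0, 0, 0, 0, 0] with hV₁
  have hl₁ : IsLayer (regLayer U₁ V₁ ![0, y.node, -y.node, 0, 0, 0]) := by
    refine isLayer_regLayer (fun k i => ?_) (fun k j => ?_) fun k => ?_
    · fin_cases k <;> simp [hU₁, Pi.single_apply] <;> split_ifs <;> simp
    · fin_cases k <;> fin_cases j <;> simp [hV₁]
    · fin_cases k <;> simp [ha]
  -- the value of the factor
  set V₂ : Fin 6 → Fin 6 → ℝ := ![![1, 0, 0, 0, 0, 0], ![0, y.right, y.left, 0, 0, 0], 0, 0, 0, 0]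
    with hV₂
  have hl₂ : IsLayer (regLayer (d := d) 0 V₂ ![0, -y.const, 0, 0, 0, 0]) := by
    refine isLayer_regLayer (by simp) (fun k j => ?_) fun k => ?_
    · fin_cases k <;> fin_cases j <;> simp [hV₂, y.abs_right_le, y.abs_left_le]
    · fin_cases k <;> simp [y.abs_const_le]
  -- sum and difference
  set V₃ : Fin 6 → Fin 6 → ℝ := ![![1, -1, 0, 0, 0, 0], ![-1, 1, 0, 0, 0, 0],
    ![1, 1, 0, 0, 0, 0], 0, 0, 0] with hV₃
  have hl₃ : IsLayer (regLayer (d := d) 0 V₃ 0) := by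
    refine isLayer_regLayer (by simp) (fun k j => ?_) fun k => ?_
    · fin_cases k <;> fin_cases j <;> simp [hV₃]
    · fin_cases k <;> simp
  -- arguments of the sawtooth functions
  set V₄ : Fin 6 → Fin 6 → ℝ := ![![0, 0, 1 / 2, 0, 0, 0], 0, ![1 / 2, 1 / 2, 0, 0, 0, 0], 0,
    ![0, 0, 1, 0, 0, 0], ![1, 1, 0, 0, 0, 0]] with hV₄
  have hl₄ : IsLayer (regLayer (d := d) 0 V₄ 0) := by
    refine isLayer_regLayer (by simp) (fun k j => ?_) fun k => ?_
    · fin_cases k <;> fin_cases j <;> norm_num [hV₄, abs_of_pos]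
    · fin_cases k <;> simp
  -- difference of the two accumulated sums
  set V₅ : Fin 6 → Fin 6 → ℝ := ![![0, 0, 0, 0, 1, -1], 0, 0, 0, 0, 0] with hV₅
  have hl₅ : IsLayer (regLayer (d := d) 0 V₅ 0) := by
    refine isLayer_regLayer (by simp) (fun k j => ?_) fun k => ?_
    · fin_cases k <;> fin_cases j <;> simp [hV₅]
    · fin_cases k <;> simp
  have hprog := ((((IsProgram.single hl₁).snoc hl₂).snoc hl₃).snoc hl₄).append (hS.snoc hl₅)
  rw [show 1 + 1 + 1 + 1 + (m + 1 + 1) = m + 6 by ring] at hprog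
  refine ⟨_, hprog, fun x hx t ht => ?_⟩
  set v := y.eval x with hv
  have hv0 : 0 ≤ v := y.eval_nonneg x
  have hv1 : v ≤ 1 / 2 := y.eval_le_half hx
  have ht0 := ht.1
  have habs : max (t - v) 0 + max (v - t) 0 = |t - v| := by
    rcases le_total t v with h | h
    · rw [max_eq_right (by linarith), max_eq_left (by linarith), abs_of_nonpos (by linarith)]; ring
    · rw [max_eq_left (by linarith), max_eq_right (by linarith), abs_of_nonneg (by linarith)]; ring
  have hd1 : |t - v| ≤ 1 := abs_le.2 ⟨by linarith, by linarith [ht.2]⟩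
  have e₁ : regLayer U₁ V₁ ![0, y.node, -y.node, 0, 0, 0] (regState x ![t, 0, 0, 0, 0, 0]) =
      regState x ![t, max (x y.idx - y.node) 0, max (y.node - x y.idx) 0, 0, 0, 0] := by
    refine regLayer_regState _ _ _ hx fun k => ?_
    fin_cases k <;> simp [hU₁, hV₁, Fin.sum_univ_six, Pi.single_apply, ht0]
    congr 1
    ring
  have e₂ : regLayer 0 V₂ ![0, -y.const, 0, 0, 0, 0]
      (regState x ![t, max (x y.idx - y.node) 0, max (y.node - x y.idx) 0, 0, 0, 0]) =
      regState x ![t, v, 0, 0, 0, 0] := by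
    refine regLayer_regState _ _ _ hx fun k => ?_
    fin_cases k <;> simp [hV₂, Fin.sum_univ_six, ht0]
    rw [hv, Factor.eval]
    congr 1
    ring
  have e₃ : regLayer 0 V₃ 0 (regState x ![t, v, 0, 0, 0, 0]) =
      regState x ![max (t - v) 0, max (v - t) 0, t + v, 0, 0, 0] := by
    refine regLayer_regState _ _ _ hx fun k => ?_
    fin_cases k <;> simp [hV₃, Fin.sum_univ_six]
    · congr 1
    · congr 1; ring
    · linarith
  have e₄ : regLayer 0 V₄ 0 (regState x ![max (t - v) 0, max (v - t) 0, t + v, 0, 0, 0]) =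
      regState x ![(t + v) / 2, 0, |t - v| / 2, 0, 2 * ((t + v) / 2), 2 * (|t - v| / 2)] := by
    refine regLayer_regState _ _ _ hx fun k => ?_
    rw [← habs]
    have h6 := le_max_right (t - v) 0
    have h7 := le_max_right (v - t) 0
    fin_cases k
    · simp [hV₄, Fin.sum_univ_six]
      rw [max_eq_left] <;> linarith
    · simp [hV₄]
    · simp [hV₄, Fin.sum_univ_six]
      rw [max_eq_left] <;> linarith
    · simp [hV₄]
    · simp [hV₄, Fin.sum_univ_six]
      rw [max_eq_left] <;> linarith
    · simp [hV₄, Fin.sum_univ_six]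
      rw [max_eq_left] <;> linarith
  obtain ⟨r, hr, -, -, hr4, hr5⟩ := hspec x hx ((t + v) / 2)
    ⟨by linarith, by linarith [ht.2]⟩ (|t - v| / 2) ⟨by positivity, by linarith⟩
  have e₅ : regLayer 0 V₅ 0 (regState x r) = regState x ![max (r 4 - r 5) 0, 0, 0, 0, 0, 0] := by
    refine regLayer_regState _ _ _ hx fun k => ?_
    fin_cases k <;> simp [hV₅, Fin.sum_univ_six]
    congr 1
  have herr := abs_sawtooth_product_sub_le ht (show v ∈ Set.Icc (0 : ℝ) 1 from
    ⟨hv0, by linarith⟩) m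
  rw [show t + v = 2 * ((t + v) / 2) by ring, show |t - v| = 2 * (|t - v| / 2) by ring,
    show 2 * ((t + v) / 2) / 2 = (t + v) / 2 by ring,
    show 2 * (|t - v| / 2) / 2 = |t - v| / 2 by ring, ← hr4, ← hr5] at herr
  have hpow : (1 / 4 : ℝ) ^ m ≤ 1 / 4 := by
    calc (1 / 4 : ℝ) ^ m ≤ (1 / 4) ^ 1 := pow_le_pow_of_le_one (by norm_num) (by norm_num) hm
      _ = 1 / 4 := pow_one _
  have htv : 0 ≤ t * v := mul_nonneg ht0 hv0
  have htv' : t * v ≤ 1 / 2 := by nlinarith [ht.2]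
  have herr' := abs_le.1 herr
  refine ⟨max (r 4 - r 5) 0, ⟨le_max_right _ _, max_le (by linarith [herr'.2]) zero_le_one⟩, ?_, ?_⟩
  · simp only [Function.comp_apply]
    rw [e₁, e₂, e₃, e₄, hr, e₅]
  · calc |max (r 4 - r 5) 0 - t * v| = |max (r 4 - r 5) 0 - max (t * v) 0| := by
          rw [max_eq_left htv]
      _ ≤ |r 4 - r 5 - t * v| := abs_max_sub_max_le_abs _ _ _
      _ ≤ _ := herr

lemma exists_program_prod {m : ℕ} (hm : 0 < m) : ∀ (D : ℕ) (y : Fin D → Factor d),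
    ∃ A : (Fin d ⊕ Fin 6 → ℝ) → Fin d ⊕ Fin 6 → ℝ, IsProgram (1 + D * (m + 6)) A ∧
      ∀ x ∈ cubeVec d, ∃ t ∈ Set.Icc (0 : ℝ) 1,
        A (regState x 0) = regState x ![t, 0, 0, 0, 0, 0] ∧
        |t - ∏ i, (y i).eval x| ≤ D * (1 / 4) ^ m
  | 0, _ => by
    have hl : IsLayer (regLayer (d := d) 0 0 ![-1, 0, 0, 0, 0, 0]) := by
      refine isLayer_regLayer (by simp) (by simp) fun k => ?_
      fin_cases k <;> simp
    refine ⟨_, by simpa using IsProgram.single hl, fun x hx => ⟨1, by simp, ?_, by simp⟩⟩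
    refine regLayer_regState _ _ _ hx fun k => ?_
    fin_cases k <;> simp
  | D + 1, y => by
    obtain ⟨A, hA, hspec⟩ := exists_program_prod hm D (fun i => y i.succ)
    obtain ⟨B, hB, hspec'⟩ := exists_program_mul_factor (y 0) hm
    refine ⟨_, by
      have := hA.append hB
      rwa [show 1 + D * (m + 6) + (m + 6) = 1 + (D + 1) * (m + 6) by ring] at this,
      fun x hx => ?_⟩
    obtain ⟨t, ht, h1, h2⟩ := hspec x hx
    obtain ⟨t', ht', h3, h4⟩ := hspec' x hx t ht
    refine ⟨t', ht', by rw [Function.comp_apply, h1, h3], ?_⟩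
    have hv0 := (y 0).eval_nonneg x
    have hv1 := (y 0).eval_le_half hx
    rw [Fin.prod_univ_succ]
    have e : t' - (y 0).eval x * ∏ i : Fin D, (y i.succ).eval x = (t' - t * (y 0).eval x) +
        (t - ∏ i : Fin D, (y i.succ).eval x) * (y 0).eval x := by ring
    rw [e]
    refine (abs_add_le _ _).trans ?_
    rw [abs_mul, abs_of_nonneg hv0]
    push_cast
    nlinarith [abs_nonneg (t - ∏ i : Fin D, (y i.succ).eval x)]

/-- Multiplication by a power of two: since the parameters are at most `1`, every layer doubles the
value by adding two copies of it. -/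
lemma exists_program_double (n : ℕ) : ∃ A : (Fin d ⊕ Fin 6 → ℝ) → Fin d ⊕ Fin 6 → ℝ,
    IsProgram (n + 1) A ∧ ∀ x ∈ cubeVec d, ∀ t, 0 ≤ t →
      A (regState x ![t, 0, 0, 0, 0, 0]) = regState x ![2 ^ n * t, 2 ^ n * t, 0, 0, 0, 0] := by
  set V : Fin 6 → Fin 6 → ℝ := ![![1, 1, 0, 0, 0, 0], ![1, 1, 0, 0, 0, 0], 0, 0, 0, 0] with hV
  have hl : IsLayer (regLayer (d := d) 0 V 0) := by
    refine isLayer_regLayer (by simp) (fun k j => ?_) (by simp)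
    fin_cases k <;> fin_cases j <;> simp [hV]
  induction n with
  | zero =>
    refine ⟨_, IsProgram.single hl, fun x hx t ht => regLayer_regState _ _ _ hx fun k => ?_⟩
    fin_cases k <;> simp [hV, Fin.sum_univ_six, ht]
  | succ n ih =>
    obtain ⟨A, hA, hspec⟩ := ih
    refine ⟨_, hA.snoc hl, fun x hx t ht => ?_⟩
    rw [Function.comp_apply, hspec x hx t ht]
    refine regLayer_regState _ _ _ hx fun k => ?_
    have h2 : 2 ^ (n + 1) * t = 2 ^ n * t + 2 ^ n * t := by ring
    have h3 : 0 ≤ 2 ^ n * t + 2 ^ n * t := by positivity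
    fin_cases k <;> simp [hV, Fin.sum_univ_six, h2, h3]

/-- A product of factors, scaled by `2 ^ n`. -/
lemma exists_program_scaled_prod {m : ℕ} (hm : 0 < m) (n : ℕ) {D : ℕ} (y : Fin D → Factor d) :
    ∃ A : (Fin d ⊕ Fin 6 → ℝ) → Fin d ⊕ Fin 6 → ℝ, IsProgram (D * (m + 6) + n + 1 + 1) A ∧
      ∀ x ∈ cubeVec d, |A (regState x 0) (Sum.inr 0) - 2 ^ n * ∏ i, (y i).eval x| ≤
        2 ^ n * (D * (1 / 4) ^ m) := by
  obtain ⟨A, hA, hspec⟩ := exists_program_prod hm D y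
  obtain ⟨B, hB, hspec'⟩ := exists_program_double (d := d) n
  refine ⟨_, by
    have := hA.append hB
    rwa [show 1 + D * (m + 6) + (n + 1) = D * (m + 6) + n + 1 + 1 by ring] at this,
    fun x hx => ?_⟩
  obtain ⟨t, ht, h1, h2⟩ := hspec x hx
  rw [Function.comp_apply, h1, hspec' x hx t ht.1]
  have h3 : regState x ![2 ^ n * t, 2 ^ n * t, 0, 0, 0, 0] (Sum.inr 0) = 2 ^ n * t := by
    simp [regState]
  rw [h3, ← mul_sub, abs_mul, abs_of_pos (by positivity)]
  gcongr

end

/-! ### Assembling sparse networks -/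

lemma hammingNorm_comp_equiv {ι κ : Type} [Fintype ι] [Fintype κ] (e : ι ≃ κ) (x : κ → ℝ) :
    hammingNorm (fun i => x (e i)) = hammingNorm x := by
  classical
  unfold hammingNorm
  refine Finset.card_bij (fun i _ => e i) (fun i hi => by simpa using hi)
    (fun i _ j _ h => e.injective h) fun k hk => ⟨e.symm k, by simpa using hk, by simp⟩

lemma hammingNorm_le_card {ι : Type} [Fintype ι] (x : ι → ℝ) :
    hammingNorm x ≤ Fintype.card ι := by
  unfold hammingNorm
  exact Finset.card_le_univ _

/-- `IsHiddenPart m w L s A` says that `A` can be prepended to every network whose width is at most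
`w` and whose parameters are at most `1`, at the price of `L` more hidden layers and at most `s`
more nonzero parameters; the width stays at most `w` and the parameters stay at most `1`.
So `A` is the map from the input to the neurons of the last hidden layer of a partial network. -/
def IsHiddenPart (m w L s : ℕ) {κ : Type} (A : (Fin m → ℝ) → κ → ℝ) : Prop :=
  ∃ (k : ℕ) (e : κ ≃ Fin k), ∀ T : ReluNet k, T.width ≤ w → T.ParamsBoundedBy 1 →
    ∃ T' : ReluNet m, (∀ x, T'.eval x = T.eval (fun i => A x (e.symm i))) ∧
      T'.depth = L + T.depth ∧ T'.width ≤ w ∧ T'.numNonzero ≤ s + T.numNonzero ∧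
      T'.ParamsBoundedBy 1

namespace IsHiddenPart

variable {m w L s : ℕ} {κ : Type} [Fintype κ] {A : (Fin m → ℝ) → κ → ℝ}

lemma input (m w : ℕ) : IsHiddenPart m w 0 0 (id : (Fin m → ℝ) → Fin m → ℝ) :=
  ⟨m, Equiv.refl _, fun T hw hB => ⟨T, fun _ => rfl, by simp, hw, by simp, hB⟩⟩

lemma snoc (h : IsHiddenPart m w L s A) {κ' : Type} [Fintype κ'] [Nonempty κ']
    (hκ' : Fintype.card κ' ≤ w) (W : κ' → κ → ℝ) (v : κ' → ℝ) (hW : ∀ i j, |W i j| ≤ 1)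
    (hv : ∀ i, |v i| ≤ 1) {s' : ℕ} (hs' : ∑ i, hammingNorm (W i) + hammingNorm v ≤ s') :
    IsHiddenPart m w (L + 1) (s + s')
      (fun x i => max (∑ j, W i j * A x j - v i) 0) := by
  obtain ⟨k, e, h⟩ := h
  refine ⟨Fintype.card κ', Fintype.equivFin κ', fun T hTw hTB => ?_⟩
  set e' := Fintype.equivFin κ'
  obtain ⟨T', h1, h2, h3, h4, h5⟩ := h
    (.layer Fintype.card_pos (fun i j => W (e'.symm i) (e.symm j)) (fun i => v (e'.symm i)) T)
    (max_le hκ' hTw) ⟨fun i j => hW _ _, fun i => hv _, hTB⟩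
  refine ⟨T', fun x => ?_, ?_, h3, ?_, h5⟩
  · rw [h1]
    simp only [ReluNet.eval, Matrix.mulVec, dotProduct]
    congr 1
    ext i
    rw [Equiv.sum_comp e.symm fun j => W (e'.symm i) j * A x j]
  · rw [h2]
    simp only [ReluNet.depth]
    ring
  · refine h4.trans ?_
    have e1 : ∑ i, hammingNorm (fun j => W (e'.symm i) (e.symm j)) = ∑ i, hammingNorm (W i) := by
      rw [← Equiv.sum_comp e'.symm fun i => hammingNorm (W i)]
      exact Finset.sum_congr rfl fun i _ => hammingNorm_comp_equiv _ _
    have e2 : hammingNorm (fun i => v (e'.symm i)) = hammingNorm v := hammingNorm_comp_equiv _ _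
    simp only [ReluNet.numNonzero]
    rw [e1, e2]
    omega

lemma snoc_dense (h : IsHiddenPart m w L s A) {κ' : Type} [Fintype κ'] [Nonempty κ']
    (hκ' : Fintype.card κ' ≤ w) (W : κ' → κ → ℝ) (v : κ' → ℝ) (hW : ∀ i j, |W i j| ≤ 1)
    (hv : ∀ i, |v i| ≤ 1) :
    IsHiddenPart m w (L + 1) (s + Fintype.card κ' * (Fintype.card κ + 1))
      (fun x i => max (∑ j, W i j * A x j - v i) 0) := by
  refine h.snoc hκ' W v hW hv ?_
  rw [mul_add, mul_one]
  refine add_le_add ?_ (hammingNorm_le_card v)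
  calc _ ≤ ∑ _i : κ', Fintype.card κ := Finset.sum_le_sum fun i _ => hammingNorm_le_card _
    _ = _ := by simp

lemma output (h : IsHiddenPart m w L s A) (c : κ → ℝ) (hc : ∀ i, |c i| ≤ 1) :
    ∃ T : ReluNet m, (∀ x, T.eval x = ∑ j, c j * A x j) ∧ T.depth = L ∧ T.width ≤ w ∧
      T.numNonzero ≤ s + Fintype.card κ ∧ T.ParamsBoundedBy 1 := by
  obtain ⟨k, e, h⟩ := h
  obtain ⟨T', h1, h2, h3, h4, h5⟩ := h (.output fun _ j => c (e.symm j)) (Nat.zero_le _)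
    fun i j => hc _
  refine ⟨T', fun x => ?_, by simpa [ReluNet.depth] using h2, h3, h4.trans ?_, h5⟩
  · rw [h1]
    simp only [ReluNet.eval, Matrix.mulVec, dotProduct]
    rw [Equiv.sum_comp e.symm fun j => c j * A x j]
  · have := hammingNorm_le_card (fun j => c (e.symm j))
    rw [Fintype.card_congr e.symm] at this
    simp only [ReluNet.numNonzero, Finset.univ_unique, Finset.sum_const, Finset.card_singleton,
      one_smul]
    omega

/-- Running a family of programs of equal length in parallel on the same input. The cost in
nonzero parameters is linear in the number of programs, since the layers are block diagonal. -/
lemma parallel {d : ℕ} {A₀ : (Fin m → ℝ) → Fin d → ℝ} (h : IsHiddenPart m w L s A₀) {G : Type}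
    [Fintype G] [Nonempty G] (hw : Fintype.card G * (d + 6) ≤ w) (n : ℕ) :
    ∀ A : G → (Fin d ⊕ Fin 6 → ℝ) → Fin d ⊕ Fin 6 → ℝ, (∀ g, IsProgram (n + 1) (A g)) →
    IsHiddenPart m w (L + (n + 1)) (s + (n + 1) * (Fintype.card G * ((d + 6) * (d + 7))))
      (fun x (p : G × (Fin d ⊕ Fin 6)) => A p.1 (regState (A₀ x) 0) p.2) := by
  classical
  have hcard : Fintype.card (G × (Fin d ⊕ Fin 6)) ≤ w := by simpa using hw
  have hbias : ∀ v : G × (Fin d ⊕ Fin 6) → ℝ, hammingNorm v ≤ Fintype.card G * (d + 6) := fun v =>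
    (hammingNorm_le_card v).trans (by simp)
  induction n with
  | zero =>
    intro A hA
    choose A' B hA' hB hAB using fun g => (hA g).exists_of_succ
    choose W v hW hv hWv using hB
    have hs : ∑ p : G × (Fin d ⊕ Fin 6), hammingNorm (fun j => W p.1 p.2 (Sum.inl j)) +
        hammingNorm (fun p : G × (Fin d ⊕ Fin 6) => v p.1 p.2) ≤
        (0 + 1) * (Fintype.card G * ((d + 6) * (d + 7))) := by
      refine (add_le_add (Finset.sum_le_sum fun p _ => hammingNorm_le_card _) (hbias _)).trans ?_
      simp only [Finset.sum_const, Finset.card_univ, Fintype.card_prod, Fintype.card_sum,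
        Fintype.card_fin, smul_eq_mul]
      nlinarith [Nat.zero_le (Fintype.card G), Nat.zero_le (Fintype.card G * d)]
    have h1 := h.snoc hcard (fun p j => W p.1 p.2 (Sum.inl j)) (fun p => v p.1 p.2)
      (fun p j => hW _ _ _) (fun p => hv _ _) hs
    convert h1 using 1
    ext x p
    rw [hAB, IsProgram.eq_id_of_zero (hA' p.1), Function.comp_apply, id, hWv]
    simp [regState]
  | succ n ih =>
    intro A hA
    choose A' B hA' hB hAB using fun g => (hA g).exists_of_succ
    choose W v hW hv hWv using hB
    set V : G × (Fin d ⊕ Fin 6) → G × (Fin d ⊕ Fin 6) → ℝ := fun p q =>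
      if p.1 = q.1 then W p.1 p.2 q.2 else 0 with hV
    have hrow : ∀ p, hammingNorm (V p) ≤ d + 6 := by
      intro p
      unfold hammingNorm
      calc _ ≤ (Finset.univ.image fun i : Fin d ⊕ Fin 6 => (p.1, i)).card := by
            refine Finset.card_le_card fun q hq => ?_
            have hq' := (Finset.mem_filter.1 hq).2
            simp only [hV] at hq'
            have : p.1 = q.1 := by
              by_contra hne
              exact hq' (if_neg hne)
            exact Finset.mem_image.2 ⟨q.2, Finset.mem_univ _, by rw [this]⟩
        _ ≤ _ := Finset.card_image_le.trans (by simp)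
    have hs : ∑ p, hammingNorm (V p) +
        hammingNorm (fun p : G × (Fin d ⊕ Fin 6) => v p.1 p.2) ≤
        Fintype.card G * ((d + 6) * (d + 7)) := by
      refine (add_le_add (Finset.sum_le_sum fun p _ => hrow p) (hbias _)).trans ?_
      simp only [Finset.sum_const, Finset.card_univ, Fintype.card_prod, Fintype.card_sum,
        Fintype.card_fin, smul_eq_mul]
      apply le_of_eq
      ring
    have h1 := (ih A' hA').snoc hcard V (fun p => v p.1 p.2)
      (fun p q => by
        simp only [hV]
        split_ifs
        · exact hW _ _ _
        · simp) (fun p => hv _ _) hs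
    rw [show s + (n + 1) * (Fintype.card G * ((d + 6) * (d + 7))) +
      Fintype.card G * ((d + 6) * (d + 7)) =
      s + (n + 1 + 1) * (Fintype.card G * ((d + 6) * (d + 7))) by ring] at h1
    refine (show (fun x (p : G × (Fin d ⊕ Fin 6)) => A p.1 (regState (A₀ x) 0) p.2) = _ from ?_) ▸ h1
    ext x p
    rw [hAB, Function.comp_apply, hWv, Fintype.sum_prod_type]
    congr 2
    simp only [hV, ite_mul, zero_mul]
    rw [Finset.sum_eq_single p.1]
    · simp
    · intro g _ hg
      simp [hg.symm]
    · simp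

/-- A sum of products of factors is, up to a small error, a linear combination with coefficients at
most `1` of the neurons of the last hidden layer of a partial network. -/
lemma exists_prodSum {d : ℕ} {A₀ : (Fin m → ℝ) → Fin d → ℝ} (h : IsHiddenPart m w L s A₀)
    {D J : ℕ} {C : ℝ} {Φ : (Fin d → ℝ) → ℝ} (hΦ : IsProdSum d D J C Φ) {n p : ℕ}
    (hp : 0 < p) (hC : C ≤ 2 ^ n) (hw : J * (d + 6) ≤ w) :
    ∃ (κ : Type) (_ : Fintype κ) (A : (Fin m → ℝ) → κ → ℝ) (c : κ → ℝ),
      IsHiddenPart m w (L + (D * (p + 6) + n + 2))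
        (s + (D * (p + 6) + n + 2) * (J * ((d + 6) * (d + 7)))) A ∧
      Fintype.card κ ≤ J * (d + 6) ∧ (∀ i, |c i| ≤ 1) ∧
      ∀ x, A₀ x ∈ cubeVec d →
        |∑ i, c i * A x i - Φ (A₀ x)| ≤ J * (2 ^ n * (D * (1 / 4) ^ p)) := by
  classical
  obtain ⟨G, hG, hG', c, y, hJ, hcC, hsum⟩ := hΦ
  choose A hA hspec using fun g => exists_program_scaled_prod hp n (y g)
  have hGw : Fintype.card G * (d + 6) ≤ w := (Nat.mul_le_mul_right _ hJ).trans hw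
  have h1 := h.parallel hGw (D * (p + 6) + n + 1) A hA
  have h2n : (0 : ℝ) < 2 ^ n := by positivity
  have hc1 : ∀ g, |c g / 2 ^ n| ≤ 1 := fun g => by
    rw [abs_div, abs_of_pos h2n, div_le_one h2n]
    exact (hcC g).trans hC
  refine ⟨G × (Fin d ⊕ Fin 6), inferInstance, fun x q => A q.1 (regState (A₀ x) 0) q.2,
    fun q => if q.2 = Sum.inr 0 then c q.1 / 2 ^ n else 0, ?_, by
      rw [Fintype.card_prod, Fintype.card_sum, Fintype.card_fin, Fintype.card_fin]
      exact Nat.mul_le_mul_right _ hJ, ?_, ?_⟩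
  · obtain ⟨k, e, h1⟩ := h1
    refine ⟨k, e, fun T hT1 hT2 => ?_⟩
    obtain ⟨T', h2, h3, h4, h5, h6⟩ := h1 T hT1 hT2
    refine ⟨T', h2, h3, h4, h5.trans ?_, h6⟩
    gcongr
  · intro q
    dsimp only
    split_ifs
    · exact hc1 _
    · simp
  · intro x hx
    rw [Fintype.sum_prod_type, hsum _ hx]
    simp only [ite_mul, zero_mul, Finset.sum_ite_eq', Finset.mem_univ, if_true]
    rw [← Finset.sum_sub_distrib]
    refine (Finset.abs_sum_le_sum_abs _ _).trans ?_
    calc _ ≤ ∑ _g : G, (2 ^ n * (D * (1 / 4) ^ p) : ℝ) := by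
          refine Finset.sum_le_sum fun g _ => ?_
          have e1 : c g / 2 ^ n * A g (regState (A₀ x) 0) (Sum.inr 0) -
              c g * ∏ i, (y g i).eval (A₀ x) = c g / 2 ^ n *
              (A g (regState (A₀ x) 0) (Sum.inr 0) - 2 ^ n * ∏ i, (y g i).eval (A₀ x)) := by
            field_simp
          rw [e1, abs_mul]
          refine (mul_le_mul (hc1 g) (hspec g _ hx) (abs_nonneg _) zero_le_one).trans ?_
          rw [one_mul]
      _ = Fintype.card G * (2 ^ n * (D * (1 / 4) ^ p) : ℝ) := by simp
      _ ≤ _ := by gcongr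

/-- Clamping a linear combination of neurons to the interval `[δ, 1 - δ]`. -/
lemma clamp (h : IsHiddenPart m w L s A) (c : κ → ℝ) (hc : ∀ i, |c i| ≤ 1) {δ : ℝ}
    (hδ0 : 0 ≤ δ) (hδ1 : δ ≤ 1 / 2) (hw : 2 ≤ w) :
    IsHiddenPart m w (L + 3) (s + (Fintype.card κ + 8))
      (fun x (_ : Fin 1) => max δ (min (∑ i, c i * A x i) (1 - δ))) := by
  have h1 := h.snoc_dense (κ' := Fin 1) (by simp; omega) (fun _ => c) (fun _ => δ) (fun _ => hc)
    (fun _ => abs_le.2 ⟨by linarith, by linarith⟩)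
  have h2 := h1.snoc_dense (κ' := Fin 2) (by simpa using hw) (fun _ _ => 1) (![0, 1 - 2 * δ])
    (by simp) (fun i => by
      fin_cases i
      · simp
      · exact abs_le.2 ⟨by simp; linarith, by simp; linarith⟩)
  have h3 := h2.snoc_dense (κ' := Fin 1) (by simp; omega) (fun _ => ![1, -1]) (fun _ => -δ)
    (fun _ j => by fin_cases j <;> simp) (fun _ => abs_le.2 ⟨by linarith, by linarith⟩)
  simp only [Fintype.card_fin] at h3
  rw [show s + 1 * (Fintype.card κ + 1) + 2 * (1 + 1) + 1 * (2 + 1) =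
    s + (Fintype.card κ + 8) by ring] at h3
  convert h3 using 1
  ext x _
  simp only [Fin.sum_univ_two, Matrix.cons_val_zero, Matrix.cons_val_one, Finset.univ_unique,
    Finset.sum_const, Finset.card_singleton, one_smul, one_mul, sub_zero]
  set S := ∑ i, c i * A x i
  rcases le_total S δ with h | h
  · rw [min_eq_left (by linarith), max_eq_left h, max_eq_right (by linarith : S - δ ≤ 0),
      max_self, max_eq_right (by linarith : (0 : ℝ) - (1 - 2 * δ) ≤ 0), max_eq_left (by linarith)]
    ring
  · rw [max_eq_left (by linarith : 0 ≤ S - δ), max_eq_left (by linarith : 0 ≤ S - δ)]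
    rcases le_total S (1 - δ) with h' | h'
    · rw [min_eq_left h', max_eq_right h, max_eq_right (by linarith : S - δ - (1 - 2 * δ) ≤ 0),
        max_eq_left (by linarith)]
      ring
    · rw [min_eq_right h', max_eq_right (by linarith),
        max_eq_left (by linarith : 0 ≤ S - δ - (1 - 2 * δ)), max_eq_left (by linarith)]
      ring

end IsHiddenPart

/-- The network that first evaluates `Φ₁`, clamps the result to `[δ, 1 - δ]` and then
evaluates `Φ₂`. -/
theorem exists_reluNet_comp {d D₁ J₁ D₂ J₂ : ℕ} {C : ℝ} {Φ₁ : (Fin d → ℝ) → ℝ}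
    {Φ₂ : (Fin 1 → ℝ) → ℝ} (h₁ : IsProdSum d D₁ J₁ C Φ₁) (h₂ : IsProdSum 1 D₂ J₂ C Φ₂)
    {δ : ℝ} (hδ0 : 0 ≤ δ) (hδ1 : δ ≤ 1 / 2) {n p w : ℕ} (hp : 0 < p) (hC : C ≤ 2 ^ n)
    (hw₁ : J₁ * (d + 6) ≤ w) (hw₂ : J₂ * 7 ≤ w) (hw : 2 ≤ w) :
    ∃ T : ReluNet d, T.depth = (D₁ + D₂) * (p + 6) + 2 * n + 7 ∧ T.width ≤ w ∧
      T.numNonzero ≤ (D₁ * (p + 6) + n + 3) * (J₁ * ((d + 6) * (d + 7))) +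
        (D₂ * (p + 6) + n + 3) * (J₂ * 56) + 8 ∧ T.ParamsBoundedBy 1 ∧
      ∀ x ∈ cubeVec d, ∃ z, |z - Φ₁ x| ≤ J₁ * (2 ^ n * (D₁ * (1 / 4) ^ p)) ∧
        |T.eval x - Φ₂ (fun _ => max δ (min z (1 - δ)))| ≤
          J₂ * (2 ^ n * (D₂ * (1 / 4) ^ p)) := by
  obtain ⟨κ, hκ, A, c, hA, hκc, hc, hAe⟩ := (IsHiddenPart.input d w).exists_prodSum h₁ hp hC hw₁
  have hcl := hA.clamp c hc hδ0 hδ1 hw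
  obtain ⟨κ', hκ', A', c', hA', hκc', hc', hAe'⟩ := hcl.exists_prodSum h₂ hp hC hw₂
  obtain ⟨T, hT1, hT2, hT3, hT4, hT5⟩ := hA'.output c' hc'
  refine ⟨T, ?_, hT3, ?_, hT5, fun x hx => ⟨∑ i, c i * A x i, hAe x hx, ?_⟩⟩
  · rw [hT2]
    ring
  · refine hT4.trans ?_
    have k1 : Fintype.card κ ≤ J₁ * ((d + 6) * (d + 7)) := by nlinarith [Nat.zero_le (J₁ * (d + 6))]
    have k2 : Fintype.card κ' ≤ J₂ * 56 := by omega
    nlinarith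
  · rw [hT1]
    refine hAe' x fun i => ⟨?_, ?_⟩
    · exact hδ0.trans (le_max_left _ _)
    · exact max_le (by linarith) (min_le_of_right_le (by linarith))

/-! ### Approximation and estimation for a fixed sample size -/

lemma measurable_of_mem_fnnClass {d : ℕ} {G N S B F : ℝ} {f : EuclideanSpace ℝ (Fin d) → ℝ}
    (hf : f ∈ fnnClass d G N S B F) : Measurable fun x : unitCube d => f x := by
  obtain ⟨T, hT, -⟩ := hf
  have : (fun x : unitCube d => f x) =
      fun x : unitCube d => T.eval fun i => (x : EuclideanSpace ℝ (Fin d)) i := by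
    ext x
    exact hT x
  rw [this]
  exact (T.continuous_eval.comp (by fun_prop)).measurable

lemma abs_max_min_sub_le {z y δ e : ℝ} (hδ0 : 0 ≤ δ) (hδ1 : δ ≤ 1 / 2) (hy0 : 0 ≤ y) (hy1 : y ≤ 1)
    (hz : |z - y| ≤ e) : |max δ (min z (1 - δ)) - y| ≤ e + δ := by
  have hz' := abs_le.1 hz
  have he : 0 ≤ e := (abs_nonneg _).trans hz
  rw [abs_le]
  rcases le_total z (1 - δ) with h | h
  · rw [min_eq_left h]
    rcases le_total z δ with h' | h'
    · rw [max_eq_left h']; constructor <;> linarith [hz'.1, hz'.2]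
    · rw [max_eq_right h']; constructor <;> linarith [hz'.1, hz'.2]
  · rw [min_eq_right h, max_eq_right (by linarith)]
    constructor <;> linarith [hz'.1, hz'.2]

lemma abs_logit_le {q δ : ℝ} (hδ0 : 0 < δ) (hq0 : δ ≤ q) (hq1 : q ≤ 1 - δ) :
    |Real.log q - Real.log (1 - q)| ≤ Real.log (1 / δ) := by
  have h1 := Real.log_le_log hδ0 hq0
  have h2 := Real.log_le_log hδ0 (show δ ≤ 1 - q by linarith)
  have h3 := Real.log_nonpos (show 0 ≤ q by linarith) (by linarith)
  have h4 := Real.log_nonpos (show 0 ≤ 1 - q by linarith) (by linarith)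
  rw [one_div, Real.log_inv, abs_le]
  constructor <;> linarith

/-- Networks approximate the conditional distribution in relative entropy: if `E₁` is the error in
approximating the conditional probability, then clamping to `[δ, 1 - δ]` and applying the logit up
to an error `E₂` gives a relative entropy of order `(E₁ + δ) ^ 2 / δ + E₂`. The bound is of first
order in `E₁` for `δ` of order `E₁`. -/
theorem exists_reluNet_klRisk_le {d : ℕ} (hd : 0 < d) {β r : ℝ} (hβ : 0 < β) (hr : 0 < r)
    {q K M t w : ℕ} {δ s E₁ E₂ : ℝ} (hq : 0 < q) (hK : 0 < K) (hM : 0 < M) (ht : 0 < t)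
    (hδ0 : 0 < δ) (hδ1 : δ ≤ 1 / 2) (hs : s * M = Real.log (1 / δ)) (hs1 : s ≤ 1 / 4)
    {J₁ J₂ : ℕ}
    (hJ₁ : (K + 1) ^ d * (⌈β⌉₊ * (d ^ (⌈β⌉₊ - 1) * 2 ^ (⌈β⌉₊ - 1))) ≤ J₁)
    (hJ₂ : 2 * ((M + 1) * ((q + 1) * 2 ^ q)) ≤ J₂)
    (hC₁ : (2 * K : ℝ) ^ d * (2 ^ (⌈β⌉₊ - 1) * r) ≤ 2 ^ t)
    (hC₂ : 4 / (δ * s) * (2 ^ q * (1 / δ) ^ q) ≤ 2 ^ t)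
    (hw₁ : J₁ * (d + 6) ≤ w) (hw₂ : J₂ * 7 ≤ w) (hw : 2 ≤ w)
    (hE₁ : r * d ^ (⌈β⌉₊ - 1) * (d * (1 / K)) ^ β +
      J₁ * (2 ^ t * ((⌈β⌉₊ - 1 + d : ℕ) * (1 / 4) ^ t)) ≤ E₁)
    (hE₂ : 4 * (2 * s) ^ (q + 1) + J₂ * (2 ^ t * ((q + 1 : ℕ) * (1 / 4) ^ t)) ≤ E₂)
    {P : ProbabilityMeasure (DataPoint d)} (hP : P ∈ holderClass d β r) :
    ∃ T : ReluNet d, T.depth = (⌈β⌉₊ - 1 + d + (q + 1)) * (t + 6) + 2 * t + 7 ∧ T.width ≤ w ∧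
      T.numNonzero ≤ ((⌈β⌉₊ - 1 + d) * (t + 6) + t + 3) * (J₁ * ((d + 6) * (d + 7))) +
        ((q + 1) * (t + 6) + t + 3) * (J₂ * 56) + 8 ∧ T.ParamsBoundedBy 1 ∧
      (∀ x ∈ cubeVec d, |T.eval x| ≤ Real.log (1 / δ) + E₂) ∧
      klRisk (P : Measure (DataPoint d))
        (fun x => T.eval fun i => (x : EuclideanSpace ℝ (Fin d)) i) ≤
        2 * (E₁ + δ) ^ 2 / δ + E₂ := by
  obtain ⟨f, hf, hfP⟩ := hP
  obtain ⟨Φ₁, hΦ₁, happ₁⟩ := exists_isProdSum_holder hd hβ hr hf hK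
  obtain ⟨Φ₂, hΦ₂, happ₂⟩ := exists_isProdSum_logit hδ0 hδ1 hM hq hs hs1
  obtain ⟨T, hT1, hT2, hT3, hT4, hT5⟩ := exists_reluNet_comp (hΦ₁.mono hJ₁ hC₁) (hΦ₂.mono hJ₂ hC₂)
    hδ0.le hδ1 (n := t) ht le_rfl hw₁ hw₂ hw
  have key : ∀ x ∈ cubeVec d, ∃ z, |z - f (WithLp.toLp 2 x)| ≤ E₁ ∧
      |T.eval x - (Real.log (max δ (min z (1 - δ))) - Real.log (1 - max δ (min z (1 - δ))))| ≤
        E₂ := by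
    intro x hx
    obtain ⟨z, hz1, hz2⟩ := hT5 x hx
    have h1 := happ₁ (WithLp.toLp 2 x) hx
    have h2 := happ₂ (fun _ => max δ (min z (1 - δ))) (le_max_left _ _)
      (max_le (by linarith) (min_le_right _ _))
    refine ⟨z, ?_, ?_⟩
    · have := abs_sub_le z (Φ₁ x) (f (WithLp.toLp 2 x))
      have h1' : |Φ₁ x - f (WithLp.toLp 2 x)| ≤ _ := h1
      linarith
    · have := abs_sub_le (T.eval x) (Φ₂ fun _ => max δ (min z (1 - δ)))
        (Real.log (max δ (min z (1 - δ))) - Real.log (1 - max δ (min z (1 - δ))))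
      linarith
  refine ⟨T, hT1, hT2, hT3, hT4, fun x hx => ?_, ?_⟩
  · obtain ⟨z, -, hz⟩ := key x hx
    have h1 := abs_logit_le hδ0 (le_max_left δ (min z (1 - δ)))
      (max_le (by linarith) (min_le_right _ _))
    have h2 := abs_add_le (T.eval x -
      (Real.log (max δ (min z (1 - δ))) - Real.log (1 - max δ (min z (1 - δ)))))
      (Real.log (max δ (min z (1 - δ))) - Real.log (1 - max δ (min z (1 - δ))))
    rw [sub_add_cancel] at h2
    linarith
  · have hbound : ∀ᵐ x ∂((P : Measure (DataPoint d)).fst),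
        binaryKL (condProb (P : Measure (DataPoint d)) x)
          (T.eval fun i => (x : EuclideanSpace ℝ (Fin d)) i) ≤ 2 * (E₁ + δ) ^ 2 / δ + E₂ := by
      filter_upwards [hfP] with x hx
      obtain ⟨z, hz1, hz2⟩ := key (fun i => (x : EuclideanSpace ℝ (Fin d)) i) x.2
      have hp0 := condProb_nonneg (P : Measure (DataPoint d)) x
      have hp1 := condProb_le_one (P : Measure (DataPoint d)) x
      have hz1' : |z - condProb (P : Measure (DataPoint d)) x| ≤ E₁ := by
        rw [hx]; exact hz1
      have hclamp := abs_max_min_sub_le hδ0.le hδ1 hp0 hp1 hz1'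
      have hq0 : δ ≤ max δ (min z (1 - δ)) := le_max_left _ _
      have hq1 : max δ (min z (1 - δ)) ≤ 1 - δ := max_le (by linarith) (min_le_right _ _)
      set v := max δ (min z (1 - δ))
      set p := condProb (P : Measure (DataPoint d)) x
      have h1 := binaryKL_le_add_abs_sub hp0 hp1
        (T.eval fun i => (x : EuclideanSpace ℝ (Fin d)) i) (Real.log v - Real.log (1 - v))
      have h2 := binaryKL_logit_le hp0 hp1 (show 0 < v by linarith) (show v < 1 by linarith)
      have h3 : δ / 2 ≤ v * (1 - v) := by
        rcases le_total v (1 / 2) with h | h <;> nlinarith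
      have h4 : (p - v) ^ 2 ≤ (E₁ + δ) ^ 2 := by
        rw [abs_sub_comm] at hclamp
        exact sq_le_sq' (by linarith [(abs_le.1 hclamp).1]) (abs_le.1 hclamp).2
      have h5 : (p - v) ^ 2 / (v * (1 - v)) ≤ 2 * (E₁ + δ) ^ 2 / δ := by
        calc (p - v) ^ 2 / (v * (1 - v)) ≤ (E₁ + δ) ^ 2 / (δ / 2) := by gcongr
          _ = _ := by field_simp
      linarith
    calc klRisk _ _ ≤ ∫ _x, (2 * (E₁ + δ) ^ 2 / δ + E₂) ∂(P : Measure (DataPoint d)).fst :=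
          integral_mono_of_nonneg (Eventually.of_forall fun x =>
            binaryKL_nonneg (condProb_nonneg _ x) (condProb_le_one _ x) _) (integrable_const _)
            hbound
      _ = _ := by simp

/-- The oracle inequality for a class of networks, with its covering number. The grid width `η` of
the parameters and the resulting covering radius `δ` remain free. -/
theorem lintegral_klRisk_le_of_isLogisticERM {d n : ℕ} (hn : 0 < n) {G N S B F δ η κ X : ℝ}
    (hB : 1 ≤ B) (hη : 0 < η)
    (hδ : (⌊G⌋₊ + 1) * ((((max d ⌊N⌋₊ : ℕ) : ℝ) + 2) * B) ^ ⌊G⌋₊ *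
          ((((max d ⌊N⌋₊ : ℕ) : ℝ) + 2) * η) ≤ δ)
    (hX : Real.log (((⌊G⌋₊ + 1) * ((⌊G⌋₊ + 1) * ((max d ⌊N⌋₊ + 1) * (max d ⌊N⌋₊ + 2)) *
        (2 * ⌈B / η⌉₊ + 1) + 1) ^ ⌊S⌋₊ : ℕ) : ℝ) ≤ X)
    {est : (Fin n → DataPoint d) → EuclideanSpace ℝ (Fin d) → ℝ}
    (hest : IsLogisticERM (fnnClass d G N S B F) est) (P : ProbabilityMeasure (DataPoint d))
    {f₀ : EuclideanSpace ℝ (Fin d) → ℝ} (hf₀ : f₀ ∈ fnnClass d G N S B F)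
    (hκ : klRisk (P : Measure (DataPoint d)) (fun x => f₀ x) ≤ κ) :
    ∫⁻ z, ENNReal.ofReal (klRisk (P : Measure (DataPoint d)) fun x => est z x)
        ∂(Measure.pi fun _ : Fin n => (P : Measure (DataPoint d))) ≤
      ENNReal.ofReal (2 * κ + 3 * δ + 2 * (F + δ + 3) / n * X) := by
  obtain ⟨ι, hι, f, hfm, hcard, hcover⟩ := exists_cover_fnnClass d G N S B F hB hη
  classical
  have hcover' : ∀ g ∈ fnnClass d G N S B F, ∃ j, ∀ x : unitCube d, |g x - f j x| ≤ δ :=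
    fun g hg => (hcover g hg).imp fun j hj x => (hj x).trans hδ
  -- only the functions close to the class are known to be bounded
  let ι' := {j : ι // ∃ g ∈ fnnClass d G N S B F, ∀ x : unitCube d, |g x - f j x| ≤ δ}
  obtain ⟨j₀, hj₀⟩ := hcover' f₀ hf₀
  have : Nonempty ι' := ⟨⟨j₀, f₀, hf₀, hj₀⟩⟩
  have hδ0 : 0 ≤ δ := (abs_nonneg _).trans (hj₀ ⟨0, by intro i; simp⟩)
  have hbdd : ∀ g ∈ fnnClass d G N S B F, ∀ x : unitCube d, |g x| ≤ F := by
    rintro g ⟨T, -, -, -, -, -, h⟩ x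
    exact h x x.2
  have hF0 : 0 ≤ F := (abs_nonneg _).trans (hbdd f₀ hf₀ ⟨0, by intro i; simp⟩)
  have hn' : (0 : ℝ) < n := by exact_mod_cast hn
  have h := lintegral_klRisk_le (P : Measure (DataPoint d)) hn (fun j : ι' => f j.1)
    (fun j => hfm _) (F := F + δ) (δ := δ) (fun j x => by
      obtain ⟨g, hg, hgj⟩ := j.2
      have h1 := abs_sub_abs_le_abs_sub (f j.1 x) (g x)
      rw [abs_sub_comm] at h1
      linarith [hgj x, hbdd g hg x])
    (fun x => f₀ x) (measurable_of_mem_fnnClass hf₀) (fun x => by linarith [hbdd f₀ hf₀ x])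
    (fun z x => est z x) (fun z => measurable_of_mem_fnnClass (hest.2 z).1)
    (fun z => by
      obtain ⟨j, hj⟩ := hcover' _ (hest.2 z).1
      exact ⟨⟨j, _, (hest.2 z).1, hj⟩, hj⟩)
    (fun z => by
      have h1 := (hest.2 z).2 f₀ hf₀
      unfold empiricalRisk at h1
      exact le_of_mul_le_mul_left h1 (by positivity))
  refine h.trans (ENNReal.ofReal_le_ofReal ?_)
  have hlog : Real.log (Fintype.card ι') ≤ X := by
    refine le_trans (Real.log_le_log (by exact_mod_cast Fintype.card_pos) ?_) hX
    exact_mod_cast (Fintype.card_subtype_le _).trans hcard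
  gcongr

lemma expectedError_excessLogisticRisk_le {d n : ℕ} {G N S B F R : ℝ}
    {est : (Fin n → DataPoint d) → EuclideanSpace ℝ (Fin d) → ℝ}
    (hest : IsLogisticERM (fnnClass d G N S B F) est) (P : ProbabilityMeasure (DataPoint d))
    (hR : ∫⁻ z, ENNReal.ofReal (klRisk (P : Measure (DataPoint d)) fun x => est z x)
        ∂(Measure.pi fun _ : Fin n => (P : Measure (DataPoint d))) ≤ ENNReal.ofReal R) :
    expectedError P excessLogisticRisk est ≤ ENNReal.ofReal R := by
  refine le_trans (lintegral_mono fun z => ?_) hR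
  refine excessLogisticRisk_le_klRisk _ (measurable_of_mem_fnnClass (hest.2 z).1) (F := F) ?_
  obtain ⟨T, -, -, -, -, -, h⟩ := (hest.2 z).1
  exact fun x => h x x.2

lemma expectedError_excessMisclassError_le {d n : ℕ} {G N S B F R τ : ℝ} (hτ : 0 < τ)
    {est : (Fin n → DataPoint d) → EuclideanSpace ℝ (Fin d) → ℝ}
    (hest : IsLogisticERM (fnnClass d G N S B F) est) (P : ProbabilityMeasure (DataPoint d))
    (hR0 : 0 ≤ R)
    (hR : ∫⁻ z, ENNReal.ofReal (klRisk (P : Measure (DataPoint d)) fun x => est z x)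
        ∂(Measure.pi fun _ : Fin n => (P : Measure (DataPoint d))) ≤ ENNReal.ofReal R) :
    expectedError P excessMisclassError est ≤ ENNReal.ofReal (τ + 2 / τ * R) := by
  have h1 : expectedError P excessMisclassError est ≤
      ∫⁻ z, (ENNReal.ofReal τ + ENNReal.ofReal (2 / τ) *
        ENNReal.ofReal (klRisk (P : Measure (DataPoint d)) fun x => est z x))
        ∂(Measure.pi fun _ : Fin n => (P : Measure (DataPoint d))) := by
    refine lintegral_mono fun z => ?_
    refine excessMisclassError_le_klRisk _ (measurable_of_mem_fnnClass (hest.2 z).1) (F := F) ?_ hτ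
    obtain ⟨T, -, -, -, -, -, h⟩ := (hest.2 z).1
    exact fun x => h x x.2
  refine h1.trans ?_
  rw [lintegral_add_left measurable_const, lintegral_const_mul' _ _ ENNReal.ofReal_ne_top,
    ENNReal.ofReal_add hτ.le (by positivity), ENNReal.ofReal_mul (by positivity)]
  gcongr
  simp

/-! ### The logarithmic rate -/

lemma ReluNet.ParamsBoundedBy.mono {A B : ℝ} (hAB : A ≤ B) {m : ℕ} {T : ReluNet m}
    (hT : T.ParamsBoundedBy A) : T.ParamsBoundedBy B := by
  induction T with
  | output W => exact fun i j => (hT i j).trans hAB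
  | layer hk W v T ih =>
    exact ⟨fun i j => (hT.1 i j).trans hAB, fun i => (hT.2.1 i).trans hAB, ih hT.2.2⟩

lemma tendsto_log_natCast : Tendsto (fun n : ℕ => Real.log n) atTop atTop :=
  Real.tendsto_log_atTop.comp tendsto_natCast_atTop_atTop

/-- Every positive power of `(log n) ^ 5 / n` beats every power of the logarithm. -/
lemma tendsto_log_pow_mul_baseRate_rpow (k : ℕ) {x : ℝ} (hx : 0 < x) :
    Tendsto (fun n : ℕ => Real.log n ^ k * baseRate n ^ x) atTop (nhds 0) := by
  have h := (isLittleO_log_rpow_rpow_atTop (k + 5 * x) hx).tendsto_div_nhds_zero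
  refine (h.comp tendsto_natCast_atTop_atTop).congr' ?_
  filter_upwards [tendsto_log_natCast.eventually_ge_atTop 1, eventually_ge_atTop 1] with n hL hn
  have hL0 : 0 < Real.log n := by linarith
  have hn0 : (0 : ℝ) < n := by exact_mod_cast hn
  have h1 : baseRate n ^ x = Real.log n ^ (5 * x) / (n : ℝ) ^ x := by
    unfold baseRate
    rw [Real.div_rpow (by positivity) hn0.le, ← Real.rpow_natCast, ← Real.rpow_mul hL0.le]
    norm_num
  simp only [Function.comp]
  rw [h1, Real.rpow_add hL0, Real.rpow_natCast]
  ring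

/-- The elementary inequalities between `L = log n`, the number of parameters
`ρ = (log n ^ 5 / n) ^ (-d / (d + β))` up to a logarithm, and the rate
`ε = (log n ^ 5 / n) ^ (β / (d + β))`. -/
lemma eventually_baseRate {d : ℕ} (hd : 0 < d) {β : ℝ} (hβ : 0 < β) :
    ∀ᶠ n : ℕ in atTop, 0 < baseRate n ∧
      1 ≤ baseRate n ^ (-(d : ℝ) / (d + β)) ∧ baseRate n ^ (-(d : ℝ) / (d + β)) ≤ n ∧
      1 / n ≤ baseRate n ^ (β / (d + β)) ∧
      baseRate n ^ (-(d : ℝ) / (d + β)) * Real.log n ^ 5 / n = baseRate n ^ (β / (d + β)) ∧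
      baseRate n ^ (β / (d + β)) = (baseRate n ^ (-(d : ℝ) / (d + β))) ^ (-(β / d)) ∧
      Real.log (1 / baseRate n ^ (β / (d + β))) =
        β / (d + β) * (Real.log n - 5 * Real.log (Real.log n)) := by
  have hd' : (0 : ℝ) < d := by exact_mod_cast hd
  have h0 := tendsto_log_pow_mul_baseRate_rpow 0 one_pos
  filter_upwards [tendsto_log_natCast.eventually_ge_atTop 1, eventually_ge_atTop 1,
    h0.eventually_le_const one_pos] with n hL hn hb
  have hL0 : 0 < Real.log n := by linarith
  have hn0 : (0 : ℝ) < n := by exact_mod_cast hn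
  have hb0 : 0 < baseRate n := by unfold baseRate; positivity
  have hb1 : baseRate n ≤ 1 := by simpa using hb
  have hbn : 1 / (n : ℝ) ≤ baseRate n := by
    unfold baseRate
    gcongr
    exact one_le_pow₀ hL
  have hγ1 : β / (d + β) ≤ 1 := (div_le_one (by positivity)).2 (by linarith)
  refine ⟨hb0, Real.one_le_rpow_of_pos_of_le_one_of_nonpos hb0 hb1 ?_, ?_, ?_, ?_, ?_, ?_⟩
  · rw [neg_div]
    exact neg_nonpos.2 (by positivity)
  · calc baseRate n ^ (-(d : ℝ) / (d + β)) ≤ baseRate n ^ (-1 : ℝ) :=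
          Real.rpow_le_rpow_of_exponent_ge hb0 hb1 (by
            rw [neg_div, neg_le_neg_iff]
            exact (div_le_one (by positivity)).2 (by linarith))
      _ = (baseRate n)⁻¹ := Real.rpow_neg_one _
      _ ≤ (1 / (n : ℝ))⁻¹ := inv_anti₀ (by positivity) hbn
      _ = n := by simp
  · calc 1 / (n : ℝ) ≤ baseRate n := hbn
      _ = baseRate n ^ (1 : ℝ) := (Real.rpow_one _).symm
      _ ≤ _ := Real.rpow_le_rpow_of_exponent_ge hb0 hb1 hγ1
  · have h1 : β / (d + β) = -(d : ℝ) / (d + β) + 1 := by field_simp; ring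
    rw [h1, Real.rpow_add hb0, Real.rpow_one, mul_div_assoc]
    rfl
  · rw [← Real.rpow_mul hb0.le]
    congr 1
    field_simp
  · rw [one_div, Real.log_inv, Real.log_rpow hb0]
    unfold baseRate
    rw [Real.log_div (by positivity) hn0.ne', Real.log_pow]
    push_cast
    ring

/-- Powers of the logarithm are negligible with respect to the number of parameters. -/
lemma eventually_log_pow_le_mul_rpow {d : ℕ} (hd : 0 < d) {β : ℝ} (hβ : 0 < β) (k : ℕ) {a : ℝ}
    (ha : 0 < a) :
    ∀ᶠ n : ℕ in atTop, Real.log n ^ k ≤ a * baseRate n ^ (-(d : ℝ) / (d + β)) := by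
  have hd' : (0 : ℝ) < d := by exact_mod_cast hd
  have h0 := tendsto_log_pow_mul_baseRate_rpow k (show 0 < (d : ℝ) / (d + β) by positivity)
  filter_upwards [h0.eventually_le_const ha, eventually_baseRate hd hβ] with n h1 h2
  have h3 := Real.rpow_pos_of_pos h2.1 ((d : ℝ) / (d + β))
  rw [neg_div, Real.rpow_neg h2.1.le, ← div_eq_mul_inv, le_div_iff₀ h3]
  exact h1

/-! ### Approximation at the logarithmic rate -/

set_option maxHeartbeats 1000000 in
/-- The network of `exists_reluNet_klRisk_le` with `K` grid points per axis, the logarithm resolved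
on a grid of `K ^ d` nodes, and the precision `4 ^ (-t)` in the multiplications. The number
`q = ⌈β / d⌉₊` is the degree to which the logarithm is expanded at each node. -/
lemma exists_reluNet_klRisk_le_mul {d : ℕ} (hd : 0 < d) {β r : ℝ} (hβ : 0 < β) (hr : 0 < r) {q : ℕ}
    (hq : 0 < q) :
    ∃ (Q : ℕ) (R : ℝ), 0 < Q ∧ 0 < R ∧ ∀ {K t : ℕ} {δ b : ℝ}, 0 < K → 0 < t → 0 < δ → δ ≤ 1 / 2 →
      Real.log (1 / δ) / K ^ d ≤ 1 / 4 → R * K ^ d ≤ 2 ^ t * δ ^ (q + 1) →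
      4 * (2 * (Real.log (1 / δ) / K ^ d)) ^ (q + 1) ≤ δ → (1 / K : ℝ) ^ β ≤ b * δ →
      ∀ P ∈ holderClass d β r, ∃ T : ReluNet d, T.depth ≤ Q * t ∧ T.width ≤ Q * K ^ d ∧
        T.numNonzero ≤ Q * K ^ d * t ∧ T.ParamsBoundedBy 1 ∧
        (∀ x ∈ cubeVec d, |T.eval x| ≤ Real.log (1 / δ) + 2 * δ) ∧
        klRisk (P : Measure (DataPoint d))
          (fun x => T.eval fun i => (x : EuclideanSpace ℝ (Fin d)) i) ≤
          (2 * (R * b + 2) ^ 2 + 2) * δ := by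
  set c₁ : ℕ := 2 ^ d * (⌈β⌉₊ * (d ^ (⌈β⌉₊ - 1) * 2 ^ (⌈β⌉₊ - 1))) with hc₁
  set c₂ : ℕ := 4 * ((q + 1) * 2 ^ q) with hc₂
  set D : ℕ := ⌈β⌉₊ - 1 + d with hD
  set Q₁ : ℕ := 7 * (D + (q + 1)) + 9 with hQ₁
  set Q₂ : ℕ := c₁ * (d + 6) + c₂ * 7 + 2 with hQ₂
  set Q₃ : ℕ := (7 * D + 4) * (c₁ * ((d + 6) * (d + 7))) + (7 * (q + 1) + 4) * (c₂ * 56) + 8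
    with hQ₃
  set R₁ : ℝ := r * d ^ (⌈β⌉₊ - 1) * (d : ℝ) ^ β with hR₁
  set R₂ : ℝ := 2 ^ d * (2 ^ (⌈β⌉₊ - 1) * r) with hR₂
  have hd' : (0 : ℝ) < d := by exact_mod_cast hd
  have hR₁0 : 0 ≤ R₁ := by positivity
  have hR₂0 : 0 ≤ R₂ := by positivity
  have hR0 : 0 ≤ (c₁ : ℝ) * D + c₂ * (q + 1) := by positivity
  have hR2q : (0 : ℝ) < 2 ^ (q + 3) := by positivity
  refine ⟨Q₁ + Q₂ + Q₃, R₁ + R₂ + 2 ^ (q + 3) + (c₁ * D + c₂ * (q + 1)), by omega, by positivity,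
    ?_⟩
  intro K t δ b hK ht hδ0 hδ1 hs1 hR hs2 hb P hP
  set R : ℝ := R₁ + R₂ + 2 ^ (q + 3) + (c₁ * D + c₂ * (q + 1)) with hRdef
  have hK' : (1 : ℝ) ≤ K := by exact_mod_cast hK
  have hKd : (1 : ℝ) ≤ (K : ℝ) ^ d := one_le_pow₀ hK'
  have hKdN : 1 ≤ K ^ d := Nat.one_le_pow _ _ hK
  have hδq : δ ^ (q + 1) ≤ δ := by
    simpa using pow_le_pow_of_le_one hδ0.le (by linarith) (show 1 ≤ q + 1 by omega)
  have h2t : (0 : ℝ) < 2 ^ t := by positivity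
  have hRδ : R * (K : ℝ) ^ d ≤ 2 ^ t * δ := hR.trans (by gcongr)
  have hR2 : R * (K : ℝ) ^ d ≤ 2 ^ t := hRδ.trans (by nlinarith)
  have hlog : 1 / 2 ≤ Real.log (1 / δ) := by
    have h1 := Real.log_two_gt_d9
    have h2 : Real.log 2 ≤ Real.log (1 / δ) := Real.log_le_log (by norm_num) (by
      rw [le_div_iff₀ hδ0]; linarith)
    linarith
  -- the errors of the multiplications sum up to at most `δ`
  have hquarter : (2 : ℝ) ^ t * (1 / 4) ^ t = 1 / 2 ^ t := by
    rw [eq_div_iff h2t.ne', mul_right_comm, ← mul_pow, ← mul_pow]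
    norm_num
  have hmul : ∀ c e : ℝ, c * e ≤ R → c * (K : ℝ) ^ d * (2 ^ t * (e * (1 / 4) ^ t)) ≤ δ := by
    intro c e hce
    calc c * (K : ℝ) ^ d * (2 ^ t * (e * (1 / 4) ^ t))
        = c * e * (K : ℝ) ^ d * (2 ^ t * (1 / 4) ^ t) := by ring
      _ ≤ R * (K : ℝ) ^ d * (1 / 2 ^ t) := by rw [hquarter]; gcongr
      _ ≤ δ := by rw [mul_one_div, div_le_iff₀ h2t, mul_comm δ]; exact hRδ
  have hmain := exists_reluNet_klRisk_le hd hβ hr (q := q) (K := K) (M := K ^ d) (t := t)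
    (w := Q₂ * K ^ d) (δ := δ) (s := Real.log (1 / δ) / K ^ d) (E₁ := (R * b + 1) * δ)
    (E₂ := 2 * δ) hq hK hKdN ht hδ0 hδ1 (by push_cast; field_simp) hs1 (J₁ := c₁ * K ^ d)
    (J₂ := c₂ * K ^ d) ?_ ?_ ?_ ?_ ?_ ?_ ?_ ?_ ?_ hP
  · obtain ⟨T, h1, h2, h3, h4, h5, h6⟩ := hmain
    refine ⟨T, ?_, ?_, ?_, h4, h5, h6.trans (le_of_eq ?_)⟩
    · rw [h1]
      have : (D + (q + 1)) * (t + 6) ≤ (D + (q + 1)) * (7 * t) := by gcongr; omega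
      calc (D + (q + 1)) * (t + 6) + 2 * t + 7 ≤ (D + (q + 1)) * (7 * t) + 9 * t := by omega
        _ = Q₁ * t := by rw [hQ₁]; ring
        _ ≤ (Q₁ + Q₂ + Q₃) * t := by gcongr; omega
    · refine h2.trans ?_
      gcongr
      omega
    · refine h3.trans ?_
      have e1 : D * (t + 6) + t + 3 ≤ (7 * D + 4) * t := by
        have : D * (t + 6) ≤ D * (7 * t) := by gcongr; omega
        linarith
      have e2 : (q + 1) * (t + 6) + t + 3 ≤ (7 * (q + 1) + 4) * t := by
        have : (q + 1) * (t + 6) ≤ (q + 1) * (7 * t) := by gcongr; omega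
        linarith
      have e3 : 8 ≤ 8 * (K ^ d * t) := by
        have : 1 ≤ K ^ d * t := Nat.mul_pos hKdN ht
        omega
      calc _ ≤ (7 * D + 4) * t * (c₁ * K ^ d * ((d + 6) * (d + 7))) +
            (7 * (q + 1) + 4) * t * (c₂ * K ^ d * 56) + 8 * (K ^ d * t) := by gcongr
        _ = Q₃ * K ^ d * t := by rw [hQ₃]; ring
        _ ≤ _ := by gcongr; omega
    · field_simp
      ring
  · calc (K + 1) ^ d * (⌈β⌉₊ * (d ^ (⌈β⌉₊ - 1) * 2 ^ (⌈β⌉₊ - 1)))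
        ≤ (2 * K) ^ d * (⌈β⌉₊ * (d ^ (⌈β⌉₊ - 1) * 2 ^ (⌈β⌉₊ - 1))) := by gcongr; omega
      _ = c₁ * K ^ d := by rw [hc₁, mul_pow]; ring
  · have : K ^ d + 1 ≤ 2 * K ^ d := by omega
    calc 2 * ((K ^ d + 1) * ((q + 1) * 2 ^ q)) ≤ 2 * ((2 * K ^ d) * ((q + 1) * 2 ^ q)) := by gcongr
      _ = c₂ * K ^ d := by rw [hc₂]; ring
  · calc (2 * K : ℝ) ^ d * (2 ^ (⌈β⌉₊ - 1) * r) = R₂ * (K : ℝ) ^ d := by rw [hR₂, mul_pow]; ring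
      _ ≤ R * (K : ℝ) ^ d := by gcongr; linarith
      _ ≤ _ := hR2
  · have hs0 : 1 / (2 * (K : ℝ) ^ d) ≤ Real.log (1 / δ) / K ^ d := by
      rw [div_le_div_iff₀ (by positivity) (by positivity)]
      nlinarith
    calc 4 / (δ * (Real.log (1 / δ) / K ^ d)) * (2 ^ q * (1 / δ) ^ q)
        ≤ 4 / (δ * (1 / (2 * (K : ℝ) ^ d))) * (2 ^ q * (1 / δ) ^ q) := by gcongr
      _ = 2 ^ (q + 3) * (K : ℝ) ^ d / δ ^ (q + 1) := by
        rw [one_div_pow]; field_simp; ring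
      _ ≤ R * (K : ℝ) ^ d / δ ^ (q + 1) := by gcongr; linarith
      _ ≤ 2 ^ t := by rw [div_le_iff₀ (by positivity)]; exact hR
  · calc c₁ * K ^ d * (d + 6) = c₁ * (d + 6) * K ^ d := by ring
      _ ≤ Q₂ * K ^ d := by gcongr; omega
  · calc c₂ * K ^ d * 7 = c₂ * 7 * K ^ d := by ring
      _ ≤ Q₂ * K ^ d := by gcongr; omega
  · calc 2 = 2 * 1 := rfl
      _ ≤ Q₂ * K ^ d := by gcongr; omega
  · have h1 : r * d ^ (⌈β⌉₊ - 1) * (d * (1 / K : ℝ)) ^ β = R₁ * (1 / K : ℝ) ^ β := by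
      rw [Real.mul_rpow (by positivity) (by positivity), hR₁]; ring
    have h2 := hmul c₁ D (by
      have : (0 : ℝ) ≤ c₂ * (q + 1) := by positivity
      linarith)
    have hbδ : 0 ≤ b * δ := le_trans (by positivity) hb
    have h3 : R₁ * (1 / K : ℝ) ^ β ≤ R * (b * δ) := by
      gcongr
      linarith
    rw [h1, ← hD]
    push_cast
    linarith
  · have h2 := hmul c₂ ((q + 1 : ℕ) : ℝ) (by
      have : (0 : ℝ) ≤ c₁ * D := by positivity
      push_cast
      linarith)
    push_cast
    push_cast at h2
    linarith

set_option maxHeartbeats 1000000 in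
/-- Approximation by networks of logarithmic depth and `ρ = (log n ^ 5 / n) ^ (-d / (d + β))` nodes
reaches the rate `ρ ^ (-β / d)`, whatever fraction of the permitted width and of the permitted
number of parameters is available; only the depth needs a constant that is large enough. -/
theorem eventually_exists_mem_fnnClass_klRisk_le {d : ℕ} (hd : 0 < d) {β r : ℝ} (hβ : 0 < β)
    (hr : 0 < r) :
    ∃ c : ℝ, 0 < c ∧ ∀ c₁ c₂ : ℝ, 0 < c₁ → 0 < c₂ → ∃ C : ℝ, 0 < C ∧ ∀ᶠ n : ℕ in atTop,
      ∀ G N S B F : ℝ, c * Real.log n ≤ G → c₁ * baseRate n ^ (-(d : ℝ) / (d + β)) ≤ N →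
        c₂ * (baseRate n ^ (-(d : ℝ) / (d + β)) * Real.log n) ≤ S → 1 ≤ B →
        β / (d + β) * Real.log n ≤ F → ∀ P ∈ holderClass d β r,
        ∃ f ∈ fnnClass d G N S B F, klRisk (P : Measure (DataPoint d)) (fun x => f x) ≤
          C * baseRate n ^ (β / (d + β)) := by
  have hd' : (0 : ℝ) < d := by exact_mod_cast hd
  set q := ⌈β / d⌉₊ with hqdef
  have hq : 0 < q := Nat.ceil_pos.2 (by positivity)
  obtain ⟨Q, R, hQ, hR, hnet⟩ := exists_reluNet_klRisk_le_mul hd hβ hr hq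
  have hQ' : (0 : ℝ) < Q := by exact_mod_cast hQ
  set A : ℝ := 2 * (q + 3) with hA
  have hA0 : 0 < A := by positivity
  refine ⟨Q * (A + 1), by positivity, fun c₁ c₂ hc₁ hc₂ => ?_⟩
  set a : ℝ := min (c₁ / Q) (c₂ / (Q * (A + 1))) with ha
  have ha0 : 0 < a := lt_min (by positivity) (by positivity)
  set b : ℝ := 2 ^ β * a ^ (-(β / d)) with hb
  have hb0 : 0 < b := by positivity
  refine ⟨2 * (R * b + 2) ^ 2 + 2, by positivity, ?_⟩
  set γ := β / (d + β) with hγ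
  have hγ0 : 0 < γ := by positivity
  have hε := tendsto_log_pow_mul_baseRate_rpow 0 hγ0
  filter_upwards [eventually_baseRate hd hβ, tendsto_log_natCast.eventually_ge_atTop (Real.exp 1),
    hε.eventually_le_const (show (0 : ℝ) < 1 / 2 by norm_num),
    hε.eventually_le_const (show (0 : ℝ) < 5 * γ / 2 by positivity),
    eventually_log_pow_le_mul_rpow hd hβ 0 ha0,
    eventually_log_pow_le_mul_rpow hd hβ 1 (show 0 < a / (4 * 2 ^ d) by positivity),
    eventually_log_pow_le_mul_rpow hd hβ (q + 1)
      (show 0 < 1 / (4 * (2 ^ (d + 1) / a) ^ (q + 1)) by positivity),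
    tendsto_natCast_atTop_atTop.eventually_ge_atTop (R * a), eventually_ge_atTop 1]
    with n hn hL hε1 hε2 hρa hρ1 hρq hRa hn1 G N S B F hG hN hS hB hF P hP
  obtain ⟨hb0', hρ1', hρn, hεn, -, hερ, hlogε⟩ := hn
  have hε0 : 0 < baseRate n ^ γ := Real.rpow_pos_of_pos hb0' _
  set ρ := baseRate n ^ (-(d : ℝ) / (d + β))
  set ε := baseRate n ^ γ
  set L := Real.log n with hLdef
  rw [pow_zero, one_mul] at hε1 hε2
  rw [pow_zero] at hρa
  rw [pow_one] at hρ1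
  have hn0 : (0 : ℝ) < n := by exact_mod_cast hn1
  have hL1 : 1 ≤ L := by linarith [Real.add_one_le_exp (1 : ℝ)]
  have hloglog : 1 ≤ Real.log L := by
    rw [Real.le_log_iff_exp_le (by linarith)]; exact hL
  -- the number of grid points per axis
  set x : ℝ := (a * ρ) ^ (1 / (d : ℝ)) with hx
  have hx1 : 1 ≤ x := Real.one_le_rpow hρa (by positivity)
  have hxd : x ^ d = a * ρ := by
    rw [hx, ← Real.rpow_natCast, ← Real.rpow_mul (by linarith), one_div_mul_cancel hd'.ne',
      Real.rpow_one]
  set K := ⌊x⌋₊ with hK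
  have hKpos : 0 < K := Nat.floor_pos.2 hx1
  have hK1 : (1 : ℝ) ≤ K := by exact_mod_cast hKpos
  have hKx : (K : ℝ) ≤ x := Nat.floor_le (by linarith)
  have hxK : x ≤ 2 * K := by linarith [Nat.lt_floor_add_one x]
  have hKd : (K : ℝ) ^ d ≤ a * ρ := by rw [← hxd]; gcongr
  have hKd' : a * ρ ≤ 2 ^ d * (K : ℝ) ^ d := by rw [← hxd, ← mul_pow]; gcongr
  have hKd0 : (0 : ℝ) < (K : ℝ) ^ d := by positivity
  -- the number of iterations
  set t := ⌈A * L⌉₊ with ht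
  have htpos : 0 < t := Nat.ceil_pos.2 (by positivity)
  have htA : (t : ℝ) ≤ (A + 1) * L := by
    linarith [Nat.ceil_lt_add_one (show 0 ≤ A * L by positivity)]
  have h2t : (n : ℝ) ^ (q + 3) ≤ 2 ^ t := by
    have h1 : (2 : ℝ) ^ t = Real.exp (Real.log 2 * t) := by
      rw [Real.exp_mul, Real.exp_log (by norm_num), Real.rpow_natCast]
    have h2 : (n : ℝ) ^ (q + 3) = Real.exp (L * (q + 3 : ℕ)) := by
      rw [Real.exp_mul, Real.exp_log hn0, Real.rpow_natCast]
    rw [h1, h2]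
    refine Real.exp_le_exp.2 ?_
    have h3 := Real.log_two_gt_d9
    have h4 : A * L ≤ t := Nat.le_ceil _
    calc L * (q + 3 : ℕ) = 1 / 2 * (A * L) := by rw [hA]; push_cast; ring
      _ ≤ Real.log 2 * t := by gcongr; linarith
  have hlog : Real.log (1 / ε) ≤ L := by
    refine Real.log_le_log (by positivity) ?_
    rw [div_le_iff₀ hε0]
    rw [div_le_iff₀ hn0] at hεn
    linarith
  have hlog0 : 0 ≤ Real.log (1 / ε) := Real.log_nonneg (by
    rw [le_div_iff₀ hε0]; linarith)
  have hsa : Real.log (1 / ε) / (K : ℝ) ^ d ≤ 2 ^ d / a * (L / ρ) := by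
    rw [div_mul_div_comm, div_le_div_iff₀ hKd0 (by positivity)]
    calc Real.log (1 / ε) * (a * ρ) ≤ L * (2 ^ d * (K : ℝ) ^ d) := by gcongr
      _ = _ := by ring
  have hT := hnet (K := K) (t := t) (δ := ε) (b := b) hKpos htpos hε0 hε1 (hsa.trans ?_) ?_ ?_ ?_
    P hP
  · obtain ⟨T, h1, h2, h3, h4, h5, h6⟩ := hT
    refine ⟨fun x => T.eval fun i => x i, ⟨T, fun x => rfl, ?_, ?_, ?_, h4.mono hB, ?_⟩, h6⟩
    · calc (T.depth : ℝ) ≤ Q * t := by exact_mod_cast h1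
        _ ≤ Q * ((A + 1) * L) := by gcongr
        _ ≤ G := by linarith
    · calc (T.width : ℝ) ≤ Q * (K : ℝ) ^ d := by exact_mod_cast h2
        _ ≤ Q * (a * ρ) := by gcongr
        _ ≤ Q * (c₁ / Q * ρ) := by gcongr; exact min_le_left _ _
        _ = c₁ * ρ := by field_simp
        _ ≤ N := hN
    · calc (T.numNonzero : ℝ) ≤ Q * (K : ℝ) ^ d * t := by exact_mod_cast h3
        _ ≤ Q * (a * ρ) * ((A + 1) * L) := by gcongr
        _ ≤ Q * (c₂ / (Q * (A + 1)) * ρ) * ((A + 1) * L) := by gcongr; exact min_le_right _ _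
        _ = c₂ * (ρ * L) := by field_simp
        _ ≤ S := hS
    · intro y hy
      refine (h5 (fun i => y i) hy).trans ?_
      have h7 : γ * 1 ≤ γ * Real.log L := by gcongr
      have h8 : γ * (L - 5 * Real.log L) = γ * L - 5 * (γ * Real.log L) := by ring
      rw [hlogε, h8]
      linarith only [h7, hε2, hF]
  · rw [div_mul_div_comm, div_le_iff₀ (by positivity)]
    rw [div_mul_eq_mul_div, le_div_iff₀ (by positivity)] at hρ1
    linarith
  · have h7 : (1 / (n : ℝ)) ^ (q + 1) ≤ ε ^ (q + 1) := by gcongr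
    calc R * (K : ℝ) ^ d ≤ R * (a * ρ) := by gcongr
      _ = R * a * ρ := by ring
      _ ≤ n * n := by gcongr
      _ = (n : ℝ) ^ (q + 3) * (1 / (n : ℝ)) ^ (q + 1) := by
        rw [one_div_pow]; field_simp; ring
      _ ≤ _ := by gcongr
  · -- here `q + 1 ≥ β / d + 1` pays for the logarithms
    have h7 : ρ ^ (q + 1) * ε ≥ ρ := by
      have : (1 : ℝ) ≤ (q + 1 : ℕ) + -(β / d) := by
        push_cast
        linarith [Nat.le_ceil (β / d)]
      rw [hερ, ← Real.rpow_natCast, ← Real.rpow_add (by linarith)]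
      calc ρ = ρ ^ (1 : ℝ) := (Real.rpow_one _).symm
        _ ≤ _ := Real.rpow_le_rpow_of_exponent_le hρ1' this
    calc 4 * (2 * (Real.log (1 / ε) / (K : ℝ) ^ d)) ^ (q + 1)
        ≤ 4 * (2 * (2 ^ d / a * (L / ρ))) ^ (q + 1) := by gcongr
      _ = 4 * (2 ^ (d + 1) / a) ^ (q + 1) * L ^ (q + 1) / ρ ^ (q + 1) := by
        rw [show 2 * (2 ^ d / a * (L / ρ)) = 2 ^ (d + 1) / a * L / ρ by field_simp; ring, div_pow,
          mul_pow]
        ring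
      _ ≤ ρ / ρ ^ (q + 1) := by
        gcongr
        rw [one_div_mul_eq_div, le_div_iff₀ (by positivity)] at hρq
        linarith
      _ ≤ ε := by
        rw [div_le_iff₀ (by positivity)]
        linarith
  · calc (1 / (K : ℝ)) ^ β ≤ (2 / x) ^ β := by
          refine Real.rpow_le_rpow (by positivity) ?_ hβ.le
          rw [div_le_div_iff₀ (by positivity) (by positivity)]
          linarith
      _ = b * ε := by
        have h7 : x ^ β = (a * ρ) ^ (β / d) := by
          rw [hx, ← Real.rpow_mul (by positivity)]
          congr 1
          ring
        rw [Real.div_rpow (by norm_num) (by positivity), h7, hb, hερ, mul_assoc,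
          ← Real.mul_rpow ha0.le (by positivity), Real.rpow_neg (by positivity)]
        rfl

/-! ### Estimation at the logarithmic rate -/

/-- The resolution `η` of the parameter grid that makes the covering radius at most `1 / n`, and the
size of the resulting logarithm of the covering number, for networks of logarithmic depth with
polynomially bounded parameters. -/
lemma exists_resolution {n d g M s V : ℕ} {B L Cg Cs ρ : ℝ} (hn : 6 ≤ n) (hL : L = Real.log n)
    (hL1 : 1 ≤ L) (hρ : 1 ≤ ρ) (hB1 : 1 ≤ B) (hB : B ≤ (n : ℝ) ^ V) (hg : g + 1 ≤ n)
    (hM : (((max d M : ℕ) : ℝ) + 2) ≤ (n : ℝ) ^ 2) (hgL : (g : ℝ) ≤ Cg * L)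
    (hs : (s : ℝ) ≤ Cs * (ρ * L)) (hCs : 0 ≤ Cs) :
    ∃ η : ℝ, 0 < η ∧
      (g + 1) * ((((max d M : ℕ) : ℝ) + 2) * B) ^ g * ((((max d M : ℕ) : ℝ) + 2) * η) ≤ 1 / n ∧
      Real.log (((g + 1) * ((g + 1) * ((max d M + 1) * (max d M + 2)) *
        (2 * ⌈B / η⌉₊ + 1) + 1) ^ s : ℕ) : ℝ) ≤
          (1 + Cs * (10 + V + (2 + V) * Cg)) * (ρ * L ^ 3) := by
  set m : ℕ := max d M with hm
  have hn6 : (6 : ℝ) ≤ n := by exact_mod_cast hn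
  have hn0 : (0 : ℝ) < n := by linarith
  have hg' : (g : ℝ) + 1 ≤ n := by exact_mod_cast hg
  set X : ℝ := (g + 1) * ((m + 2) * B) ^ g * (m + 2) with hX
  have hX0 : 0 < X := by positivity
  have hXn : X ≤ (n : ℝ) ^ (3 + (2 + V) * g) := by
    calc X ≤ n * ((n : ℝ) ^ 2 * (n : ℝ) ^ V) ^ g * (n : ℝ) ^ 2 := by rw [hX]; gcongr
      _ = _ := by rw [← pow_add, ← pow_mul]; ring
  set E : ℕ := V + (1 + (3 + (2 + V) * g)) with hE
  have hBX : B * (n * X) ≤ (n : ℝ) ^ E := by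
    calc B * (n * X) ≤ (n : ℝ) ^ V * (n * (n : ℝ) ^ (3 + (2 + V) * g)) := by gcongr
      _ = _ := by rw [hE, ← pow_succ', ← pow_add]; congr 1; ring
  refine ⟨1 / (n * X), by positivity, ?_, ?_⟩
  · refine le_of_eq ?_
    rw [hX]
    field_simp
  · have hceil : (⌈B / (1 / (n * X))⌉₊ : ℝ) ≤ (n : ℝ) ^ E + 1 := by
      rw [div_div_eq_mul_div, div_one]
      linarith [Nat.ceil_lt_add_one (show 0 ≤ B * (n * X) by positivity)]
    set c := ⌈B / (1 / (n * X))⌉₊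
    have h1n : (1 : ℝ) ≤ (n : ℝ) ^ E := one_le_pow₀ (by linarith)
    have h1n5 : (1 : ℝ) ≤ (n : ℝ) ^ 5 := one_le_pow₀ (by linarith)
    have hbase : ((g : ℝ) + 1) * ((m + 1) * (m + 2)) * (2 * c + 1) + 1 ≤ (n : ℝ) ^ (6 + E) := by
      have hm1 : (m : ℝ) + 1 ≤ (n : ℝ) ^ 2 := by linarith
      calc ((g : ℝ) + 1) * ((m + 1) * (m + 2)) * (2 * c + 1) + 1
          ≤ n * ((n : ℝ) ^ 2 * (n : ℝ) ^ 2) * (5 * (n : ℝ) ^ E) + 1 * 1 := by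
            gcongr
            · linarith
            · norm_num
        _ ≤ (n : ℝ) ^ 5 * (5 * (n : ℝ) ^ E) + (n : ℝ) ^ 5 * (n : ℝ) ^ E := by
            have : n * ((n : ℝ) ^ 2 * (n : ℝ) ^ 2) = (n : ℝ) ^ 5 := by ring
            rw [this]
            gcongr
        _ = 6 * ((n : ℝ) ^ 5 * (n : ℝ) ^ E) := by ring
        _ ≤ n * ((n : ℝ) ^ 5 * (n : ℝ) ^ E) := by gcongr
        _ = _ := by ring
    have hexp : ((6 + E : ℕ) : ℝ) ≤ (10 + V + (2 + V) * Cg) * L := by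
      rw [hE]
      push_cast
      have h1 : (2 + (V : ℝ)) * g ≤ (2 + V) * (Cg * L) := by gcongr
      have h2 : (10 + (V : ℝ)) * 1 ≤ (10 + V) * L := by gcongr
      linarith
    push_cast
    rw [Real.log_mul (by positivity) (by positivity), Real.log_pow]
    have hlog1 : Real.log ((g : ℝ) + 1) ≤ L := by
      rw [hL]
      exact Real.log_le_log (by positivity) hg'
    have hlog2 : Real.log (((g : ℝ) + 1) * ((m + 1) * (m + 2)) * (2 * c + 1) + 1) ≤
        (10 + V + (2 + V) * Cg) * L * L := by
      calc _ ≤ Real.log ((n : ℝ) ^ (6 + E)) := Real.log_le_log (by positivity) hbase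
        _ = (6 + E : ℕ) * L := by rw [Real.log_pow, hL]
        _ ≤ _ := by gcongr
    have hLρ : L ≤ ρ * L ^ 3 := by
      calc L = 1 * (L ^ 1) := by ring
        _ ≤ ρ * L ^ 3 := by gcongr; norm_num
    calc Real.log ((g : ℝ) + 1) +
          s * Real.log (((g : ℝ) + 1) * ((m + 1) * (m + 2)) * (2 * c + 1) + 1)
        ≤ ρ * L ^ 3 + Cs * (ρ * L) * ((10 + V + (2 + V) * Cg) * L * L) := by
          gcongr
          · exact hlog1.trans hLρ
          · refine Real.log_nonneg ?_
            have : 0 ≤ ((g : ℝ) + 1) * ((m + 1) * (m + 2)) * (2 * c + 1) := by positivity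
            linarith
      _ = _ := by ring

lemma natFloor_le_of_le {x y : ℝ} (hy : 0 ≤ y) (h : x ≤ y) : (⌊x⌋₊ : ℝ) ≤ y :=
  (Nat.cast_le.2 (Nat.floor_mono h)).trans (Nat.floor_le hy)

/-- The estimation error of an empirical risk minimizer over networks of logarithmic depth with
at most `ρ log n` parameters, `ρ = (log n ^ 5 / n) ^ (-d / (d + β))`, matches the approximation
rate. Of the five logarithms, three come from the covering number and one from the bound on the
class. -/
theorem eventually_lintegral_klRisk_le {d : ℕ} (hd : 0 < d) {β : ℝ} (hβ : 0 < β)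
    {ν Cg Cn Cs Cb Cf : ℝ} (hCg : 0 ≤ Cg) (hCn : 0 ≤ Cn) (hCs : 0 ≤ Cs)
    (hCf : 0 ≤ Cf) :
    ∃ C : ℝ, 0 < C ∧ ∀ᶠ n : ℕ in atTop, ∀ G N S B F : ℝ, G ≤ Cg * Real.log n →
      N ≤ Cn * baseRate n ^ (-(d : ℝ) / (d + β)) →
      S ≤ Cs * (baseRate n ^ (-(d : ℝ) / (d + β)) * Real.log n) → 1 ≤ B → B ≤ Cb * (n : ℝ) ^ ν →
      F ≤ Cf * Real.log n → ∀ est : (Fin n → DataPoint d) → EuclideanSpace ℝ (Fin d) → ℝ,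
        IsLogisticERM (fnnClass d G N S B F) est → ∀ (P : ProbabilityMeasure (DataPoint d)) (κ : ℝ),
        (∃ f ∈ fnnClass d G N S B F, klRisk (P : Measure (DataPoint d)) (fun x => f x) ≤ κ) →
        ∫⁻ z, ENNReal.ofReal (klRisk (P : Measure (DataPoint d)) fun x => est z x)
            ∂(Measure.pi fun _ : Fin n => (P : Measure (DataPoint d))) ≤
          ENNReal.ofReal (2 * κ + C * baseRate n ^ (β / (d + β))) := by
  set V := ⌈ν⌉₊ + 1 with hV
  set D : ℝ := 1 + Cs * (10 + V + (2 + V) * Cg) with hD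
  have hD0 : 0 < D := by positivity
  refine ⟨3 + 2 * (Cf + 4) * D, by positivity, ?_⟩
  have hlog := (Real.isLittleO_log_id_atTop.bound (show 0 < 1 / (Cg + 1) by positivity))
  filter_upwards [eventually_baseRate hd hβ, tendsto_log_natCast.eventually_ge_atTop 1,
    tendsto_natCast_atTop_atTop.eventually_ge_atTop Cb,
    tendsto_natCast_atTop_atTop.eventually_ge_atTop (Cn + d + 2),
    tendsto_natCast_atTop_atTop.eventually hlog, eventually_ge_atTop 6]
    with n hn hL hnb hnd hnL hn6 G N S B F hG hN hS hB1 hB hF est hest P κ hf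
  obtain ⟨hb0, hρ1, hρn, hεn, hερ, -, -⟩ := hn
  set ρ := baseRate n ^ (-(d : ℝ) / (d + β))
  set ε := baseRate n ^ (β / (d + β))
  set L := Real.log n with hLdef
  obtain ⟨f, hf, hκ⟩ := hf
  have hn6' : (6 : ℝ) ≤ n := by exact_mod_cast hn6
  have hn0 : (0 : ℝ) < n := by linarith
  have hgL : (⌊G⌋₊ : ℝ) ≤ Cg * L := natFloor_le_of_le (by positivity) hG
  have hsL : (⌊S⌋₊ : ℝ) ≤ Cs * (ρ * L) := natFloor_le_of_le (by positivity) hS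
  have hNρ : (⌊N⌋₊ : ℝ) ≤ Cn * ρ := natFloor_le_of_le (by positivity) hN
  have hgn : ⌊G⌋₊ + 1 ≤ n := by
    simp only [id, Real.norm_eq_abs] at hnL
    rw [abs_of_nonneg (by linarith), abs_of_nonneg hn0.le, one_div_mul_eq_div,
      le_div_iff₀ (by positivity)] at hnL
    have : (⌊G⌋₊ : ℝ) + 1 ≤ n := by linarith
    exact_mod_cast this
  have hMn : ((max d ⌊N⌋₊ : ℕ) : ℝ) + 2 ≤ (n : ℝ) ^ 2 := by
    have h1 : ((max d ⌊N⌋₊ : ℕ) : ℝ) ≤ d + Cn * ρ := by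
      rw [Nat.cast_max]
      have : (0 : ℝ) ≤ d := by positivity
      have : (0 : ℝ) ≤ ⌊N⌋₊ := by positivity
      exact max_le (by linarith) (by linarith)
    calc ((max d ⌊N⌋₊ : ℕ) : ℝ) + 2 ≤ d * 1 + Cn * n + 2 * 1 := by
          have : Cn * ρ ≤ Cn * n := by gcongr
          linarith
      _ ≤ d * n + Cn * n + 2 * n := by gcongr <;> linarith
      _ = (Cn + d + 2) * n := by ring
      _ ≤ n * n := by gcongr
      _ = _ := by ring
  have hBn : B ≤ (n : ℝ) ^ V := by
    calc B ≤ Cb * (n : ℝ) ^ ν := hB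
      _ ≤ n * (n : ℝ) ^ (⌈ν⌉₊ : ℝ) := by
        gcongr
        · linarith
        · exact Nat.le_ceil ν
      _ = _ := by rw [Real.rpow_natCast, hV, pow_succ, mul_comm]
  obtain ⟨η, hη, h1, h2⟩ := exists_resolution hn6 hLdef hL hρ1 hB1 hBn hgn hMn hgL hsL hCs
  refine (lintegral_klRisk_le_of_isLogisticERM (by omega) hB1 hη h1 h2 hest P hf hκ).trans
    (ENNReal.ofReal_le_ofReal ?_)
  have h3 : F + 1 / n + 3 ≤ (Cf + 4) * L := by
    have : 1 / (n : ℝ) ≤ 1 := by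
      rw [div_le_one hn0]
      linarith
    linarith
  calc 2 * κ + 3 * (1 / n) + 2 * (F + 1 / n + 3) / n * (D * (ρ * L ^ 3))
      ≤ 2 * κ + 3 * ε + 2 * ((Cf + 4) * L) / n * (D * (ρ * L ^ 3)) := by gcongr
    _ = 2 * κ + 3 * ε + 2 * (Cf + 4) * D * (ρ * L ^ 4 / n) := by ring
    _ ≤ 2 * κ + 3 * ε + 2 * (Cf + 4) * D * (ρ * L ^ 5 / n) := by
      gcongr
      norm_num
    _ = _ := by rw [hερ]; ring

theorem theorem2p2 (d : ℕ) (hd : 0 < d) (β r : ℝ) (hβ : 0 < β) (hr : 0 < r) :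
    ∃ c : ℝ, 0 < c ∧
      ∀ (ν : ℝ), 0 ≤ ν →
      ∀ (G N S B F : ℕ → ℝ),
        (∀ᶠ n : ℕ in atTop, c * Real.log n ≤ G n) →
        Lesssim G (fun n => Real.log n) →
        Asymp N (fun n => baseRate n ^ (-(d : ℝ) / (d + β))) →
        Asymp S (fun n => baseRate n ^ (-(d : ℝ) / (d + β)) * Real.log n) →
        (∀ᶠ n : ℕ in atTop, 1 ≤ B n) →
        Lesssim B (fun n => (n : ℝ) ^ ν) →
        (∀ᶠ n : ℕ in atTop, β / (d + β) * Real.log n ≤ F n) →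
        Lesssim F (fun n => Real.log n) →
      ∀ (est : (n : ℕ) → (Fin n → DataPoint d) → EuclideanSpace ℝ (Fin d) → ℝ),
        (∀ᶠ n : ℕ in atTop,
          IsLogisticERM (fnnClass d (G n) (N n) (S n) (B n) (F n)) (est n)) →
        (∃ n₀ : ℕ, ∃ C : ℝ, 0 < C ∧ ∀ n ≥ n₀,
          (⨆ P ∈ holderClass d β r, expectedError P excessLogisticRisk (est n)) ≤
            ENNReal.ofReal (C * baseRate n ^ (β / (β + d)))) ∧
        (∃ n₀ : ℕ, ∃ C : ℝ, 0 < C ∧ ∀ n ≥ n₀,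
          (⨆ P ∈ holderClass d β r, expectedError P excessMisclassError (est n)) ≤
            ENNReal.ofReal (C * baseRate n ^ (β / (2 * β + 2 * d)))) := by
  obtain ⟨c, hc, happ⟩ := eventually_exists_mem_fnnClass_klRisk_le hd hβ hr
  refine ⟨c, hc, ?_⟩
  rintro ν - G N S B F hG ⟨ng, Cg, hCg, hG'⟩ ⟨⟨nn, Cn, hCn, hN'⟩, nn', Cn', hCn', hN⟩
    ⟨⟨ns, Cs, hCs, hS'⟩, ns', Cs', hCs', hS⟩ hB ⟨nb, Cb, hCb, hB'⟩ hF ⟨nf, Cf, hCf, hF'⟩ est hest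
  obtain ⟨C₁, hC₁, happ⟩ := happ (1 / Cn') (1 / Cs') (by positivity) (by positivity)
  obtain ⟨C₂, hC₂, hstat⟩ := eventually_lintegral_klRisk_le hd hβ (ν := ν) hCg.le hCn.le hCs.le
    hCf.le
  have hd' : (0 : ℝ) < d := by exact_mod_cast hd
  have hmain : ∀ᶠ n : ℕ in atTop, 0 < baseRate n ∧
      IsLogisticERM (fnnClass d (G n) (N n) (S n) (B n) (F n)) (est n) ∧
      ∀ P ∈ holderClass d β r,
        ∫⁻ z, ENNReal.ofReal (klRisk (P : Measure (DataPoint d)) fun x => est n z x)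
            ∂(Measure.pi fun _ : Fin n => (P : Measure (DataPoint d))) ≤
          ENNReal.ofReal ((2 * C₁ + C₂) * baseRate n ^ (β / (d + β))) := by
    filter_upwards [eventually_baseRate hd hβ, happ, hstat, hG, hB, hF, hest,
      eventually_ge_atTop ng, eventually_ge_atTop nn, eventually_ge_atTop nn',
      eventually_ge_atTop ns, eventually_ge_atTop ns', eventually_ge_atTop nb,
      eventually_ge_atTop nf] with n hn happ hstat hG hB hF hest h1 h2 h3 h4 h5 h6 h7
    refine ⟨hn.1, hest, fun P hP => ?_⟩
    have hf := happ (G n) (N n) (S n) (B n) (F n) hG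
      (by rw [one_div_mul_eq_div, div_le_iff₀ hCn', mul_comm]; exact hN n h3)
      (by rw [one_div_mul_eq_div, div_le_iff₀ hCs', mul_comm (S n)]; exact hS n h5) hB hF P hP
    refine (hstat (G n) (N n) (S n) (B n) (F n) (hG' n h1) (hN' n h2) (hS' n h4) hB (hB' n h6)
      (hF' n h7) (est n) hest P _ hf).trans (le_of_eq ?_)
    congr 1
    ring
  obtain ⟨n₀, hn₀⟩ := eventually_atTop.1 hmain
  refine ⟨⟨n₀, 2 * C₁ + C₂, by positivity, fun n hn => ?_⟩,
    ⟨n₀, 1 + 2 * (2 * C₁ + C₂), by positivity, fun n hn => ?_⟩⟩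
  · obtain ⟨-, hERM, h⟩ := hn₀ n hn
    rw [add_comm β]
    exact iSup₂_le fun P hP => expectedError_excessLogisticRisk_le hERM P (h P hP)
  · obtain ⟨hb, hERM, h⟩ := hn₀ n hn
    refine iSup₂_le fun P hP => ?_
    -- the threshold `τ` balances `τ` against `τ ^ 2 / τ`
    set τ := baseRate n ^ (β / (2 * β + 2 * d)) with hτ
    have hτ0 : 0 < τ := Real.rpow_pos_of_pos hb _
    have hτ2 : baseRate n ^ (β / (d + β)) = τ * τ := by
      rw [hτ, ← Real.rpow_add hb]
      congr 1
      field_simp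
      ring
    have hR := h P hP
    rw [hτ2] at hR
    refine (expectedError_excessMisclassError_le hτ0 hERM P (by positivity) hR).trans (le_of_eq ?_)
    congr 1
    field_simp

end
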